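/- Use cylindrical coordinates $(r,\theta,z)$ on $\mathbb{R}^3\subset S^3=\mathbb{R}^3\cup\{\infty\}$. A link $L$ is a smooth embedding of finitely many disjoint circles in $S^3$, considered up to smooth isotopy and without orientation. A booklink is a link $\lambda$ in $\mathbb{R}^3$ that is disjoint from the $z$-axis and on which the angle $\theta$ has only finitely many critical points, all non-degenerate; their number is even, and $\lambda$ has bridge number $d$ if it is $2d$. For an angle $\varphi$ let $H_\varphi$ be the open half-plane $\{r>0,\ \theta=\varphi\}$. The bridge-braid spectrum of $L$ is the sequence $b_0(L),b_1(L),b_2(L),\dots$, where $b_d(L)$ is the minimum of $|\lambda\cap H_\varphi|$ over all booklinks $\lambda$ isotopic to $L$ in $S^3$ with bridge number $d$ and all angles $\varphi$. The braid index of $L$ is the smallest number of strands of a closed braid around the $z$-axis (a link in $\mathbb{R}^3$ disjoint from the axis, on which $\theta$ has no critical points; its number of strands is the number of points in which it meets every $H_\varphi$) that is isotopic to $L$. The bridge index of $L$ is the smallest number of local maxima of the height $z$ on a link in $\mathbb{R}^3$ that is isotopic to $L$ in $S^3$ and on which $z$ has only non-degenerate critical points. Corollary 5.3. If $L$ is a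 2-bridge link, that is, a link with bridge index $2$, and $L$ has braid index $n$, then the bridge-braid spectrum of $L$ is $(n,1,0)$, i.e. $b_0(L)=n$, $b_1(L)=1$, and $b_d(L)=0$ for all $d\ge 2$. -/

import Mathlib

open scoped ContDiff

noncomputable section

namespace BridgeBraid

/-- Euclidean 3-space, with coordinates `x 0`, `x 1`, `x 2`; the braid axis is the `x 2`-axis. -/
abbrev R3 : Type := EuclideanSpace ℝ (Fin 3)

/-- Euclidean 4-space. -/
abbrev R4 : Type := EuclideanSpace ℝ (Fin 4)

/-- The 3-sphere, as the unit sphere of 4-space. -/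
def S3 : Set R4 := Metric.sphere 0 1

/-- A `k`-component link in `X ⊆ E`: a smooth embedding in `X` of a disjoint union of `k` circles.
The `i`-th circle is `ℝ / ℤ`, so that its embedding is a smooth regular curve `γ i : ℝ → E` of
period `1`; the whole map is injective on the disjoint union of the circles. (The circles are
compact, so an injective immersion is an embedding.) -/
structure IsLink {E : Type} [NormedAddCommGroup E] [NormedSpace ℝ E] (X : Set E) {k : ℕ}
    (γ : Fin k → ℝ → E) : Prop where
  smooth : ∀ i, ContDiff ℝ ∞ (γ i)
  periodic : ∀ i, Function.Periodic (γ i) 1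
  mem : ∀ i t, γ i t ∈ X
  immersion : ∀ i t, deriv (γ i) t ≠ 0
  injective : ∀ i j s t, γ i s = γ j t → i = j ∧ ∃ m : ℤ, t = s + m

/-- Smooth isotopy of links in `X`: a jointly smooth one-parameter family of links in `X` from `γ`
to `γ'`. The time runs through all of `ℝ`; a family over `[0, 1]` is extended by slowing the time
down smoothly at `0` and `1`. -/
def Isotopic {E : Type} [NormedAddCommGroup E] [NormedSpace ℝ E] (X : Set E) {k : ℕ}
    (γ γ' : Fin k → ℝ → E) : Prop :=
  ∃ F : ℝ → Fin k → ℝ → E,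
    (∀ i, ContDiff ℝ ∞ (fun p : ℝ × ℝ => F p.1 i p.2)) ∧
    (∀ s, IsLink X (F s)) ∧ F 0 = γ ∧ F 1 = γ'

/-- Inverse stereographic projection, which identifies 3-space with the complement of the point
`(0, 0, 0, 1)` in the 3-sphere. -/
def stereoInv (x : R3) : R4 :=
  (‖x‖ ^ 2 + 1)⁻¹ • !₂[2 * x 0, 2 * x 1, 2 * x 2, ‖x‖ ^ 2 - 1]

/-- `γ` is a representative in 3-space of the link type of the link `L` in the 3-sphere. -/
structure Represents {k : ℕ} (γ : Fin k → ℝ → R3) (L : Fin k → ℝ → R4) : Prop where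
  isLink : IsLink Set.univ γ
  isotopic : Isotopic S3 (fun i t => stereoInv (γ i t)) L

/-! ### The angular coordinate -/

/-- The projection of a point of 3-space along the axis, as a complex number `r * exp (θ * I)`
where `(r, θ, z)` are the cylindrical coordinates of the point. -/
def planar (x : R3) : ℂ := ⟨x 0, x 1⟩

/-- The derivative of the angular coordinate `θ` along a curve `c` that avoids the axis, as the
imaginary part of the logarithmic derivative of `r * exp (θ * I)`. -/
def angularVelocity (c : ℝ → R3) (t : ℝ) : ℝ :=
  (deriv (fun s => planar (c s)) t / planar (c t)).im

/-- The page `H_θ`: the open half-plane of all points off the axis whose angle is `θ`. -/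
def page (θ : ℝ) : Set R3 :=
  {x | ∃ r : ℝ, 0 < r ∧ x 0 = r * Real.cos θ ∧ x 1 = r * Real.sin θ}

/-- The set of points of the link parametrized by `γ`. -/
def support {k : ℕ} (γ : Fin k → ℝ → R3) : Set R3 := {x | ∃ i t, γ i t = x}

/-- The critical points of `θ` on a link, as parameters in the union of `k` circles. -/
def angularCritical {k : ℕ} (γ : Fin k → ℝ → R3) : Set (Fin k × ℝ) :=
  {p | p.2 ∈ Set.Ico (0 : ℝ) 1 ∧ angularVelocity (γ p.1) p.2 = 0}

/-- A booklink with `d` pairs of critical points: a link off the axis on which `θ` has only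
non-degenerate critical points, `2 * d` in number. -/
structure IsBooklink {k : ℕ} (γ : Fin k → ℝ → R3) (d : ℕ) : Prop where
  isLink : IsLink Set.univ γ
  off_axis : ∀ i t, planar (γ i t) ≠ 0
  nondegenerate : ∀ i t, angularVelocity (γ i) t = 0 → deriv (angularVelocity (γ i)) t ≠ 0
  card_critical : (angularCritical γ).encard = 2 * (d : ℕ∞)

/-- The smallest number of intersections of a link with a page. -/
def pageNumber {k : ℕ} (γ : Fin k → ℝ → R3) : ℕ∞ :=
  ⨅ θ : ℝ, (support γ ∩ page θ).encard

/-- The bridge-braid spectrum of the link `L` in the 3-sphere: `spectrum L d` is the smallest `n`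
for which the link type of `L` has a booklink representative with `d` pairs of critical points
that meets some page in `n` points (`⊤` if there is no such representative). -/
def spectrum {k : ℕ} (L : Fin k → ℝ → R4) (d : ℕ) : ℕ∞ :=
  sInf {n : ℕ∞ | ∃ γ : Fin k → ℝ → R3, Represents γ L ∧ IsBooklink γ d ∧ pageNumber γ = n}

/-! ### The classical indices -/

/-- A closed braid on `n` strands around the axis: a link off the axis on which `θ` has no critical
point, and which meets every page in `n` points. Links are not oriented: each component winds
monotonically, and it may be oriented by increasing `θ`. -/
structure IsClosedBraid {k : ℕ} (γ : Fin k → ℝ → R3) (n : ℕ) : Prop where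
  isLink : IsLink Set.univ γ
  off_axis : ∀ i t, planar (γ i t) ≠ 0
  monotone : ∀ i t, angularVelocity (γ i) t ≠ 0
  strands : ∀ θ : ℝ, (support γ ∩ page θ).encard = n

/-- The braid index: the smallest number of strands of a closed braid that represents the link. -/
def braidIndex {k : ℕ} (L : Fin k → ℝ → R4) : ℕ∞ :=
  sInf {n : ℕ∞ | ∃ (γ : Fin k → ℝ → R3) (m : ℕ), Represents γ L ∧ IsClosedBraid γ m ∧ n = m}

/-- The height function `x ↦ x 2` has only non-degenerate critical points on the link. -/
def HeightMorse {k : ℕ} (γ : Fin k → ℝ → R3) : Prop :=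
  ∀ i t, deriv (fun s => γ i s 2) t = 0 → deriv (deriv (fun s => γ i s 2)) t ≠ 0

/-- The local maxima of the height function on a link, as parameters in the union of `k` circles. -/
def heightMaxima {k : ℕ} (γ : Fin k → ℝ → R3) : Set (Fin k × ℝ) :=
  {p | p.2 ∈ Set.Ico (0 : ℝ) 1 ∧ IsLocalMax (fun s => γ p.1 s 2) p.2}

/-- The bridge index: the smallest number of local maxima of the height function on a
representative of the link on which all critical points of the height are non-degenerate. -/
def bridgeIndex {k : ℕ} (L : Fin k → ℝ → R4) : ℕ∞ :=
  sInf {b : ℕ∞ | ∃ γ : Fin k → ℝ → R3,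
    Represents γ L ∧ HeightMorse γ ∧ (heightMaxima γ).encard = b}

end BridgeBraid

end

/-! Two of the three values come from reading the angle as a height or as a winding. A booklink
without critical points is a closed braid, and a closed braid meets all pages equally often, so the
value at `0` is the braid index (`spectrum_zero`). A booklink that misses a page lies in the
complement of a closed half-plane bounded by the axis. The logarithm of the planar coordinate `r *
exp (θ * I)` unrolls this complement and makes `θ` a linear coordinate, which a turn of space makes
the height. Conversely a Morse height, squeezed into `(-π, π)`, is wrapped around the axis by the
exponential. Hence a link has a booklink with `d` pairs of critical points that misses a page
exactly when it has a Morse position with `d` maxima (`exists_height_of_booklink`,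
`exists_booklink_of_height`). Bridge index `2` therefore rules out the value `0` at `d = 1`. It also
gives the value `0` at all `d ≥ 2`, because small folds add pairs of critical points of the height
at will (`exists_two_more_critical`).

The remaining claim, that the value at `1` is at most `1`, trades a minimum and a maximum of the
height for one intersection with a page (`exists_booklink_of_height_succ`). Take an arc that ascends
from a minimum to the next maximum. In general position no point of the link lies vertically above
the maximum or vertically below the minimum (`exists_shear_above`, `exists_shear_below`). Then a
translation of every horizontal plane, followed by a dilation, puts the arc inside the unit cylinder
and the rest of the link outside (`exists_isTube`).

Now use the open book whose binding is the unit circle at height `0` and whose angle is the argument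
of `|p|² - 1 + 2 * z * I`; a rotation of the 3-sphere carries its binding to the axis
(`represents_bookMap`). Away from the cylinder a vertical rescaling makes the angle `arctan (2 *
h)`, with the critical points of the height `h`. Along the arc, and in a small collar beyond its
ends, the angle is monotone, so exactly the two ends disappear as critical points. The page at angle
`π` is the open unit disc at height `0`, which the link can meet only where the ascending arc passes
through it, at most once (`exists_booklink_of_isTube`).

All isotopies are given by formulas in the planar coordinate `p` and the height `h`, so that each
one reduces to checking injectivity and immersion at every time. -/

noncomputable section

namespace BridgeBraid

/-! ### Links in coordinates -/

/-- The point with planar coordinate `w` and height `z`. -/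
def mk (w : ℂ) (z : ℝ) : R3 := !₂[w.re, w.im, z]

@[simp] lemma planar_mk (w : ℂ) (z : ℝ) : planar (mk w z) = w := rfl

@[simp] lemma mk_zero (w : ℂ) (z : ℝ) : mk w z 0 = w.re := rfl

@[simp] lemma mk_one (w : ℂ) (z : ℝ) : mk w z 1 = w.im := rfl

@[simp] lemma mk_two (w : ℂ) (z : ℝ) : mk w z 2 = z := rfl

lemma mk_planar (x : R3) : mk (planar x) (x 2) = x := by
  ext i; fin_cases i <;> rfl

lemma mk_inj {w w' : ℂ} {z z' : ℝ} : mk w z = mk w' z' ↔ w = w' ∧ z = z' := by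
  refine ⟨fun h => ⟨?_, ?_⟩, ?_⟩
  · simpa using congrArg planar h
  · simpa using congrArg (fun x : R3 => x 2) h
  · rintro ⟨rfl, rfl⟩; rfl

/-- The link with planar coordinates `p` and heights `h`. -/
def curve {k : ℕ} (p : Fin k → ℝ → ℂ) (h : Fin k → ℝ → ℝ) : Fin k → ℝ → R3 :=
  fun i t => mk (p i t) (h i t)

lemma curve_coords {k : ℕ} (γ : Fin k → ℝ → R3) :
    curve (fun i t => planar (γ i t)) (fun i t => γ i t 2) = γ := by
  funext i t; exact mk_planar _

/-- The conditions for a link, in terms of its planar coordinates and heights. -/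
structure IsLinkData {k : ℕ} (p : Fin k → ℝ → ℂ) (h : Fin k → ℝ → ℝ) : Prop where
  smooth_p : ∀ i, ContDiff ℝ ∞ (p i)
  smooth_h : ∀ i, ContDiff ℝ ∞ (h i)
  periodic_p : ∀ i, Function.Periodic (p i) 1
  periodic_h : ∀ i, Function.Periodic (h i) 1
  immersion : ∀ i t, deriv (p i) t = 0 → deriv (h i) t ≠ 0
  injective : ∀ i j s t, p i s = p j t → h i s = h j t → i = j ∧ ∃ m : ℤ, t = s + m

section Smoothness

variable {E : Type*} [NormedAddCommGroup E] [NormedSpace ℝ E] {n : WithTop ℕ∞}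

lemma contDiff_mk {p : E → ℂ} {h : E → ℝ} (hp : ContDiff ℝ n p) (hh : ContDiff ℝ n h) :
    ContDiff ℝ n (fun x => mk (p x) (h x)) := by
  rw [contDiff_euclidean]
  intro i
  fin_cases i
  · exact Complex.reCLM.contDiff.comp hp
  · exact Complex.imCLM.contDiff.comp hp
  · exact hh

lemma contDiff_planar : ContDiff ℝ n planar := by
  have : planar = fun x : R3 => Complex.equivRealProdCLM.symm (x 0, x 1) := by
    funext x
    apply Complex.ext <;> simp [planar]
  rw [this]
  refine Complex.equivRealProdCLM.symm.contDiff.comp (ContDiff.prodMk ?_ ?_) <;> fun_prop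

lemma contDiff_height : ContDiff ℝ n (fun x : R3 => x 2) := by fun_prop

lemma hasDerivAt_mk {p : ℝ → ℂ} {h : ℝ → ℝ} {p' : ℂ} {h' t : ℝ} (hp : HasDerivAt p p' t)
    (hh : HasDerivAt h h' t) : HasDerivAt (fun s => mk (p s) (h s)) (mk p' h') t := by
  let l : ℂ × ℝ →ₗ[ℝ] R3 :=
    { toFun := fun q => mk q.1 q.2
      map_add' := fun q q' => by ext i; fin_cases i <;> simp [mk]
      map_smul' := fun c q => by ext i; fin_cases i <;> simp [mk] }
  exact l.toContinuousLinearMap.hasFDerivAt.comp_hasDerivAt t (hp.prodMk hh)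

end Smoothness

lemma mk_eq_zero {w : ℂ} {z : ℝ} : mk w z = 0 ↔ w = 0 ∧ z = 0 := by
  have : (0 : R3) = mk 0 0 := by ext i; fin_cases i <;> simp [mk]
  rw [this, mk_inj]

variable {k : ℕ}

lemma isLink_curve_iff {p : Fin k → ℝ → ℂ} {h : Fin k → ℝ → ℝ} :
    IsLink Set.univ (curve p h) ↔ IsLinkData p h := by
  constructor
  · intro H
    have sp : ∀ i, ContDiff ℝ ∞ (p i) := fun i => contDiff_planar.comp (H.smooth i)
    have sh : ∀ i, ContDiff ℝ ∞ (h i) := fun i => contDiff_height.comp (H.smooth i)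
    refine ⟨sp, sh, fun i t => ?_, fun i t => ?_, fun i t h0 h1 => ?_, fun i j s t h0 h1 => ?_⟩
    · simpa [curve] using congrArg planar (H.periodic i t)
    · simpa [curve] using congrArg (fun x : R3 => x 2) (H.periodic i t)
    · apply H.immersion i t
      have := hasDerivAt_mk ((sp i).differentiable (by simp) t).hasDerivAt
        ((sh i).differentiable (by simp) t).hasDerivAt
      rw [show curve p h i = fun s => mk (p i s) (h i s) from rfl, this.deriv, h0, h1]
      exact mk_eq_zero.2 ⟨rfl, rfl⟩
    · exact H.injective i j s t (mk_inj.2 ⟨h0, h1⟩)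
  · intro H
    refine ⟨fun i => contDiff_mk (H.smooth_p i) (H.smooth_h i), fun i t => ?_,
      fun _ _ => trivial, fun i t h0 => ?_, fun i j s t h0 => ?_⟩
    · exact mk_inj.2 ⟨H.periodic_p i t, H.periodic_h i t⟩
    · have := hasDerivAt_mk ((H.smooth_p i).differentiable (by simp) t).hasDerivAt
        ((H.smooth_h i).differentiable (by simp) t).hasDerivAt
      rw [show curve p h i = fun s => mk (p i s) (h i s) from rfl, this.deriv, mk_eq_zero] at h0
      exact H.immersion i t h0.1 h0.2
    · exact H.injective i j s t (mk_inj.1 h0).1 (mk_inj.1 h0).2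

/-! ### Isotopies -/

section Isotopies

variable {E : Type} [NormedAddCommGroup E] [NormedSpace ℝ E] {X : Set E}

/-- `Real.smoothTransition` as a new time takes values in `[0, 1]` only, so links are needed only
there although `Isotopic` runs over all real times. -/
lemma isotopic_of_unitInterval (F : ℝ → Fin k → ℝ → E)
    (hF : ∀ i, ContDiff ℝ ∞ (fun q : ℝ × ℝ => F q.1 i q.2))
    (hlink : ∀ s ∈ Set.Icc (0 : ℝ) 1, IsLink X (F s)) : Isotopic X (F 0) (F 1) := by
  refine ⟨fun s => F (Real.smoothTransition s), fun i => ?_, fun s => ?_, ?_, ?_⟩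
  · have : ContDiff ℝ ∞ (fun q : ℝ × ℝ => (Real.smoothTransition q.1, q.2)) :=
      (Real.smoothTransition.contDiff.comp contDiff_fst).prodMk contDiff_snd
    exact (hF i).comp this
  · exact hlink _ ⟨Real.smoothTransition.nonneg s, Real.smoothTransition.le_one s⟩
  · simp [Real.smoothTransition.zero]
  · simp [Real.smoothTransition.one]

lemma Isotopic.symm {γ γ' : Fin k → ℝ → E} (H : Isotopic X γ γ') : Isotopic X γ' γ := by
  obtain ⟨F, h1, h2, h3, h4⟩ := H
  refine ⟨fun s => F (1 - s), fun i => ?_, fun s => h2 _, by simpa using h4, by simpa using h3⟩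
  have : ContDiff ℝ ∞ (fun q : ℝ × ℝ => (1 - q.1, q.2)) := by fun_prop
  exact (h1 i).comp this

lemma Isotopic.trans {γ γ' γ'' : Fin k → ℝ → E} (H : Isotopic X γ γ') (H' : Isotopic X γ' γ'') :
    Isotopic X γ γ'' := by
  obtain ⟨F, h1, h2, h3, h4⟩ := H
  obtain ⟨G, g1, g2, g3, g4⟩ := H'
  -- Both reparametrized families rest at `γ'` for times in `(1/3, 2/3)`, so the concatenation at
  -- `1/2` is smooth.
  let σ := Real.smoothTransition
  have e1 : ∀ s : ℝ, 1 / 3 < s → F (σ (3 * s)) = γ' := fun s hs => by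
    rw [show σ (3 * s) = 1 from Real.smoothTransition.one_of_one_le (by linarith), h4]
  have e2 : ∀ s : ℝ, s < 2 / 3 → G (σ (3 * s - 2)) = γ' := fun s hs => by
    rw [show σ (3 * s - 2) = 0 from Real.smoothTransition.zero_of_nonpos (by linarith), g3]
  let K : ℝ → Fin k → ℝ → E := fun s => if s < 1 / 2 then F (σ (3 * s)) else G (σ (3 * s - 2))
  have k1 : ∀ s : ℝ, s < 2 / 3 → K s = F (σ (3 * s)) := fun s hs => by
    by_cases h : s < 1 / 2
    · simp only [K, if_pos h]
    · simp only [K, if_neg h]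
      rw [e2 s hs, e1 s (by linarith)]
  have k2 : ∀ s : ℝ, 1 / 3 < s → K s = G (σ (3 * s - 2)) := fun s hs => by
    by_cases h : s < 1 / 2
    · simp only [K, if_pos h]
      rw [e2 s (by linarith), e1 s (by linarith)]
    · simp only [K, if_neg h]
  refine ⟨K, fun i => ?_, fun s => ?_, ?_, ?_⟩
  · rw [contDiff_iff_contDiffAt]
    rintro ⟨s, t⟩
    by_cases hs : s < 1 / 2
    · have c : ContDiff ℝ ∞ (fun q : ℝ × ℝ => (σ (3 * q.1), q.2)) :=
        (Real.smoothTransition.contDiff.comp (by fun_prop)).prodMk contDiff_snd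
      have := ((h1 i).comp c).contDiffAt (x := (s, t))
      refine this.congr_of_eventuallyEq ?_
      have o : {q : ℝ × ℝ | q.1 < 2 / 3} ∈ nhds (s, t) :=
        (isOpen_lt continuous_fst continuous_const).mem_nhds (by simp; linarith)
      filter_upwards [o] with q hq
      simp only [k1 q.1 hq, Function.comp]
    · have c : ContDiff ℝ ∞ (fun q : ℝ × ℝ => (σ (3 * q.1 - 2), q.2)) :=
        (Real.smoothTransition.contDiff.comp (by fun_prop)).prodMk contDiff_snd
      have := ((g1 i).comp c).contDiffAt (x := (s, t))
      refine this.congr_of_eventuallyEq ?_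
      have o : {q : ℝ × ℝ | 1 / 3 < q.1} ∈ nhds (s, t) :=
        (isOpen_lt continuous_const continuous_fst).mem_nhds (by simp; linarith)
      filter_upwards [o] with q hq
      simp only [k2 q.1 hq, Function.comp]
  · by_cases h : s < 1 / 2
    · simp only [K, if_pos h]; exact h2 _
    · simp only [K, if_neg h]; exact g2 _
  · rw [k1 0 (by norm_num)]; simp [σ, Real.smoothTransition.zero, h3]
  · rw [k2 1 (by norm_num)]
    norm_num [σ, Real.smoothTransition.one, g4]

end Isotopies

/-! ### Stereographic projection -/

lemma contDiff_stereoInv : ContDiff ℝ ∞ stereoInv := by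
  unfold stereoInv
  have hn : ContDiff ℝ ∞ (fun x : R3 => ‖x‖ ^ 2) := contDiff_norm_sq ℝ
  refine ContDiff.smul ((hn.add contDiff_const).inv fun x => by positivity) ?_
  rw [contDiff_euclidean]
  intro i
  fin_cases i
  · simp; fun_prop
  · simp; fun_prop
  · simp; fun_prop
  · simpa using hn.sub contDiff_const

lemma stereoInv_apply (x : R3) :
    stereoInv x 0 = (‖x‖ ^ 2 + 1)⁻¹ * (2 * x 0) ∧ stereoInv x 1 = (‖x‖ ^ 2 + 1)⁻¹ * (2 * x 1) ∧
    stereoInv x 2 = (‖x‖ ^ 2 + 1)⁻¹ * (2 * x 2) ∧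
    stereoInv x 3 = (‖x‖ ^ 2 + 1)⁻¹ * (‖x‖ ^ 2 - 1) := by
  simp [stereoInv]

lemma norm_sq_R3 (x : R3) : ‖x‖ ^ 2 = x 0 ^ 2 + x 1 ^ 2 + x 2 ^ 2 := by
  rw [EuclideanSpace.norm_sq_eq, Fin.sum_univ_three]; simp

lemma norm_sq_R4 (x : R4) : ‖x‖ ^ 2 = x 0 ^ 2 + x 1 ^ 2 + x 2 ^ 2 + x 3 ^ 2 := by
  rw [EuclideanSpace.norm_sq_eq, Fin.sum_univ_four]; simp

lemma stereoInv_mem (x : R3) : stereoInv x ∈ S3 := by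
  rw [S3, mem_sphere_zero_iff_norm]
  obtain ⟨h0, h1, h2, h3⟩ := stereoInv_apply x
  have : ‖stereoInv x‖ ^ 2 = 1 := by
    have hp : ‖x‖ ^ 2 + 1 ≠ 0 := by positivity
    rw [norm_sq_R4, h0, h1, h2, h3]
    field_simp
    have := norm_sq_R3 x
    nlinarith
  nlinarith [norm_nonneg (stereoInv x)]

/-- Stereographic projection from `(0, 0, 0, 1)`. -/
def stereo (X : R4) : R3 := (1 - X 3)⁻¹ • !₂[X 0, X 1, X 2]

lemma stereo_stereoInv (x : R3) : stereo (stereoInv x) = x := by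
  obtain ⟨h0, h1, h2, h3⟩ := stereoInv_apply x
  have hp : ‖x‖ ^ 2 + 1 ≠ 0 := by positivity
  have e : 1 - stereoInv x 3 = 2 * (‖x‖ ^ 2 + 1)⁻¹ := by rw [h3]; field_simp; ring
  ext i
  simp only [stereo, e, h0, h1, h2]
  fin_cases i <;> simp <;> field_simp

lemma stereoInv_stereo {X : R4} (hX : X ∈ S3) (h3 : X 3 ≠ 1) : stereoInv (stereo X) = X := by
  have hX' : X 0 ^ 2 + X 1 ^ 2 + X 2 ^ 2 + X 3 ^ 2 = 1 := by
    rw [← norm_sq_R4, mem_sphere_zero_iff_norm.1 hX]; norm_num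
  have hp : 1 - X 3 ≠ 0 := sub_ne_zero.2 h3.symm
  have hn : ‖stereo X‖ ^ 2 = (1 + X 3) / (1 - X 3) := by
    rw [norm_sq_R3]
    simp [stereo]
    field_simp
    nlinarith
  have hn1 : (‖stereo X‖ ^ 2 + 1)⁻¹ = (1 - X 3) / 2 := by
    rw [hn]; field_simp; ring
  obtain ⟨h0, h1, h2, h3'⟩ := stereoInv_apply (stereo X)
  ext i
  fin_cases i
  · simp [h0, hn1]; simp [stereo]; field_simp
  · simp [h1, hn1]; simp [stereo]; field_simp
  · simp [h2, hn1]; simp [stereo]; field_simp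
  · simp [h3', hn1]; rw [hn]; field_simp; ring

lemma stereoInv_injective : Function.Injective stereoInv :=
  Function.LeftInverse.injective stereo_stereoInv

lemma contDiffAt_stereo {X : R4} (h3 : X 3 ≠ 1) : ContDiffAt ℝ ∞ stereo X := by
  have hp : 1 - X 3 ≠ 0 := sub_ne_zero.2 h3.symm
  unfold stereo
  refine ContDiffAt.smul (ContDiffAt.inv (f := fun X : R4 => 1 - X 3) (by fun_prop) hp) ?_
  apply ContDiff.contDiffAt
  rw [contDiff_euclidean]
  intro i
  fin_cases i <;> simp <;> fun_prop

/-- A smooth curve has nonzero velocity where some smooth function of it has. -/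
lemma deriv_ne_zero_of_comp {E F : Type*} [NormedAddCommGroup E] [NormedSpace ℝ E]
    [NormedAddCommGroup F] [NormedSpace ℝ F] {f : E → F} {c : ℝ → E} {t : ℝ}
    (hf : DifferentiableAt ℝ f (c t)) (hc : DifferentiableAt ℝ c t)
    (h : deriv (fun s => f (c s)) t ≠ 0) : deriv c t ≠ 0 := by
  intro h0
  apply h
  have := hf.hasFDerivAt.comp_hasDerivAt t hc.hasDerivAt
  rw [h0, map_zero] at this
  exact this.deriv

lemma IsLink.stereoInv {γ : Fin k → ℝ → R3} (H : IsLink Set.univ γ) :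
    IsLink S3 (fun i t => stereoInv (γ i t)) := by
  refine ⟨fun i => contDiff_stereoInv.comp (H.smooth i), fun i t => ?_,
    fun i t => stereoInv_mem _, fun i t => ?_, fun i j s t h => ?_⟩
  · simp only [H.periodic i t]
  · have hs : ContDiff ℝ ∞ fun t => BridgeBraid.stereoInv (γ i t) :=
      contDiff_stereoInv.comp (H.smooth i)
    refine deriv_ne_zero_of_comp (f := stereo) ?_ (hs.differentiable (by simp) t) ?_
    · refine (contDiffAt_stereo ?_).differentiableAt (by simp)
      rw [(stereoInv_apply _).2.2.2]
      have hp : ‖γ i t‖ ^ 2 + 1 ≠ 0 := by positivity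
      intro h
      field_simp at h
      linarith
    · simpa only [stereo_stereoInv] using H.immersion i t
  · exact H.injective i j s t (stereoInv_injective h)

lemma Isotopic.stereoInv {γ γ' : Fin k → ℝ → R3} (H : Isotopic Set.univ γ γ') :
    Isotopic S3 (fun i t => stereoInv (γ i t)) (fun i t => stereoInv (γ' i t)) := by
  obtain ⟨F, h1, h2, h3, h4⟩ := H
  refine ⟨fun s i t => BridgeBraid.stereoInv (F s i t), fun i => contDiff_stereoInv.comp (h1 i),
    fun s => (h2 s).stereoInv, by simp [h3], by simp [h4]⟩

lemma Isotopic.isLink_left {E : Type} [NormedAddCommGroup E] [NormedSpace ℝ E] {X : Set E}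
    {γ γ' : Fin k → ℝ → E} (H : Isotopic X γ γ') : IsLink X γ := by
  obtain ⟨F, -, h2, h3, -⟩ := H
  exact h3 ▸ h2 0

lemma Represents.of_isotopic {γ γ' : Fin k → ℝ → R3} {L : Fin k → ℝ → R4} (H : Represents γ L)
    (h : Isotopic Set.univ γ γ') : Represents γ' L :=
  ⟨h.symm.isLink_left, h.symm.stereoInv.trans H.isotopic⟩

/-- A link in the 3-sphere that avoids the centre of the stereographic projection is represented by
its projection. -/
lemma represents_stereo {Y L : Fin k → ℝ → R4} (hY : Isotopic S3 Y L) (h3 : ∀ i t, Y i t 3 ≠ 1) :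
    Represents (fun i t => stereo (Y i t)) L := by
  have H := hY.isLink_left
  have e : ∀ i t, stereoInv (stereo (Y i t)) = Y i t :=
    fun i t => stereoInv_stereo (H.mem i t) (h3 i t)
  refine ⟨⟨fun i => ?_, fun i t => ?_, fun _ _ => trivial, fun i t => ?_, fun i j s t h => ?_⟩, ?_⟩
  · rw [contDiff_iff_contDiffAt]
    exact fun t => (contDiffAt_stereo (h3 i t)).comp t (H.smooth i).contDiffAt
  · simp only [H.periodic i t]
  · refine deriv_ne_zero_of_comp (f := stereoInv)
      (contDiff_stereoInv.differentiable (by simp) _) ?_ ?_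
    · exact ((contDiffAt_stereo (h3 i t)).comp t (H.smooth i).contDiffAt).differentiableAt (by simp)
    · simpa only [e] using H.immersion i t
  · exact H.injective i j s t (by rw [← e i s, ← e j t, h])
  · simpa only [e] using hY

/-! ### Isotopies in coordinates -/

section Coordinates

variable {p : Fin k → ℝ → ℂ} {h : Fin k → ℝ → ℝ}

lemma IsLinkData.hasDerivAt_p (H : IsLinkData p h) (i : Fin k) (t : ℝ) :
    HasDerivAt (p i) (deriv (p i) t) t :=
  ((H.smooth_p i).differentiable (by simp) t).hasDerivAt

lemma IsLinkData.hasDerivAt_h (H : IsLinkData p h) (i : Fin k) (t : ℝ) :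
    HasDerivAt (h i) (deriv (h i) t) t :=
  ((H.smooth_h i).differentiable (by simp) t).hasDerivAt

lemma isotopic_of_data (P : ℝ → Fin k → ℝ → ℂ) (Z : ℝ → Fin k → ℝ → ℝ)
    (hP : ∀ i, ContDiff ℝ ∞ (fun q : ℝ × ℝ => P q.1 i q.2))
    (hZ : ∀ i, ContDiff ℝ ∞ (fun q : ℝ × ℝ => Z q.1 i q.2))
    (hlink : ∀ s ∈ Set.Icc (0 : ℝ) 1, IsLinkData (P s) (Z s)) :
    Isotopic Set.univ (curve (P 0) (Z 0)) (curve (P 1) (Z 1)) :=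
  isotopic_of_unitInterval (fun s => curve (P s) (Z s)) (fun i => contDiff_mk (hP i) (hZ i))
    fun s hs => isLink_curve_iff.2 (hlink s hs)

lemma Isotopic.isLinkData_right {p' : Fin k → ℝ → ℂ} {h' : Fin k → ℝ → ℝ}
    {γ : Fin k → ℝ → R3} (H : Isotopic Set.univ γ (curve p' h')) : IsLinkData p' h' :=
  isLink_curve_iff.1 H.symm.isLink_left

/-- Every horizontal plane is translated as a whole and heights do not change. Points at equal
height keep their difference, and where the height is stationary the planar velocity is unchanged,
so no double point or singular point arises. -/
lemma IsLinkData.isotopic_shear (H : IsLinkData p h) {c : ℝ → ℂ} (hc : ContDiff ℝ ∞ c) :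
    Isotopic Set.univ (curve p h) (curve (fun i t => p i t - c (h i t)) h) := by
  have := isotopic_of_data (fun s i t => p i t - s • c (h i t)) (fun _ => h)
    (fun i => ((H.smooth_p i).comp contDiff_snd).sub
      (contDiff_fst.smul (hc.comp ((H.smooth_h i).comp contDiff_snd))))
    (fun i => (H.smooth_h i).comp contDiff_snd) ?_
  · simpa using this
  · intro s _
    refine ⟨fun i => (H.smooth_p i).sub ((hc.comp (H.smooth_h i)).const_smul s), H.smooth_h,
      fun i t => ?_, H.periodic_h, fun i t h0 h1 => ?_, fun i j u t h0 h1 => ?_⟩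
    · simp only [H.periodic_p i t, H.periodic_h i t]
    · have hcd := (hc.differentiable (by simp) (h i t)).hasDerivAt
      have := (H.hasDerivAt_p i t).sub ((hcd.scomp t (H.hasDerivAt_h i t)).const_smul s)
      have e : deriv (fun t => p i t - s • c (h i t)) t = deriv (p i) t := by
        refine (HasDerivAt.deriv this).trans ?_
        rw [h1]; simp
      exact H.immersion i t (e ▸ h0) h1
    · simp only [h1, sub_left_inj] at h0
      exact H.injective i j u t h0 h1

/-- The projection is fixed and the heights move along segments. `hcross` says that strands over the
same point keep their vertical order, `himm` that where the projection stops the two vertical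
velocities have the same sign; convex combinations inherit both. -/
lemma IsLinkData.isotopic_vertical (H : IsLinkData p h) {h' : Fin k → ℝ → ℝ}
    (hs : ∀ i, ContDiff ℝ ∞ (h' i)) (hp : ∀ i, Function.Periodic (h' i) 1)
    (hcross : ∀ i j s t, p i s = p j t → h i s < h j t → h' i s < h' j t)
    (himm : ∀ i t, deriv (p i) t = 0 → 0 < deriv (h i) t * deriv (h' i) t) :
    Isotopic Set.univ (curve p h) (curve p h') := by
  have := isotopic_of_data (fun _ => p) (fun s i t => (1 - s) * h i t + s * h' i t)
    (fun i => (H.smooth_p i).comp contDiff_snd)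
    (fun i => ((contDiff_const.sub contDiff_fst).mul ((H.smooth_h i).comp contDiff_snd)).add
      (contDiff_fst.mul ((hs i).comp contDiff_snd))) ?_
  · simpa using this
  · intro s hs01
    have aux : ∀ i j u t, p i u = p j t → h i u < h j t →
        (1 - s) * h i u + s * h' i u < (1 - s) * h j t + s * h' j t := by
      intro i j u t h0 h1
      have h2 := hcross i j u t h0 h1
      rcases eq_or_lt_of_le hs01.1 with rfl | hs0
      · simpa using h1
      · nlinarith [hs01.2, mul_lt_mul_of_pos_left h2 hs0]
    refine ⟨H.smooth_p, fun i => (contDiff_const.mul (H.smooth_h i)).add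
      (contDiff_const.mul (hs i)), H.periodic_p, fun i t => ?_, fun i t h0 h1 => ?_,
      fun i j u t h0 h1 => ?_⟩
    · simp only [hp i t, H.periodic_h i t]
    · have d' := ((hs i).differentiable (by simp) t).hasDerivAt
      have := ((H.hasDerivAt_h i t).const_mul (1 - s)).add (d'.const_mul s)
      have e := (HasDerivAt.deriv this).symm.trans h1
      have h3 := himm i t h0
      have h4 : 0 < deriv (h i) t ^ 2 := by
        have := H.immersion i t h0
        positivity
      have h5 : (1 - s) * deriv (h i) t ^ 2 + s * (deriv (h i) t * deriv (h' i) t) = 0 := by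
        linear_combination deriv (h i) t * e
      rcases eq_or_lt_of_le hs01.1 with rfl | hs0
      · linarith
      · nlinarith [hs01.2, mul_pos hs0 h3, mul_nonneg (sub_nonneg.2 hs01.2) h4.le]
    · rcases lt_trichotomy (h i u) (h j t) with h2 | h2 | h2
      · exact absurd h1 (aux i j u t h0 h2).ne
      · exact H.injective i j u t h0 h2
      · exact absurd h1 (aux j i t u h0.symm h2).ne'

/-- Positive dilation of the plane, and orientation-preserving affine change of height. -/
lemma IsLinkData.isotopic_affine (H : IsLinkData p h) {lam mu : ℝ} (hl : 0 < lam) (hm : 0 < mu)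
    (nu : ℝ) :
    Isotopic Set.univ (curve p h)
      (curve (fun i t => (lam : ℂ) * p i t) (fun i t => mu * h i t + nu)) := by
  have := isotopic_of_data (fun s i t => (1 + s * (lam - 1)) • p i t)
    (fun s i t => (1 + s * (mu - 1)) * h i t + s * nu)
    (fun i => (contDiff_const.add (contDiff_fst.mul contDiff_const)).smul
      ((H.smooth_p i).comp contDiff_snd))
    (fun i => ((contDiff_const.add (contDiff_fst.mul contDiff_const)).mul
      ((H.smooth_h i).comp contDiff_snd)).add (contDiff_fst.mul contDiff_const)) ?_
  · simpa using this
  · intro s hs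
    have hl' : 1 + s * (lam - 1) ≠ 0 := by
      rcases eq_or_lt_of_le hs.1 with rfl | hs0
      · simp
      · nlinarith [hs.2, mul_pos hs0 hl]
    have hm' : 1 + s * (mu - 1) ≠ 0 := by
      rcases eq_or_lt_of_le hs.1 with rfl | hs0
      · simp
      · nlinarith [hs.2, mul_pos hs0 hm]
    refine ⟨fun i => (H.smooth_p i).const_smul _,
      fun i => (contDiff_const.mul (H.smooth_h i)).add contDiff_const,
      fun i t => by simp only [H.periodic_p i t], fun i t => by simp only [H.periodic_h i t],
      fun i t h0 h1 => ?_, fun i j u t h0 h1 => ?_⟩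
    · have e := (HasDerivAt.deriv ((H.hasDerivAt_p i t).const_smul (1 + s * (lam - 1)))).symm.trans h0
      have e' := (HasDerivAt.deriv
        (((H.hasDerivAt_h i t).const_mul (1 + s * (mu - 1))).add_const (s * nu))).symm.trans h1
      exact H.immersion i t ((smul_eq_zero.1 e).resolve_left hl')
        ((mul_eq_zero.1 e').resolve_left hm')
    · refine H.injective i j u t (smul_right_injective _ hl' h0) (mul_left_cancel₀ hm' ?_)
      exact add_right_cancel h1

/-- Rotation about the axis. -/
lemma IsLinkData.isotopic_rotate (H : IsLinkData p h) (α : ℝ) :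
    Isotopic Set.univ (curve p h) (curve (fun i t => Complex.exp (α * Complex.I) * p i t) h) := by
  have := isotopic_of_data (fun s i t => Complex.exp ((s * α : ℝ) * Complex.I) * p i t)
    (fun _ => h) (fun i => ContDiff.mul ?_ ((H.smooth_p i).comp contDiff_snd))
    (fun i => (H.smooth_h i).comp contDiff_snd) ?_
  · simpa using this
  · have : ContDiff ℝ ∞ (fun q : ℝ × ℝ => ((q.1 * α : ℝ) : ℂ)) :=
      Complex.ofRealCLM.contDiff.comp (contDiff_fst.mul contDiff_const)
    exact (this.mul contDiff_const).cexp
  · intro s _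
    have hne := Complex.exp_ne_zero ((s * α : ℝ) * Complex.I)
    refine ⟨fun i => contDiff_const.mul (H.smooth_p i), H.smooth_h,
      fun i t => by simp only [H.periodic_p i t], H.periodic_h, fun i t h0 => ?_,
      fun i j u t h0 => H.injective i j u t (mul_left_cancel₀ hne h0)⟩
    have e := (HasDerivAt.deriv ((H.hasDerivAt_p i t).const_mul _)).symm.trans h0
    exact H.immersion i t ((mul_eq_zero.1 e).resolve_left hne)

/-- A quarter turn that exchanges the height with the second planar coordinate. -/
lemma IsLinkData.isotopic_turn (H : IsLinkData p h) :
    Isotopic Set.univ (curve p h)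
      (curve (fun i t => ⟨(p i t).re, h i t⟩) (fun i t => -(p i t).im)) := by
  let A : ℝ → ℝ := fun s => s * (Real.pi / 2)
  have hA : ContDiff ℝ ∞ (fun q : ℝ × ℝ => A q.1) := contDiff_fst.mul contDiff_const
  have mkC : ∀ {E : Type} [NormedAddCommGroup E] [NormedSpace ℝ E] {f g : E → ℝ},
      ContDiff ℝ ∞ f → ContDiff ℝ ∞ g → ContDiff ℝ ∞ (fun x => (⟨f x, g x⟩ : ℂ)) := by
    intro E _ _ f g hf hg
    exact Complex.equivRealProdCLM.symm.contDiff.comp (hf.prodMk hg)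
  have hre : ∀ i, ContDiff ℝ ∞ (fun t => (p i t).re) :=
    fun i => Complex.reCLM.contDiff.comp (H.smooth_p i)
  have him : ∀ i, ContDiff ℝ ∞ (fun t => (p i t).im) :=
    fun i => Complex.imCLM.contDiff.comp (H.smooth_p i)
  have := isotopic_of_data
    (fun s i t => ⟨(p i t).re, Real.cos (A s) * (p i t).im + Real.sin (A s) * h i t⟩)
    (fun s i t => Real.cos (A s) * h i t - Real.sin (A s) * (p i t).im)
    (fun i => mkC ((hre i).comp contDiff_snd) ((hA.cos.mul ((him i).comp contDiff_snd)).add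
      (hA.sin.mul ((H.smooth_h i).comp contDiff_snd))))
    (fun i => (hA.cos.mul ((H.smooth_h i).comp contDiff_snd)).sub
      (hA.sin.mul ((him i).comp contDiff_snd))) ?_
  · simpa [A] using this
  · intro s _
    set C := Real.cos (A s)
    set S := Real.sin (A s)
    have hCS : S ^ 2 + C ^ 2 = 1 := Real.sin_sq_add_cos_sq _
    have key : ∀ a b : ℝ, C * a + S * b = 0 → C * b - S * a = 0 → a = 0 ∧ b = 0 := by
      intro a b h0 h1
      exact ⟨by linear_combination C * h0 - S * h1 - a * hCS,
        by linear_combination S * h0 + C * h1 - b * hCS⟩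
    refine ⟨fun i => mkC (hre i) ((contDiff_const.mul (him i)).add
      (contDiff_const.mul (H.smooth_h i))), fun i => (contDiff_const.mul (H.smooth_h i)).sub
      (contDiff_const.mul (him i)), fun i t => ?_, fun i t => ?_, fun i t h0 h1 => ?_,
      fun i j u t h0 h1 => ?_⟩
    · simp only [H.periodic_p i t, H.periodic_h i t]
    · simp only [H.periodic_p i t, H.periodic_h i t]
    · have dp := H.hasDerivAt_p i t
      have dre := Complex.reCLM.hasFDerivAt.comp_hasDerivAt t dp
      have dim := Complex.imCLM.hasFDerivAt.comp_hasDerivAt t dp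
      have dh := H.hasDerivAt_h i t
      have d1 := (dim.const_mul C).add (dh.const_mul S)
      have d2 := (dh.const_mul C).sub (dim.const_mul S)
      have e2 := (HasDerivAt.deriv d2).symm.trans h1
      have dq := Complex.equivRealProdCLM.symm.hasFDerivAt.comp_hasDerivAt t (dre.prodMk d1)
      have e1 := (HasDerivAt.deriv dq).symm.trans h0
      have e1' := congrArg Complex.re e1
      have e1'' := congrArg Complex.im e1
      simp at e1' e1'' e2
      obtain ⟨a0, b0⟩ := key _ _ e1'' e2
      exact H.immersion i t (Complex.ext e1' a0) b0
    · have r := congrArg Complex.re h0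
      have m := congrArg Complex.im h0
      simp only at r m
      obtain ⟨a0, b0⟩ := key ((p i u).im - (p j t).im) (h i u - h j t)
        (by linear_combination m) (by linear_combination h1)
      exact H.injective i j u t (Complex.ext r (sub_eq_zero.1 a0)) (sub_eq_zero.1 b0)

/-- This is `(exp z - 1) / z` with its removable singularity filled in; it makes the family of
`isotopic_exp` smooth at time `0`, where it becomes the inclusion. -/
lemma contDiff_dslope_exp : ContDiff ℝ ∞ (dslope Complex.exp 0) := by
  have : DifferentiableOn ℂ (dslope Complex.exp 0) Set.univ :=
    (Complex.differentiableOn_dslope Filter.univ_mem).2 Complex.differentiable_exp.differentiableOn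
  exact (differentiableOn_univ.1 this).contDiff.restrict_scalars ℝ

lemma mul_dslope_exp (z : ℂ) : z * dslope Complex.exp 0 z = Complex.exp z - 1 := by
  have := sub_smul_dslope Complex.exp 0 z
  simpa using this

/-- The exponential map of the strip around the real axis is isotopic to the inclusion, through the
maps `l ↦ (exp (s * l) - 1) / s + s`. -/
lemma IsLinkData.isotopic_exp (H : IsLinkData p h) (hp : ∀ i t, |(p i t).im| < Real.pi) :
    Isotopic Set.univ (curve p h) (curve (fun i t => Complex.exp (p i t)) h) := by
  have sub : ∀ i, ContDiff ℝ ∞ (fun q : ℝ × ℝ => p i q.2) :=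
    fun i => (H.smooth_p i).comp contDiff_snd
  have sof : ContDiff ℝ ∞ (fun q : ℝ × ℝ => (q.1 : ℂ)) :=
    Complex.ofRealCLM.contDiff.comp contDiff_fst
  have form : ∀ (s : ℝ), s ≠ 0 → ∀ l : ℂ,
      l * dslope Complex.exp 0 (s * l) + s = (Complex.exp (s * l) - 1) / s + s := by
    intro s hs l
    have : (s : ℂ) ≠ 0 := by exact_mod_cast hs
    rw [← mul_dslope_exp]
    field_simp
  have := isotopic_of_data (fun s i t => p i t * dslope Complex.exp 0 (s * p i t) + s)
    (fun _ => h)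
    (fun i => ((sub i).mul (contDiff_dslope_exp.comp (sof.mul (sub i)))).add sof)
    (fun i => (H.smooth_h i).comp contDiff_snd) ?_
  · have e := form 1 one_ne_zero
    simp only [Complex.ofReal_one, one_mul, div_one, sub_add_cancel] at e
    simpa [e, Complex.ofReal_one] using this
  · intro s hs
    refine ⟨fun i => ((H.smooth_p i).mul (contDiff_dslope_exp.comp
      (contDiff_const.mul (H.smooth_p i)))).add contDiff_const, H.smooth_h,
      fun i t => by simp only [H.periodic_p i t], H.periodic_h, fun i t h0 => ?_,
      fun i j u t h0 => ?_⟩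
    · apply H.immersion i t
      by_cases hs0 : s = 0
      · simpa [hs0] using h0
      · simp only [form s hs0] at h0
        have hs0' : (s : ℂ) ≠ 0 := by exact_mod_cast hs0
        have d := ((((H.hasDerivAt_p i t).const_mul (s : ℂ)).cexp.sub_const 1).div_const
          (s : ℂ)).add_const (s : ℂ)
        have e := d.deriv.symm.trans h0
        simpa [Complex.exp_ne_zero, hs0'] using e
    · refine H.injective i j u t ?_
      by_cases hs0 : s = 0
      · simpa [hs0] using h0
      · simp only [form s hs0] at h0
        have hs0' : (s : ℂ) ≠ 0 := by exact_mod_cast hs0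
        have e : Complex.exp (s * p i u) = Complex.exp (s * p j t) := by
          field_simp at h0
          linear_combination h0
        have bd : ∀ i t, |((s : ℂ) * p i t).im| < Real.pi := by
          intro i t
          have : ((s : ℂ) * p i t).im = s * (p i t).im := by simp
          rw [this, abs_mul, abs_of_nonneg hs.1]
          nlinarith [hp i t, hs.2, hs.1, abs_nonneg (p i t).im]
        have := Complex.exp_inj_of_neg_pi_lt_of_le_pi (abs_lt.1 (bd i u)).1 (abs_lt.1 (bd i u)).2.le
          (abs_lt.1 (bd j t)).1 (abs_lt.1 (bd j t)).2.le e
        exact mul_left_cancel₀ hs0' this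

/-- The logarithm maps the slit plane into the open strip `|im| < π`, so `isotopic_exp` applies to
the logarithm of the link and is read backwards. -/
lemma IsLinkData.isotopic_log (H : IsLinkData p h) (hp : ∀ i t, p i t ∈ Complex.slitPlane) :
    Isotopic Set.univ (curve p h) (curve (fun i t => Complex.log (p i t)) h) := by
  have e : ∀ i t, Complex.exp (Complex.log (p i t)) = p i t :=
    fun i t => Complex.exp_log (Complex.slitPlane_ne_zero (hp i t))
  have H' : IsLinkData (fun i t => Complex.log (p i t)) h := by
    refine ⟨fun i => ?_, H.smooth_h, fun i t => by simp only [H.periodic_p i t], H.periodic_h,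
      fun i t h0 => ?_, fun i j u t h0 => ?_⟩
    · rw [contDiff_iff_contDiffAt]
      exact fun t => ((Complex.contDiffAt_log (hp i t)).restrict_scalars ℝ).comp t
        (H.smooth_p i).contDiffAt
    · apply H.immersion i t
      have := ((H.hasDerivAt_p i t).clog_real (hp i t)).deriv.symm.trans h0
      simpa [Complex.slitPlane_ne_zero (hp i t)] using this
    · exact H.injective i j u t (by rw [← e i u, ← e j t, h0])
  have := H'.isotopic_exp fun i t => by
    rw [Complex.log_im]
    have := Complex.mem_slitPlane_iff_arg.1 (hp i t)
    exact lt_of_le_of_ne (Complex.abs_arg_le_pi _) fun h => by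
      rcases abs_eq Real.pi_pos.le |>.1 h with h | h
      · exact this.1 h
      · linarith [Complex.neg_pi_lt_arg (p i t)]
  simp only [e] at this
  exact this.symm

/-! ### Isotopies in the 3-sphere by normalization -/

/-- Radial projection to the sphere gives an embedding when no two points share a ray and the
velocity is never a multiple of the position. Deformations can thus be written as families of
vectors without controlling their norms. -/
lemma isotopic_normalize (V : ℝ → Fin k → ℝ → R4)
    (hV : ∀ i, ContDiff ℝ ∞ (fun q : ℝ × ℝ => V q.1 i q.2)) (hne : ∀ s i t, V s i t ≠ 0)
    (hper : ∀ s i, Function.Periodic (V s i) 1)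
    (hinj : ∀ s ∈ Set.Icc (0 : ℝ) 1, ∀ i j u t (r : ℝ), 0 < r → V s i u = r • V s j t →
      i = j ∧ ∃ m : ℤ, t = u + m)
    (himm : ∀ s ∈ Set.Icc (0 : ℝ) 1, ∀ i t (r : ℝ), deriv (V s i) t ≠ r • V s i t) :
    Isotopic S3 (fun i t => ‖V 0 i t‖⁻¹ • V 0 i t) (fun i t => ‖V 1 i t‖⁻¹ • V 1 i t) := by
  refine isotopic_of_unitInterval (fun s i t => ‖V s i t‖⁻¹ • V s i t) (fun i => ?_) fun s hs => ?_
  · exact (((hV i).norm ℝ fun q => hne _ _ _).inv fun q => norm_ne_zero_iff.2 (hne _ _ _)).smul (hV i)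
  · have hVs : ∀ i, ContDiff ℝ ∞ (V s i) := fun i =>
      (hV i).comp (contDiff_const.prodMk contDiff_id : ContDiff ℝ ∞ fun t : ℝ => (s, t))
    have hn : ∀ i, ContDiff ℝ ∞ (fun t => ‖V s i t‖⁻¹) := fun i =>
      ((hVs i).norm ℝ fun t => hne _ _ _).inv fun t => norm_ne_zero_iff.2 (hne _ _ _)
    refine ⟨fun i => (hn i).smul (hVs i), fun i t => by simp only [hper s i t], fun i t => ?_,
      fun i t h0 => ?_, fun i j u t h0 => ?_⟩
    · rw [S3, mem_sphere_zero_iff_norm, norm_smul, norm_inv, norm_norm,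
        inv_mul_cancel₀ (norm_ne_zero_iff.2 (hne _ _ _))]
    · have d1 := ((hn i).differentiable (by simp) t).hasDerivAt
      have d2 := ((hVs i).differentiable (by simp) t).hasDerivAt
      have e := (HasDerivAt.deriv (d1.smul d2)).symm.trans h0
      have hp : 0 < ‖V s i t‖ := norm_pos_iff.2 (hne _ _ _)
      apply himm s hs i t (-(‖V s i t‖ * deriv (fun t => ‖V s i t‖⁻¹) t))
      have e2 := congrArg (fun v => ‖V s i t‖ • v) e
      simp only [smul_add, smul_smul, mul_inv_cancel₀ hp.ne', one_smul, smul_zero] at e2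
      rw [neg_smul]
      exact eq_neg_of_add_eq_zero_left e2
    · have hp : 0 < ‖V s i u‖ := norm_pos_iff.2 (hne _ _ _)
      have hq : 0 < ‖V s j t‖ := norm_pos_iff.2 (hne _ _ _)
      refine hinj s hs i j u t (‖V s i u‖ * ‖V s j t‖⁻¹) (by positivity) ?_
      have e2 := congrArg (fun v => ‖V s i u‖ • v) h0
      simpa only [smul_smul, mul_inv_cancel₀ hp.ne', one_smul] using e2

end Coordinates

/-! ### Morse functions on a union of circles -/

/-- All critical points of `f` are nondegenerate. -/
def IsMorse (f : ℝ → ℝ) : Prop := ∀ t, deriv f t = 0 → deriv (deriv f) t ≠ 0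

/-- The critical points of a family of periodic functions, in a period. -/
def criticalSet (h : Fin k → ℝ → ℝ) : Set (Fin k × ℝ) :=
  {q | q.2 ∈ Set.Ico (0 : ℝ) 1 ∧ deriv (h q.1) q.2 = 0}

lemma periodic_deriv {E : Type*} [NormedAddCommGroup E] [NormedSpace ℝ E] {f : ℝ → E}
    (hf : Function.Periodic f 1) : Function.Periodic (deriv f) 1 := by
  intro t
  rw [← deriv_comp_add_const]
  congr 1
  funext s
  exact hf s

lemma contDiff_deriv_of_smooth {E : Type*} [NormedAddCommGroup E] [NormedSpace ℝ E] {f : ℝ → E}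
    (hf : ContDiff ℝ ∞ f) : ContDiff ℝ ∞ (deriv f) := (contDiff_infty_iff_deriv.1 hf).2

/-- After a maximum the derivative is negative until its next zero, which exists because a periodic
function cannot decrease over a whole period. The first such zero is a nondegenerate minimum. -/
lemma exists_next_min {f : ℝ → ℝ} (hf : ContDiff ℝ ∞ f) (hp : Function.Periodic f 1)
    (hm : IsMorse f) {t : ℝ} (h0 : deriv f t = 0) (h2 : deriv (deriv f) t < 0) :
    ∃ s, t < s ∧ deriv f s = 0 ∧ 0 < deriv (deriv f) s ∧ ∀ u ∈ Set.Ioo t s, deriv f u < 0 := by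
  have hd := contDiff_deriv_of_smooth hf
  have hcont := hd.continuous
  have hdd : ∀ u, HasDerivAt (deriv f) (deriv (deriv f) u) u := fun u =>
    (hd.differentiable (by simp) u).hasDerivAt
  let S : Set ℝ := {u | t < u ∧ 0 ≤ deriv f u}
  have hne : S.Nonempty := by
    by_contra hS
    have hneg : ∀ u ∈ interior (Set.Icc t (t + 1)), deriv f u < 0 := by
      intro u hu
      rw [interior_Icc] at hu
      by_contra hc
      exact hS ⟨u, hu.1, not_lt.1 hc⟩
    have := strictAntiOn_of_deriv_neg (convex_Icc t (t + 1)) hf.continuous.continuousOn hneg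
      (Set.left_mem_Icc.2 (by linarith)) (Set.right_mem_Icc.2 (by linarith)) (by linarith)
    rw [hp t] at this
    exact lt_irrefl _ this
  have hbdd : BddBelow S := ⟨t, fun u hu => hu.1.le⟩
  -- just after `t` the derivative is negative
  have hright : ∀ᶠ u in nhdsWithin t (Set.Ioi t), deriv f u < 0 := by
    have := (hasDerivAt_iff_tendsto_slope.1 (hdd t)).eventually (gt_mem_nhds h2)
    have := this.filter_mono (nhdsWithin_mono t fun u (hu : t < u) => hu.ne')
    filter_upwards [this, self_mem_nhdsWithin] with u hu htu
    rw [slope_def_field, h0, sub_zero] at hu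
    exact (div_neg_iff.1 hu).elim (fun h => absurd h.2 (by simp at htu; linarith)) fun h => h.1
  obtain ⟨r, hr, hrneg⟩ := (mem_nhdsGT_iff_exists_Ioo_subset).1 hright
  set s := sInf S with hs
  have hrs : r ≤ s := le_csInf hne fun u hu => by
    by_contra hc
    exact absurd (hrneg ⟨hu.1, not_le.1 hc⟩) (not_lt.2 hu.2)
  have hts : t < s := lt_of_lt_of_le hr hrs
  have hneg : ∀ u ∈ Set.Ioo t s, deriv f u < 0 := fun u hu => by
    by_contra hc
    exact absurd (csInf_le hbdd (show u ∈ S from ⟨hu.1, not_lt.1 hc⟩)) (not_le.2 hu.2)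
  have hge : 0 ≤ deriv f s := by
    have hmem : s ∈ closure S := csInf_mem_closure hne hbdd
    have hcl : IsClosed {u | 0 ≤ deriv f u} := isClosed_le continuous_const hcont
    exact closure_minimal (fun u hu => hu.2) hcl hmem
  have hle : deriv f s ≤ 0 := by
    have hmem : s ∈ closure (Set.Ioo t s) := by
      rw [closure_Ioo hts.ne]; exact ⟨hts.le, le_rfl⟩
    have hcl : IsClosed {u | deriv f u ≤ 0} := isClosed_le hcont continuous_const
    exact closure_minimal (fun u hu => (hneg u hu).le) hcl hmem
  have hs0 : deriv f s = 0 := le_antisymm hle hge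
  refine ⟨s, hts, hs0, lt_of_le_of_ne ?_ (hm s hs0).symm, hneg⟩
  -- A negative second derivative at `s` would make the first derivative positive just before `s`,
  -- where it is negative.
  by_contra hc
  rw [not_le] at hc
  have := (hasDerivAt_iff_tendsto_slope.1 (hdd s)).eventually (gt_mem_nhds hc)
  have := this.filter_mono (nhdsWithin_mono s fun u (hu : u ∈ Set.Iio s) => hu.ne)
  obtain ⟨u, hu, hus⟩ := (this.and (Ioo_mem_nhdsLT hts)).exists
  rw [slope_def_field, hs0, sub_zero] at hu
  exact absurd hu (not_lt.2 (div_nonneg_of_nonpos (hneg u hus).le (by linarith [hus.2])))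

lemma isMorse_reverse {f : ℝ → ℝ} (hm : IsMorse f) : IsMorse (fun t => f (-t)) := by
  intro t h0
  have e : deriv (fun t => f (-t)) = fun t => -deriv f (-t) := by
    funext u; exact deriv_comp_neg f u
  rw [e] at h0 ⊢
  have e2 : deriv (fun t => -deriv f (-t)) t = deriv (deriv f) (-t) := by
    rw [deriv.fun_neg]
    rw [deriv_comp_neg (deriv f) t, neg_neg]
  rw [e2]
  exact hm _ (neg_eq_zero.1 h0)

lemma exists_prev_min {f : ℝ → ℝ} (hf : ContDiff ℝ ∞ f) (hp : Function.Periodic f 1)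
    (hm : IsMorse f) {t : ℝ} (h0 : deriv f t = 0) (h2 : deriv (deriv f) t < 0) :
    ∃ s, s < t ∧ deriv f s = 0 ∧ 0 < deriv (deriv f) s ∧ ∀ u ∈ Set.Ioo s t, 0 < deriv f u := by
  have e : deriv (fun t => f (-t)) = fun t => -deriv f (-t) := by
    funext u; exact deriv_comp_neg f u
  have e2 : ∀ t, deriv (deriv (fun t => f (-t))) t = deriv (deriv f) (-t) := by
    intro t
    rw [e, deriv.fun_neg, deriv_comp_neg (deriv f) t, neg_neg]
  obtain ⟨s, h1, h3, h4, h5⟩ := exists_next_min (f := fun t => f (-t)) (hf.comp contDiff_neg)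
    (fun u => by
      have := hp (-u - 1)
      simp only [sub_add_cancel] at this
      simp only [neg_add, this, ← sub_eq_add_neg]) (isMorse_reverse hm) (t := -t) (by rw [e]; simpa using h0)
    (by rw [e2]; simpa using h2)
  refine ⟨-s, by linarith, by rw [e] at h3; simpa using h3, by rw [e2] at h4; exact h4,
    fun u hu => ?_⟩
  have := h5 (-u) ⟨by linarith [hu.2], by linarith [hu.1]⟩
  rw [e] at this
  simpa using this

/-- A maximum with positive second derivative would also be a minimum, so `f` would be constant
nearby and its second derivative would vanish. -/
lemma isLocalMax_iff {f : ℝ → ℝ} (hf : ContDiff ℝ ∞ f) (hm : IsMorse f) (t : ℝ) :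
    IsLocalMax f t ↔ deriv f t = 0 ∧ deriv (deriv f) t < 0 := by
  constructor
  · intro h
    have h0 := h.deriv_eq_zero
    refine ⟨h0, lt_of_le_of_ne ?_ (hm t h0)⟩
    by_contra hc
    have hmin := isLocalMin_of_deriv_deriv_pos (not_le.1 hc) h0 hf.continuous.continuousAt
    have heq : f =ᶠ[nhds t] fun _ => f t := by
      filter_upwards [h, hmin] with u h1 h2 using le_antisymm h1 h2
    have := heq.deriv.deriv_eq
    simp at this
    exact hm t h0 this
  · rintro ⟨h0, h2⟩
    exact isLocalMax_of_deriv_deriv_neg h2 h0 hf.continuous.continuousAt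

/-- Sending each maximum to the next minimum is injective on the circles: of two maxima with the
same next minimum, the later one would lie where the derivative is negative. `Int.fract` brings the
minimum back into the period. -/
lemma encard_maxima_le {h : Fin k → ℝ → ℝ} (hs : ∀ i, ContDiff ℝ ∞ (h i))
    (hp : ∀ i, Function.Periodic (h i) 1) (hm : ∀ i, IsMorse (h i)) :
    {q ∈ criticalSet h | deriv (deriv (h q.1)) q.2 < 0}.encard ≤
      {q ∈ criticalSet h | 0 < deriv (deriv (h q.1)) q.2}.encard := by
  have ex : ∀ q : Fin k × ℝ, q ∈ {q ∈ criticalSet h | deriv (deriv (h q.1)) q.2 < 0} →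
      ∃ s, q.2 < s ∧ deriv (h q.1) s = 0 ∧ 0 < deriv (deriv (h q.1)) s ∧
        ∀ u ∈ Set.Ioo q.2 s, deriv (h q.1) u < 0 :=
    fun q hq => exists_next_min (hs q.1) (hp q.1) (hm q.1) hq.1.2 hq.2
  choose! N h1 h2 h3 h4 using ex
  refine Set.encard_le_encard_of_injOn (f := fun q => (q.1, Int.fract (N q))) ?_ ?_
  · intro q hq
    have p1 := periodic_deriv (hp q.1)
    have p2 := periodic_deriv p1
    have e1 : deriv (h q.1) (Int.fract (N q)) = deriv (h q.1) (N q) := by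
      rw [Int.fract]; simpa using p1.sub_zsmul_eq (x := N q) ⌊N q⌋
    have e2 : deriv (deriv (h q.1)) (Int.fract (N q)) = deriv (deriv (h q.1)) (N q) := by
      rw [Int.fract]; simpa using p2.sub_zsmul_eq (x := N q) ⌊N q⌋
    refine ⟨⟨⟨Int.fract_nonneg _, Int.fract_lt_one _⟩, ?_⟩, ?_⟩
    · simp only [e1]; exact h2 q hq
    · simp only [e2]; exact h3 q hq
  · rintro ⟨i, t⟩ hq ⟨j, t'⟩ hq' heq
    simp only [Prod.mk.injEq] at heq
    obtain ⟨rfl, hfr⟩ := heq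
    obtain ⟨m, hm'⟩ := Int.fract_eq_fract.1 hfr
    have p1 := periodic_deriv (hp i)
    have a1 := h1 _ hq
    have a2 := h1 _ hq'
    have b1 := h4 _ hq
    have b2 := h4 _ hq'
    simp only at a1 a2 b1 b2
    have e : t = t' + m := by
      rcases lt_trichotomy t (t' + m) with hlt | heq | hlt
      · have := b1 (t' + m) ⟨hlt, by linarith⟩
        have e3 : deriv (h i) (t' + m) = deriv (h i) t' := by simpa using p1.zsmul m t'
        rw [e3] at this
        exact absurd hq'.1.2 this.ne
      · exact heq
      · have := b2 (t - m) ⟨by linarith, by linarith⟩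
        have e3 : deriv (h i) (t - m) = deriv (h i) t := by simpa using p1.sub_zsmul_eq (x := t) m
        rw [e3] at this
        exact absurd hq.1.2 this.ne
    have c1 := hq.1.1
    have c2 := hq'.1.1
    simp only [Set.mem_Ico] at c1 c2
    have hm0 : m = 0 := by
      have l1 : (m : ℝ) < 1 := by linarith
      have l2 : (-1 : ℝ) < m := by linarith
      have l1' : m < 1 := by exact_mod_cast l1
      have l2' : -1 < m := by exact_mod_cast l2
      omega
    simp [e, hm0]

/-- Comparing `h` with `-h` in `encard_maxima_le` shows that maxima and minima are equally numerous,
and nondegeneracy leaves no other critical points. -/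
lemma encard_criticalSet {h : Fin k → ℝ → ℝ} (hs : ∀ i, ContDiff ℝ ∞ (h i))
    (hp : ∀ i, Function.Periodic (h i) 1) (hm : ∀ i, IsMorse (h i)) :
    (criticalSet h).encard =
      2 * {q : Fin k × ℝ | q.2 ∈ Set.Ico (0 : ℝ) 1 ∧ IsLocalMax (h q.1) q.2}.encard := by
  have hd : ∀ i, deriv (fun t => -h i t) = fun t => -deriv (h i) t := fun i => by
    funext t; simp
  have hdd : ∀ i, deriv (deriv fun t => -h i t) = fun t => -deriv (deriv (h i)) t := fun i => by
    rw [hd]; funext t; simp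
  have hcrit : criticalSet (fun i t => -h i t) = criticalSet h := by
    ext q; simp [criticalSet, hd]
  have le2 := encard_maxima_le (h := fun i t => -h i t) (fun i => (hs i).neg)
    (fun i t => by simp only [hp i t]) (fun i t h0 => by
      rw [hdd]
      rw [hd] at h0
      exact neg_ne_zero.2 (hm i t (neg_eq_zero.1 h0)))
  rw [hcrit] at le2
  simp only [hdd, Left.neg_neg_iff, Left.neg_pos_iff] at le2
  have e := le_antisymm (encard_maxima_le hs hp hm) le2
  have emax : {q : Fin k × ℝ | q.2 ∈ Set.Ico (0 : ℝ) 1 ∧ IsLocalMax (h q.1) q.2} =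
      {q ∈ criticalSet h | deriv (deriv (h q.1)) q.2 < 0} := by
    ext q
    simp only [Set.mem_ofPred_eq, isLocalMax_iff (hs q.1) (hm q.1), criticalSet, and_assoc]
  have eun : criticalSet h = {q ∈ criticalSet h | deriv (deriv (h q.1)) q.2 < 0} ∪
      {q ∈ criticalSet h | 0 < deriv (deriv (h q.1)) q.2} := by
    ext q
    simp only [Set.mem_union, Set.mem_ofPred_eq, ← and_or_left]
    exact ⟨fun hq => ⟨hq, lt_or_gt_of_ne (hm q.1 q.2 hq.2)⟩, fun hq => hq.1⟩
  rw [emax, eun, Set.encard_union_eq, ← eun, ← e, two_mul]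
  rw [Set.disjoint_left]
  intro q h1 h2
  exact lt_asymm h1.2 h2.2

/-! ### Booklinks that miss a page -/

lemma mem_page_iff {x : R3} {θ : ℝ} :
    x ∈ page θ ↔ ∃ r : ℝ, 0 < r ∧ planar x = r * Complex.exp (θ * Complex.I) := by
  refine exists_congr fun r => and_congr_right fun _ => ?_
  rw [Complex.ext_iff]
  simp [planar, Complex.exp_re, Complex.exp_im]

/-- The argument of `exp P` is `P.im` itself, without any jump. So the critical points correspond,
and the page at angle `π` is not reached. -/
lemma isBooklink_exp {P : Fin k → ℝ → ℂ} {Z : Fin k → ℝ → ℝ} (H : IsLinkData P Z)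
    (hb : ∀ i t, |(P i t).im| < Real.pi) (hm : ∀ i, IsMorse fun t => (P i t).im) {d : ℕ}
    (hd : (criticalSet fun i t => (P i t).im).encard = 2 * (d : ℕ∞)) :
    IsBooklink (curve (fun i t => Complex.exp (P i t)) Z) d ∧
      pageNumber (curve (fun i t => Complex.exp (P i t)) Z) = 0 := by
  have hv : ∀ i, angularVelocity (curve (fun i t => Complex.exp (P i t)) Z i) =
      deriv fun t => (P i t).im := by
    intro i
    funext t
    have d := H.hasDerivAt_p i t
    change (deriv (fun t => Complex.exp (P i t)) t / Complex.exp (P i t)).im = _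
    rw [d.cexp.deriv, mul_div_cancel_left₀ _ (Complex.exp_ne_zero _)]
    exact (Complex.imCLM.hasFDerivAt.comp_hasDerivAt t d).deriv.symm
  have D := (H.isotopic_exp hb).isLinkData_right
  refine ⟨⟨isLink_curve_iff.2 D, fun i t => Complex.exp_ne_zero _, fun i t h0 => ?_, ?_⟩, ?_⟩
  · rw [hv] at h0 ⊢
    exact hm i t h0
  · rw [← hd]
    congr 1
    ext q
    simp only [angularCritical, criticalSet, Set.mem_ofPred_eq, hv]
  · refine le_antisymm ((iInf_le _ Real.pi).trans (le_of_eq ?_)) zero_le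
    rw [Set.encard_eq_zero, Set.eq_empty_iff_forall_notMem]
    rintro x ⟨⟨i, t, rfl⟩, hx⟩
    obtain ⟨r, hr, e⟩ := mem_page_iff.1 hx
    rw [Complex.exp_pi_mul_I] at e
    have hlt := abs_lt.1 (hb i t)
    have ha : Complex.arg (Complex.exp (P i t)) = (P i t).im := by
      rw [Complex.arg_exp, toIocMod_eq_self]
      exact ⟨hlt.1, by linarith [hlt.2]⟩
    have e' : Complex.exp (P i t) = ((-r : ℝ) : ℂ) := by
      simp only [curve, planar_mk] at e
      rw [e]; push_cast; ring
    rw [e', Complex.arg_ofReal_of_neg (by linarith)] at ha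
    linarith [hlt.2]

/-- The height is scaled into `(-π, π)`, turned into the imaginary part of the planar coordinate,
and wrapped around the axis by the exponential. -/
lemma exists_booklink_of_height {p : Fin k → ℝ → ℂ} {h : Fin k → ℝ → ℝ} (H : IsLinkData p h)
    (hm : ∀ i, IsMorse (h i)) {d : ℕ} (hd : (criticalSet h).encard = 2 * (d : ℕ∞)) :
    ∃ γ, Isotopic Set.univ (curve p h) γ ∧ IsBooklink γ d ∧ pageNumber γ = 0 := by
  obtain ⟨C, hC0, hC⟩ : ∃ C, 0 < C ∧ ∀ i t, |h i t| < C := by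
    have : ∀ i, ∃ C, ∀ t, |h i t| ≤ C := fun i => by
      obtain ⟨C, hC⟩ := (isCompact_Icc (a := (0 : ℝ)) (b := 1)).exists_bound_of_continuousOn
        (H.smooth_h i).continuous.continuousOn
      refine ⟨C, fun t => ?_⟩
      obtain ⟨u, hu, e⟩ := (H.periodic_h i).exists_mem_Ico₀ one_pos t
      rw [e]
      exact hC u ⟨hu.1, hu.2.le⟩
    choose C hC using this
    refine ⟨∑ i, |C i| + 1, by positivity, fun i t => ?_⟩
    have := Finset.single_le_sum (f := fun i => |C i|) (fun i _ => abs_nonneg _) (Finset.mem_univ i)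
    have h1 := hC i t
    have h2 := le_abs_self (C i)
    linarith
  set mu := Real.pi / C with hmu
  have hmu0 : 0 < mu := div_pos Real.pi_pos hC0
  have i1 := H.isotopic_affine one_pos hmu0 0
  have i2 := i1.isLinkData_right.isotopic_turn
  have hb : ∀ i t, |mu * h i t + 0| < Real.pi := fun i t => by
    rw [add_zero, abs_mul, abs_of_pos hmu0, hmu, div_mul_eq_mul_div, div_lt_iff₀ hC0]
    exact mul_lt_mul_of_pos_left (hC i t) Real.pi_pos
  have hdv : ∀ i, deriv (fun t => mu * h i t + 0) = fun t => mu * deriv (h i) t := fun i => by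
    funext t; simp
  have B := isBooklink_exp (d := d) i2.isLinkData_right (fun i t => hb i t)
    (fun i t (h0 : deriv (fun t => mu * h i t + 0) t = 0) =>
      show deriv (deriv fun t => mu * h i t + 0) t ≠ 0 from ?_) ?_
  · exact ⟨_, (i1.trans i2).trans (i2.isLinkData_right.isotopic_exp fun i t => hb i t), B⟩
  · rw [hdv] at h0 ⊢
    rw [deriv_const_mul_field]
    exact mul_ne_zero hmu0.ne' (hm i t ((mul_eq_zero.1 h0).resolve_left hmu0.ne'))
  · rw [← hd]
    congr 1
    ext q
    refine and_congr_right fun _ => ?_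
    change deriv (fun t => mu * h q.1 t + 0) q.2 = 0 ↔ _
    rw [hdv]
    simp [hmu0.ne']

/-- The converse of `exists_booklink_of_height`: off the missed page the angle is a globally defined
function, the imaginary part of a logarithm, and can serve as height. -/
lemma exists_height_of_booklink {γ : Fin k → ℝ → R3} {d : ℕ} (H : IsBooklink γ d)
    (h0 : pageNumber γ = 0) :
    ∃ (p : Fin k → ℝ → ℂ) (h : Fin k → ℝ → ℝ), Isotopic Set.univ γ (curve p h) ∧
      (∀ i, IsMorse (h i)) ∧ (criticalSet h).encard = 2 * (d : ℕ∞) := by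
  obtain ⟨θ, hθ⟩ : ∃ θ : ℝ, (support γ ∩ page θ).encard = 0 := by
    simpa [pageNumber, ENat.iInf_eq_zero] using h0
  rw [Set.encard_eq_zero, Set.eq_empty_iff_forall_notMem] at hθ
  obtain ⟨q, z, rfl⟩ : ∃ q z, γ = curve q z := ⟨_, _, (curve_coords γ).symm⟩
  have D := isLink_curve_iff.1 H.isLink
  -- This rotation moves the missed page to the negative real axis, the cut of the logarithm.
  have i1 := D.isotopic_rotate (Real.pi - θ)
  have hslit : ∀ i t, Complex.exp ((Real.pi - θ : ℝ) * Complex.I) * q i t ∈ Complex.slitPlane := by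
    intro i t
    rw [Complex.mem_slitPlane_iff_arg]
    have hq : q i t ≠ 0 := H.off_axis i t
    refine ⟨fun ha => ?_, mul_ne_zero (Complex.exp_ne_zero _) hq⟩
    apply hθ (curve q z i t)
    refine ⟨⟨i, t, rfl⟩, mem_page_iff.2 ⟨‖q i t‖, norm_pos_iff.2 hq, ?_⟩⟩
    have := Complex.norm_mul_exp_arg_mul_I (Complex.exp ((Real.pi - θ : ℝ) * Complex.I) * q i t)
    rw [ha, norm_mul, Complex.norm_exp_ofReal_mul_I, one_mul, Complex.exp_pi_mul_I] at this
    simp only [curve, planar_mk]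
    have e : Complex.exp (θ * Complex.I) * Complex.exp ((Real.pi - θ : ℝ) * Complex.I) = -1 := by
      rw [← Complex.exp_add, ← Complex.exp_pi_mul_I]
      congr 1; push_cast; ring
    linear_combination Complex.exp (θ * Complex.I) * this + q i t * e
  have i2 := i1.isLinkData_right.isotopic_log hslit
  have i3 := i2.isLinkData_right.isotopic_turn
  -- One turn alone would make the height minus the imaginary part; three turns give it the right
  -- sign.
  have i4 := i3.isLinkData_right.isotopic_turn
  have i5 := i4.isLinkData_right.isotopic_turn
  have i123 := (((i1.trans i2).trans i3).trans i4).trans i5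
  simp only [neg_neg] at i123
  have hv : ∀ i, deriv (fun t => (Complex.log (Complex.exp ((Real.pi - θ : ℝ) * Complex.I) *
      q i t)).im) = angularVelocity (curve q z i) := by
    intro i
    funext t
    have d := ((D.hasDerivAt_p i t).const_mul
      (Complex.exp ((Real.pi - θ : ℝ) * Complex.I))).clog_real (hslit i t)
    refine (Complex.imCLM.hasFDerivAt.comp_hasDerivAt t d).deriv.trans ?_
    rw [mul_div_mul_left _ _ (Complex.exp_ne_zero _)]
    rfl
  refine ⟨_, _, i123, fun i t h1 => ?_, ?_⟩
  · rw [hv] at h1 ⊢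
    exact H.nondegenerate i t h1
  · rw [← H.card_critical]
    congr 1
    ext q
    simp only [angularCritical, criticalSet, Set.mem_ofPred_eq, hv]

/-! ### The open book around the unit circle -/

/-- The argument of this function is an open book of the 3-sphere with binding the unit circle of
the horizontal plane. -/
def bookMap (p : ℂ) (z : ℝ) : ℂ := ⟨Complex.normSq p - 1, 2 * z⟩

lemma normSq_bookMap (p : ℂ) (z : ℝ) :
    Complex.normSq (bookMap p z) = (Complex.normSq p - 1) ^ 2 + 4 * z ^ 2 := by
  rw [bookMap, Complex.normSq_mk]; ring

/-- A rotation of the 3-sphere by the angle `a` in two coordinate planes, applied to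
`(2 * p, 2 * z, w)`. -/
def turnVec (a : ℝ) (p : ℂ) (z w : ℝ) : R4 :=
  !₂[Real.cos a * (2 * p.re) + Real.sin a * w, Real.cos a * (2 * p.im) + Real.sin a * (2 * z),
    -(Real.sin a * (2 * p.im)) + Real.cos a * (2 * z),
    -(Real.sin a * (2 * p.re)) + Real.cos a * w]

lemma turnVec_eq_smul {a r w w' z z' : ℝ} {p p' : ℂ} (h : turnVec a p z w = r • turnVec a p' z' w') :
    p = r * p' ∧ z = r * z' ∧ w = r * w' := by
  have e0 := congrArg (fun x : R4 => x 0) h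
  have e1 := congrArg (fun x : R4 => x 1) h
  have e2 := congrArg (fun x : R4 => x 2) h
  have e3 := congrArg (fun x : R4 => x 3) h
  simp [turnVec] at e0 e1 e2 e3
  set C := Real.cos a
  set S := Real.sin a
  have hCS : S ^ 2 + C ^ 2 = 1 := Real.sin_sq_add_cos_sq _
  refine ⟨Complex.ext ?_ ?_, ?_, ?_⟩
  · simp
    linear_combination (C / 2) * e0 - (S / 2) * e3 - (p.re - r * p'.re) * hCS
  · simp
    linear_combination (C / 2) * e1 - (S / 2) * e2 - (p.im - r * p'.im) * hCS
  · linear_combination (C / 2) * e2 + (S / 2) * e1 - (z - r * z') * hCS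
  · linear_combination C * e3 + S * e0 - (w - r * w') * hCS

lemma contDiff_turnVec {E : Type*} [NormedAddCommGroup E] [NormedSpace ℝ E]
    {a z w : E → ℝ} {p : E → ℂ} (ha : ContDiff ℝ ∞ a) (hp : ContDiff ℝ ∞ p) (hz : ContDiff ℝ ∞ z)
    (hw : ContDiff ℝ ∞ w) : ContDiff ℝ ∞ (fun x => turnVec (a x) (p x) (z x) (w x)) := by
  have hre : ContDiff ℝ ∞ (fun x => (p x).re) := Complex.reCLM.contDiff.comp hp
  have him : ContDiff ℝ ∞ (fun x => (p x).im) := Complex.imCLM.contDiff.comp hp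
  have hc := ha.cos
  have hs := ha.sin
  rw [contDiff_euclidean]
  intro i
  fin_cases i
  · exact (hc.mul (contDiff_const.mul hre)).add (hs.mul hw)
  · exact (hc.mul (contDiff_const.mul him)).add (hs.mul (contDiff_const.mul hz))
  · exact (hs.mul (contDiff_const.mul him)).neg.add (hc.mul (contDiff_const.mul hz))
  · exact (hs.mul (contDiff_const.mul hre)).neg.add (hc.mul hw)

lemma hasDerivAt_turnVec {a z' w' t : ℝ} {p' : ℂ} {z w : ℝ → ℝ} {p : ℝ → ℂ}
    (hp : HasDerivAt p p' t) (hz : HasDerivAt z z' t) (hw : HasDerivAt w w' t) :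
    HasDerivAt (fun t => turnVec a (p t) (z t) (w t)) (turnVec a p' z' w') t := by
  let l : ℂ × ℝ × ℝ →ₗ[ℝ] R4 :=
    { toFun := fun q => turnVec a q.1 q.2.1 q.2.2
      map_add' := fun q q' => by ext i; fin_cases i <;> simp [turnVec] <;> ring
      map_smul' := fun c q => by ext i; fin_cases i <;> simp [turnVec] <;> ring }
  exact l.toContinuousLinearMap.hasFDerivAt.comp_hasDerivAt t (hp.prodMk (hz.prodMk hw))

lemma norm_sq_turnVec (a : ℝ) (p : ℂ) (z w : ℝ) :
    ‖turnVec a p z w‖ ^ 2 = 4 * Complex.normSq p + 4 * z ^ 2 + w ^ 2 := by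
  rw [norm_sq_R4, Complex.normSq_apply]
  simp [turnVec]
  linear_combination (4 * (p.re * p.re + p.im * p.im) + 4 * z ^ 2 + w ^ 2) *
    Real.sin_sq_add_cos_sq a

lemma turnVec_zero (p : ℂ) (z : ℝ) :
    ‖turnVec 0 p z (Complex.normSq p - 1 + z ^ 2)‖⁻¹ •
      turnVec 0 p z (Complex.normSq p - 1 + z ^ 2) = stereoInv (mk p z) := by
  have hN := Complex.normSq_nonneg p
  have e1 : ‖turnVec 0 p z (Complex.normSq p - 1 + z ^ 2)‖ = Complex.normSq p + z ^ 2 + 1 := by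
    rw [← Real.sqrt_sq (norm_nonneg (turnVec _ _ _ _)), norm_sq_turnVec,
      ← Real.sqrt_sq (show (0 : ℝ) ≤ Complex.normSq p + z ^ 2 + 1 by positivity)]
    congr 1; ring
  have e2 : ‖mk p z‖ ^ 2 = Complex.normSq p + z ^ 2 := by
    rw [norm_sq_R3, Complex.normSq_apply]; simp [sq]
  rw [e1, stereoInv, e2]
  congr 1
  ext i; fin_cases i <;> simp [turnVec]; ring

lemma hasDerivAt_normSq {p : ℝ → ℂ} {p' : ℂ} {t : ℝ} (hp : HasDerivAt p p' t) :
    HasDerivAt (fun s => Complex.normSq (p s)) (2 * ((p t).re * p'.re + (p t).im * p'.im)) t := by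
  have h1 := Complex.reCLM.hasFDerivAt.comp_hasDerivAt t hp
  have h2 := Complex.imCLM.hasFDerivAt.comp_hasDerivAt t hp
  have := (h1.mul h1).add (h2.mul h2)
  refine (this.congr_deriv ?_).congr_of_eventuallyEq (Filter.Eventually.of_forall fun s => ?_)
  · simp; ring
  · simp [Complex.normSq_apply]

lemma contDiff_normSq {E : Type*} [NormedAddCommGroup E] [NormedSpace ℝ E] {p : E → ℂ}
    (hp : ContDiff ℝ ∞ p) : ContDiff ℝ ∞ (fun x => Complex.normSq (p x)) := by
  have hre : ContDiff ℝ ∞ (fun x => (p x).re) := Complex.reCLM.contDiff.comp hp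
  have him : ContDiff ℝ ∞ (fun x => (p x).im) := Complex.imCLM.contDiff.comp hp
  simpa only [Complex.normSq_apply] using (hre.mul hre).add (him.mul him)

/-- A link off the unit circle is isotopic in the 3-sphere to a link off the axis, on which the
angle is the argument of `bookMap`. -/
lemma represents_bookMap {p : Fin k → ℝ → ℂ} {z : Fin k → ℝ → ℝ} {L : Fin k → ℝ → R4}
    (HL : Represents (curve p z) L) (hW : ∀ i t, bookMap (p i t) (z i t) ≠ 0) :
    ∃ γ : Fin k → ℝ → R3, Represents γ L ∧
      (∀ i t, ∃ c : ℝ, 0 < c ∧ planar (γ i t) = c * bookMap (p i t) (z i t)) ∧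
      ∀ i t, angularVelocity (γ i) t =
        (deriv (fun s => bookMap (p i s) (z i s)) t / bookMap (p i t) (z i t)).im := by
  have D := isLink_curve_iff.1 HL.isLink
  -- Up to a positive factor `stereoInv` is `(2 * p, 2 * z, |p|² - 1 + z²)`. As `s` runs from `0` to
  -- `1` the term `z²` is removed while the vector makes a quarter turn; at `s = 1` the first two
  -- coordinates are exactly those of `bookMap`.
  let w : ℝ → Fin k → ℝ → ℝ := fun s i t => Complex.normSq (p i t) - 1 + (1 - s) * z i t ^ 2
  let V : ℝ → Fin k → ℝ → R4 :=
    fun s i t => turnVec (s * (Real.pi / 2)) (p i t) (z i t) (w s i t)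
  have hV0 : ∀ s i t, V s i t ≠ 0 := by
    intro s i t h0
    have := turnVec_eq_smul (r := 0) (p' := 0) (z' := 0) (w' := 0) (h0.trans (zero_smul ℝ _).symm)
    simp only [Complex.ofReal_zero, zero_mul, w] at this
    obtain ⟨h1, h2, h3⟩ := this
    rw [h1, h2] at h3
    norm_num at h3
  -- Two vectors of the family on one ray coincide: the last coordinate is not homogeneous, because
  -- of the constant `-1`, and this forces the factor `r` to be `1`.
  have key : ∀ s ∈ Set.Icc (0 : ℝ) 1, ∀ (x y : ℂ) (u v r : ℝ), 0 < r → x = r * y → u = r * v →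
      Complex.normSq x - 1 + (1 - s) * u ^ 2 = r * (Complex.normSq y - 1 + (1 - s) * v ^ 2) →
      r = 1 := by
    intro s hs x y u v r hr hx hu he
    rw [hx, hu, Complex.normSq_mul, Complex.normSq_ofReal] at he
    have h1 : (r - 1) * (r * (Complex.normSq y + (1 - s) * v ^ 2) + 1) = 0 := by
      linear_combination he
    have h2 : 0 < r * (Complex.normSq y + (1 - s) * v ^ 2) + 1 := by
      have := Complex.normSq_nonneg y
      have := sub_nonneg.2 hs.2
      positivity
    exact sub_eq_zero.1 ((mul_eq_zero.1 h1).resolve_right h2.ne')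
  have iso := isotopic_normalize V (fun i => contDiff_turnVec (contDiff_fst.mul contDiff_const)
      ((D.smooth_p i).comp contDiff_snd) ((D.smooth_h i).comp contDiff_snd)
      (((contDiff_normSq ((D.smooth_p i).comp contDiff_snd)).sub contDiff_const).add
        ((contDiff_const.sub contDiff_fst).mul (((D.smooth_h i).comp contDiff_snd).pow 2))))
    hV0 (fun s i t => by simp only [V, w, D.periodic_p i t, D.periodic_h i t])
    (fun s hs i j u t r hr he => ?_) (fun s hs i t r he => ?_)
  rotate_left
  · obtain ⟨h1, h2, h3⟩ := turnVec_eq_smul he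
    have hr1 := key s hs _ _ _ _ r hr h1 h2 h3
    rw [hr1] at h1 h2
    exact D.injective i j u t (by simpa using h1) (by simpa using h2)
  · have dw : HasDerivAt (w s i) (2 * ((p i t).re * (deriv (p i) t).re +
        (p i t).im * (deriv (p i) t).im) + (1 - s) * (2 * z i t * deriv (z i) t)) t := by
      have := ((hasDerivAt_normSq (D.hasDerivAt_p i t)).sub_const 1).add
        (((D.hasDerivAt_h i t).pow 2).const_mul (1 - s))
      exact this.congr_deriv (by simp)
    have dV := hasDerivAt_turnVec (a := s * (Real.pi / 2)) (D.hasDerivAt_p i t)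
      (D.hasDerivAt_h i t) dw
    obtain ⟨h1, h2, h3⟩ := turnVec_eq_smul (dV.deriv.symm.trans he)
    have h1r := congrArg Complex.re h1
    have h1i := congrArg Complex.im h1
    simp at h1r h1i
    have hr0 : r * (Complex.normSq (p i t) + (1 - s) * z i t ^ 2 + 1) = 0 := by
      rw [h2] at h3
      simp only [w, h1r, h1i, Complex.normSq_apply] at h3 ⊢
      linear_combination h3
    have h2' : 0 < Complex.normSq (p i t) + (1 - s) * z i t ^ 2 + 1 := by
      have := Complex.normSq_nonneg (p i t)
      have := sub_nonneg.2 hs.2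
      positivity
    have hr : r = 0 := (mul_eq_zero.1 hr0).resolve_right h2'.ne'
    rw [hr] at h1 h2
    exact D.immersion i t (by simpa using h1) (by simpa using h2)
  have e0 : (fun i t => ‖V 0 i t‖⁻¹ • V 0 i t) = fun i t => stereoInv (curve p z i t) := by
    funext i t
    simp only [V, w, zero_mul, sub_zero, one_mul]
    exact turnVec_zero _ _
  rw [e0] at iso
  have hV1 : ∀ i t, V 1 i t = !₂[Complex.normSq (p i t) - 1, 2 * z i t, -(2 * (p i t).im),
      -(2 * (p i t).re)] := by
    intro i t
    simp [V, w, turnVec]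
  -- Up to the norm this is the denominator in `stereo`. It is positive because the link avoids the
  -- unit circle, whose image under the rotation is the axis together with the centre of projection.
  have hn : ∀ i t, 0 < ‖V 1 i t‖ + 2 * (p i t).re := by
    intro i t
    have h1 : ‖V 1 i t‖ ^ 2 = 4 * Complex.normSq (p i t) + Complex.normSq (bookMap (p i t) (z i t)) := by
      rw [norm_sq_turnVec, normSq_bookMap]
      simp only [w]; ring
    have h2 := Complex.normSq_pos.2 (hW i t)
    have h3 : (2 * (p i t).re) ^ 2 < ‖V 1 i t‖ ^ 2 := by
      rw [h1, Complex.normSq_apply (p i t)]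
      nlinarith [mul_self_nonneg (p i t).im]
    have := abs_lt_of_sq_lt_sq h3 (norm_nonneg _)
    linarith [(abs_lt.1 this).1]
  have hY3 : ∀ i t, (‖V 1 i t‖⁻¹ • V 1 i t) 3 ≠ 1 := by
    intro i t h
    have hp := norm_pos_iff.2 (hV0 1 i t)
    have : (‖V 1 i t‖⁻¹ • V 1 i t) 3 = ‖V 1 i t‖⁻¹ * -(2 * (p i t).re) := by
      rw [PiLp.smul_apply, hV1 i t]; simp
    rw [this] at h
    field_simp at h
    linarith [hn i t]
  have hst : ∀ i t, planar (stereo (‖V 1 i t‖⁻¹ • V 1 i t)) =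
      ((‖V 1 i t‖ + 2 * (p i t).re)⁻¹ : ℝ) * bookMap (p i t) (z i t) := by
    intro i t
    have hp := norm_pos_iff.2 (hV0 1 i t)
    set n := ‖V 1 i t‖ with hndef
    have hne := (hn i t).ne'
    have hn1 : (1 - (n⁻¹ • V 1 i t) 3)⁻¹ = n * (n + 2 * (p i t).re)⁻¹ := by
      rw [PiLp.smul_apply, hV1 i t]
      simp
      field_simp
    rw [stereo, hn1, PiLp.smul_apply, PiLp.smul_apply, PiLp.smul_apply, hV1 i t]
    apply Complex.ext
    · rw [Complex.re_ofReal_mul]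
      simp [planar, bookMap]
      field_simp
    · rw [Complex.im_ofReal_mul]
      simp [planar, bookMap]
      field_simp
  refine ⟨fun i t => stereo (‖V 1 i t‖⁻¹ • V 1 i t),
    represents_stereo (iso.symm.trans HL.isotopic) hY3, fun i t => ⟨_, inv_pos.2 (hn i t), hst i t⟩,
    fun i t => ?_⟩
  have sW : ContDiff ℝ ∞ (fun t => bookMap (p i t) (z i t)) :=
    Complex.equivRealProdCLM.symm.contDiff.comp (((contDiff_normSq (D.smooth_p i)).sub
      contDiff_const).prodMk (contDiff_const.mul (D.smooth_h i)))
  have sV : ContDiff ℝ ∞ (V 1 i) := contDiff_turnVec contDiff_const (D.smooth_p i) (D.smooth_h i)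
    (((contDiff_normSq (D.smooth_p i)).sub contDiff_const).add
      (contDiff_const.mul ((D.smooth_h i).pow 2)))
  have sre : ContDiff ℝ ∞ (fun t => (p i t).re) := Complex.reCLM.contDiff.comp (D.smooth_p i)
  have sc : ContDiff ℝ ∞ (fun t => (‖V 1 i t‖ + 2 * (p i t).re)⁻¹) :=
    ((sV.norm ℝ (hV0 1 i)).add (contDiff_const.mul sre)).inv fun t => (hn i t).ne'
  have dc := (sc.differentiable (by simp) t).hasDerivAt.ofReal_comp
  have dW := (sW.differentiable (by simp) t).hasDerivAt
  have hc : (‖V 1 i t‖ + 2 * (p i t).re)⁻¹ ≠ 0 := (inv_pos.2 (hn i t)).ne'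
  simp only [angularVelocity, hst]
  have e : deriv (fun s => (((‖V 1 i s‖ + 2 * (p i s).re)⁻¹ : ℝ) : ℂ) * bookMap (p i s) (z i s)) t = _ :=
    (dc.mul dW).deriv
  -- The positive factor adds only a real term to the logarithmic derivative, so the angular
  -- velocity is that of `bookMap`.
  rw [e, add_div, mul_div_mul_left _ _ (Complex.ofReal_ne_zero.2 hc),
    mul_div_mul_right _ _ (hW i t), ← Complex.ofReal_div, Complex.add_im, Complex.ofReal_im, zero_add]

lemma im_deriv_bookMap {p : ℝ → ℂ} {z : ℝ → ℝ} {R' z' t : ℝ}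
    (hR : HasDerivAt (fun s => Complex.normSq (p s)) R' t) (hz : HasDerivAt z z' t) :
    (deriv (fun s => bookMap (p s) (z s)) t / bookMap (p t) (z t)).im =
      2 * ((Complex.normSq (p t) - 1) * z' - z t * R') /
        Complex.normSq (bookMap (p t) (z t)) := by
  have h := Complex.equivRealProdCLM.symm.hasFDerivAt.comp_hasDerivAt t
    ((hR.sub_const 1).prodMk (hz.const_mul 2))
  have e : deriv (fun s => bookMap (p s) (z s)) t = ⟨R', 2 * z'⟩ := h.deriv
  rw [e, Complex.div_im, bookMap]
  ring

/-! ### Booklinks from a tube around an ascending arc -/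

/-- The part of the link inside the unit cylinder is an arc that ascends from a minimum of the
height to a maximum, and is in good position with respect to the open book `bookMap`. -/
structure IsTube (p : Fin k → ℝ → ℂ) (h : Fin k → ℝ → ℝ) (i₀ : Fin k) (a b : ℝ) : Prop where
  lt : a < b
  lt_add_one : b < a + 1
  crit_left : deriv (h i₀) a = 0
  crit_right : deriv (h i₀) b = 0
  convex_left : 0 < deriv (deriv (h i₀)) a
  concave_right : deriv (deriv (h i₀)) b < 0
  ascending : ∀ t ∈ Set.Ioo a b, 0 < deriv (h i₀) t
  inside : ∀ t ∈ Set.Ioo a b, Complex.normSq (p i₀ t) < 1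
  boundary_left : Complex.normSq (p i₀ a) = 1
  boundary_right : Complex.normSq (p i₀ b) = 1
  outside : ∀ (j : Fin k) (s : ℝ), (¬∃ m : ℤ, j = i₀ ∧ s + m ∈ Set.Icc a b) → 1 < Complex.normSq (p j s)
  slope : ∀ t ∈ Set.Ioo a b, 0 < (1 - Complex.normSq (p i₀ t)) * deriv (h i₀) t +
    h i₀ t * deriv (fun s => Complex.normSq (p i₀ s)) t
  deriv_left : deriv (fun s => Complex.normSq (p i₀ s)) a < 0
  deriv_right : 0 < deriv (fun s => Complex.normSq (p i₀ s)) b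
  height_left : h i₀ a < 0
  height_right : 0 < h i₀ b

lemma periodic_add_int {E : Type*} {f : ℝ → E} (hf : Function.Periodic f 1) (t : ℝ) (m : ℤ) :
    f (t + m) = f t := by
  simpa using hf.zsmul m t

/-- A function that interpolates between `1` and the identity. -/
lemma exists_interpolation {y : ℝ} (hy : 0 < y) :
    ∃ g : ℝ → ℝ, ContDiff ℝ ∞ g ∧ (∀ x, 0 < g x) ∧ (∀ x, x ≤ y / 2 → g x = 1) ∧
      (∀ x, y ≤ x → g x = x) ∧ ∀ x, 0 ≤ x → x ≤ 1 → x * deriv g x ≤ g x := by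
  let c : ℝ → ℝ := fun x => Real.smoothTransition (2 * x / y - 1)
  have hc : ContDiff ℝ ∞ c := Real.smoothTransition.contDiff.comp
    (((contDiff_const.mul contDiff_id).div_const y).sub contDiff_const)
  have c0 : ∀ x, x ≤ y / 2 → c x = 0 := fun x hx => by
    refine Real.smoothTransition.zero_of_nonpos ?_
    rw [sub_nonpos, div_le_one hy]; linarith
  have c1 : ∀ x, y ≤ x → c x = 1 := fun x hx => by
    refine Real.smoothTransition.one_of_one_le ?_
    rw [le_sub_iff_add_le, le_div_iff₀ hy]; linarith
  have cm : Monotone c := fun u v huv => Real.smoothTransition.monotone (by gcongr)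
  have cnn : ∀ x, 0 ≤ c x := fun x => Real.smoothTransition.nonneg _
  have cle : ∀ x, c x ≤ 1 := fun x => Real.smoothTransition.le_one _
  refine ⟨fun x => (1 - c x) + c x * x, (contDiff_const.sub hc).add (hc.mul contDiff_id),
    fun x => ?_, fun x hx => by simp [c0 x hx], fun x hx => by simp [c1 x hx], fun x h0 h1 => ?_⟩
  · rcases le_total x (y / 2) with hx | hx
    · simp [c0 x hx]
    · rcases eq_or_lt_of_le (cnn x) with h | h
      · simp [← h]
      · have : 0 < c x * x := mul_pos h (by linarith)
        linarith [cle x]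
  · have dc := (hc.differentiable (by simp) x).hasDerivAt
    have d := (dc.const_sub 1).add (dc.mul (hasDerivAt_id x))
    have e : deriv (fun x => (1 - c x) + c x * x) x = _ := d.deriv
    rw [e]
    have hd : 0 ≤ deriv c x := cm.deriv_nonneg
    simp only [id]
    nlinarith [cle x, mul_nonneg (mul_nonneg hd h0) (sub_nonneg.2 h1)]

lemma eventually_neg_right {f : ℝ → ℝ} {t c : ℝ} (hd : HasDerivAt f c t) (h0 : f t = 0)
    (hc : c < 0) : ∀ᶠ u in nhdsWithin t (Set.Ioi t), f u < 0 := by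
  have := (hasDerivAt_iff_tendsto_slope.1 hd).eventually (gt_mem_nhds hc)
  have := this.filter_mono (nhdsWithin_mono t fun u (hu : u ∈ Set.Ioi t) => ne_of_gt hu)
  filter_upwards [this, self_mem_nhdsWithin] with u hu htu
  rw [slope_def_field, h0, sub_zero] at hu
  exact (div_neg_iff.1 hu).elim (fun h => absurd h.2 (by simp at htu; linarith)) fun h => h.1

lemma eventually_neg_left {f : ℝ → ℝ} {t c : ℝ} (hd : HasDerivAt f c t) (h0 : f t = 0)
    (hc : 0 < c) : ∀ᶠ u in nhdsWithin t (Set.Iio t), f u < 0 := by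
  have := (hasDerivAt_iff_tendsto_slope.1 hd).eventually (lt_mem_nhds hc)
  have := this.filter_mono (nhdsWithin_mono t fun u (hu : u ∈ Set.Iio t) => ne_of_lt hu)
  filter_upwards [this, self_mem_nhdsWithin] with u hu htu
  rw [slope_def_field, h0, sub_zero] at hu
  exact (div_pos_iff.1 hu).elim (fun h => absurd h.2 (by simp at htu; linarith)) fun h => h.1

/-- A finite family of periodic functions that exceeds `c` off an open arc exceeds `c` by a fixed
amount off the arc. -/
lemma exists_gap {R : Fin k → ℝ → ℝ} (hR : ∀ j, Continuous (R j))
    (hp : ∀ j, Function.Periodic (R j) 1) {i₀ : Fin k} {u v c : ℝ} (huv : u < v)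
    (hvu : v < u + 1)
    (hout : ∀ (j : Fin k) (s : ℝ), (¬∃ m : ℤ, j = i₀ ∧ s + m ∈ Set.Ioo u v) → c < R j s) :
    ∃ y, 0 < y ∧ ∀ (j : Fin k) (s : ℝ), R j s ≤ c + y → ∃ m : ℤ, j = i₀ ∧ s + m ∈ Set.Ioo u v := by
  have main : ∀ j, ∃ y, 0 < y ∧ ∀ s : ℝ, (¬∃ m : ℤ, j = i₀ ∧ s + m ∈ Set.Ioo u v) → c + y < R j s := by
    intro j
    let l : ℝ := if j = i₀ then v else u
    have hl : l ≤ u + 1 := by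
      by_cases hj : j = i₀
      · simp only [l, if_pos hj]; exact hvu.le
      · simp only [l, if_neg hj]; linarith
    obtain ⟨x, hx, hmin⟩ := (isCompact_Icc (a := l) (b := u + 1)).exists_isMinOn
      (Set.nonempty_Icc.2 hl) (hR j).continuousOn
    have hxc : c < R j x := by
      apply hout
      rintro ⟨m, hj, hm⟩
      simp only [l, if_pos hj] at hx
      have h1 : (m : ℝ) < 0 := by linarith [hx.1, hm.2]
      have h2 : (-1 : ℝ) < m := by linarith [hx.2, hm.1]
      have h1' : m < 0 := by exact_mod_cast h1
      have h2' : -1 < m := by exact_mod_cast h2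
      omega
    refine ⟨(R j x - c) / 2, by linarith, fun s hs => ?_⟩
    obtain ⟨m, hm⟩ := (existsUnique_add_zsmul_mem_Ioc one_pos s u).exists
    have hm' : s + (m : ℝ) ∈ Set.Ioc u (u + 1) := by simpa using hm
    have hmem : s + (m : ℝ) ∈ Set.Icc l (u + 1) := by
      refine ⟨?_, hm'.2⟩
      by_cases hj : j = i₀
      · simp only [l, if_pos hj]
        by_contra hc
        exact hs ⟨m, hj, hm'.1, not_le.1 hc⟩
      · simp only [l, if_neg hj]; exact hm'.1.le
    have := hmin hmem
    simp only [Set.mem_ofPred_eq] at this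
    rw [periodic_add_int (hp j)] at this
    linarith
  choose y hy0 hy using main
  have hne : (Finset.univ : Finset (Fin k)).Nonempty := ⟨i₀, Finset.mem_univ _⟩
  refine ⟨Finset.univ.inf' hne y, (Finset.lt_inf'_iff hne).2 fun j _ => hy0 j, fun j s hs => ?_⟩
  by_contra hc
  have := hy j s hc
  have := Finset.inf'_le y (Finset.mem_univ j)
  linarith

/-- The heights are multiplied by `g (R - 1)`, a positive function of the squared radius `R`, which
is a vertical isotopy. It equals `1` on the arc, so nothing changes there, and `R - 1` far out,
where `bookMap` becomes `(R - 1) * (1 + 2 * h * I)`. Thus the angle has the critical points of `h`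
far out. Near the cylinder the conditions of `IsTube` and the inequality `x * g' ≤ g` make the angle
strictly monotone, which removes the two ends of the arc from the critical set. -/
lemma exists_booklink_of_isTube {p : Fin k → ℝ → ℂ} {h : Fin k → ℝ → ℝ} {i₀ : Fin k} {a b : ℝ}
    {L : Fin k → ℝ → R4} (HL : Represents (curve p h) L) (hm : ∀ i, IsMorse (h i))
    (T : IsTube p h i₀ a b) {d : ℕ} (hd : (criticalSet h).encard = 2 * ((d + 1 : ℕ) : ℕ∞)) :
    ∃ γ : Fin k → ℝ → R3, Represents γ L ∧ IsBooklink γ d ∧ pageNumber γ ≤ 1 := by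
  have D := isLink_curve_iff.1 HL.isLink
  set R : Fin k → ℝ → ℝ := fun i s => Complex.normSq (p i s) with hRdef
  have sR : ∀ i, ContDiff ℝ ∞ (R i) := fun i => contDiff_normSq (D.smooth_p i)
  have pR : ∀ i, Function.Periodic (R i) 1 := fun i t => by simp only [R, D.periodic_p i t]
  have dR : ∀ i t, HasDerivAt (R i) (deriv (R i) t) t := fun i t =>
    ((sR i).differentiable (by simp) t).hasDerivAt
  have sh := D.smooth_h
  have sh' := fun i => contDiff_deriv_of_smooth (sh i)
  have sR' := fun i => contDiff_deriv_of_smooth (sR i)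
  have dh' : ∀ i t, HasDerivAt (deriv (h i)) (deriv (deriv (h i)) t) t := fun i t =>
    ((sh' i).differentiable (by simp) t).hasDerivAt
  -- the two ends of the arc
  obtain ⟨v, hbv, hv⟩ : ∃ v, b < v ∧ ∀ t ∈ Set.Ioo b v,
      deriv (h i₀) t < 0 ∧ 0 < deriv (R i₀) t ∧ 0 < h i₀ t := by
    have e1 := eventually_neg_right (dh' i₀ b) T.crit_right T.concave_right
    have e2 : ∀ᶠ u in nhdsWithin b (Set.Ioi b), 0 < deriv (R i₀) u :=
      ((sR' i₀).continuous.continuousAt.eventually (lt_mem_nhds T.deriv_right)).filter_mono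
        nhdsWithin_le_nhds
    have e3 : ∀ᶠ u in nhdsWithin b (Set.Ioi b), 0 < h i₀ u :=
      ((sh i₀).continuous.continuousAt.eventually (lt_mem_nhds T.height_right)).filter_mono
        nhdsWithin_le_nhds
    obtain ⟨v, hv, hs⟩ := mem_nhdsGT_iff_exists_Ioo_subset.1 ((e1.and (e2.and e3)))
    exact ⟨v, hv, fun t ht => hs ht⟩
  obtain ⟨u, hua, hu⟩ : ∃ u, u < a ∧ ∀ t ∈ Set.Ioo u a,
      deriv (h i₀) t < 0 ∧ deriv (R i₀) t < 0 ∧ h i₀ t < 0 := by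
    have e1 := eventually_neg_left (dh' i₀ a) T.crit_left T.convex_left
    have e2 : ∀ᶠ u in nhdsWithin a (Set.Iio a), deriv (R i₀) u < 0 :=
      ((sR' i₀).continuous.continuousAt.eventually (gt_mem_nhds T.deriv_left)).filter_mono
        nhdsWithin_le_nhds
    have e3 : ∀ᶠ u in nhdsWithin a (Set.Iio a), h i₀ u < 0 :=
      ((sh i₀).continuous.continuousAt.eventually (gt_mem_nhds T.height_left)).filter_mono
        nhdsWithin_le_nhds
    obtain ⟨u, hu, hs⟩ := mem_nhdsLT_iff_exists_Ioo_subset.1 ((e1.and (e2.and e3)))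
    exact ⟨u, hu, fun t ht => hs ht⟩
  obtain ⟨u, v, hua, hbv, hvu, hu, hv⟩ : ∃ u v, u < a ∧ b < v ∧ v < u + 1 ∧
      (∀ t ∈ Set.Ioo u a, deriv (h i₀) t < 0 ∧ deriv (R i₀) t < 0 ∧ h i₀ t < 0) ∧
      ∀ t ∈ Set.Ioo b v, deriv (h i₀) t < 0 ∧ 0 < deriv (R i₀) t ∧ 0 < h i₀ t := by
    have := T.lt_add_one
    -- The collars are shortened to at most a third of the complementary arc each, so that with the
    -- arc they do not fill a whole period.
    refine ⟨max u (a - (a + 1 - b) / 3), min v (b + (a + 1 - b) / 3), max_lt hua (by linarith),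
      lt_min hbv (by linarith), ?_, fun t ht => hu t ⟨(le_max_left _ _).trans_lt ht.1, ht.2⟩,
      fun t ht => hv t ⟨ht.1, ht.2.trans_le (min_le_left _ _)⟩⟩
    have h1 := le_max_right u (a - (a + 1 - b) / 3)
    have h2 := min_le_right v (b + (a + 1 - b) / 3)
    linarith
  have huv : u < v := by linarith [T.lt]
  obtain ⟨y, hy0, hy1, hgap⟩ : ∃ y, 0 < y ∧ y ≤ 1 ∧ ∀ (j : Fin k) (s : ℝ), R j s ≤ 1 + y →
      ∃ m : ℤ, j = i₀ ∧ s + m ∈ Set.Ioo u v := by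
    obtain ⟨y, hy0, hy⟩ := exists_gap (c := 1) (fun j => (sR j).continuous) pR (i₀ := i₀) huv hvu
      fun j s hs => T.outside j s fun ⟨m, hj, hm⟩ =>
        hs ⟨m, hj, lt_of_lt_of_le hua hm.1, lt_of_le_of_lt hm.2 hbv⟩
    exact ⟨min y 1, lt_min hy0 one_pos, min_le_right _ _, fun j s hs =>
      hy j s (hs.trans (by linarith [min_le_left y 1]))⟩
  obtain ⟨g, sg, gpos, g1, gid, gder⟩ := exists_interpolation hy0
  -- the vertical isotopy
  set z : Fin k → ℝ → ℝ := fun i t => h i t * g (R i t - 1) with hz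
  have sz : ∀ i, ContDiff ℝ ∞ (z i) := fun i =>
    (sh i).mul (sg.comp ((sR i).sub contDiff_const))
  have dz : ∀ i t, HasDerivAt (z i)
      (deriv (h i) t * g (R i t - 1) + h i t * (deriv g (R i t - 1) * deriv (R i) t)) t := by
    intro i t
    have dg := (sg.differentiable (by simp) (R i t - 1)).hasDerivAt
    exact (D.hasDerivAt_h i t).mul (dg.comp t ((dR i t).sub_const 1))
  have pz : ∀ i, Function.Periodic (z i) 1 := fun i t => by
    simp only [z, D.periodic_h i t, pR i t]
  have iso := D.isotopic_vertical sz pz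
    (fun i j s t he hlt => by
      simp only [z, R, he]
      exact mul_lt_mul_of_pos_right hlt (gpos _))
    (fun i t h0 => by
      have hR0 : deriv (R i) t = 0 := by
        have := hasDerivAt_normSq (D.hasDerivAt_p i t)
        rw [h0] at this
        simpa using this.deriv
      rw [(dz i t).deriv, hR0, mul_zero, mul_zero, add_zero, ← mul_assoc]
      exact mul_pos (mul_self_pos.2 (D.immersion i t h0)) (gpos _))
  have HL' := HL.of_isotopic iso
  -- points of the link near the arc
  have inner : ∀ t ∈ Set.Icc a b, R i₀ t ≤ 1 := by
    intro t ht
    rcases eq_or_lt_of_le ht.1 with rfl | h1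
    · exact T.boundary_left.le
    rcases eq_or_lt_of_le ht.2 with rfl | h2
    · exact T.boundary_right.le
    exact (T.inside t ⟨h1, h2⟩).le
  have outer : ∀ t ∈ Set.Ioo u v, t ∉ Set.Icc a b → 1 < R i₀ t := by
    intro t ht hn
    refine T.outside i₀ t ?_
    rintro ⟨m, -, hm⟩
    have hm1 : (m : ℝ) < 1 := by linarith [hm.2, ht.1]
    have hm2 : (-1 : ℝ) < m := by linarith [hm.1, ht.2]
    have hm1' : m < 1 := by exact_mod_cast hm1
    have hm2' : -1 < m := by exact_mod_cast hm2
    have : m = 0 := by omega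
    rw [this] at hm
    exact hn (by simpa using hm)
  -- `N` is the angular velocity up to a positive factor; the aim is `N < 0` wherever `R ≤ 1 + y`.
  set N : Fin k → ℝ → ℝ := fun i t => (R i t - 1) * deriv (z i) t - z i t * deriv (R i) t with hN
  have pN : ∀ i, Function.Periodic (N i) 1 := fun i t => by
    simp only [N, pR i t, pz i t, periodic_deriv (pz i) t, periodic_deriv (pR i) t]
  have Nform : ∀ i t, N i t = (R i t - 1) * g (R i t - 1) * deriv (h i) t +
      h i t * deriv (R i) t * ((R i t - 1) * deriv g (R i t - 1) - g (R i t - 1)) := by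
    intro i t
    simp only [N, (dz i t).deriv, z]; ring
  have g1' : ∀ x, x < y / 2 → deriv g x = 0 := fun x hx => by
    have : g =ᶠ[nhds x] fun _ => 1 := by
      filter_upwards [gt_mem_nhds hx] with w hw using g1 w hw.le
    simpa using this.deriv_eq
  have arcN : ∀ t ∈ Set.Icc a b, N i₀ t < 0 := by
    intro t ht
    have hle := inner t ht
    rw [Nform, g1 _ (by linarith), g1' _ (by linarith)]
    rcases eq_or_lt_of_le ht.1 with rfl | h1
    · have := T.boundary_left
      have h2 := mul_pos_of_neg_of_neg T.height_left T.deriv_left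
      rw [T.crit_left]
      simp only [R] at h2 ⊢
      linarith
    rcases eq_or_lt_of_le ht.2 with rfl | h2
    · have h2 := mul_pos T.height_right T.deriv_right
      rw [T.crit_right]
      simp only [R] at h2 ⊢
      linarith
    have := T.slope t ⟨h1, h2⟩
    simp only [R] at this ⊢
    linarith
  have capN : ∀ t ∈ Set.Ioo u v, R i₀ t ≤ 1 + y → N i₀ t < 0 := by
    intro t ht hR1
    by_cases hmem : t ∈ Set.Icc a b
    · exact arcN t hmem
    have hgt := outer t ht hmem
    -- In the collars the height descends while `h * R'` is nonnegative. With `hg` both summands of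
    -- `Nform` have the right sign.
    have hg := gder (R i₀ t - 1) (by linarith) (by linarith)
    have hneg : deriv (h i₀) t < 0 ∧ 0 ≤ h i₀ t * deriv (R i₀) t := by
      rw [Set.mem_Icc, not_and_or, not_le, not_le] at hmem
      rcases hmem with hlt | hlt
      · have := hu t ⟨ht.1, hlt⟩
        exact ⟨this.1, (mul_pos_of_neg_of_neg this.2.2 this.2.1).le⟩
      · have := hv t ⟨hlt, ht.2⟩
        exact ⟨this.1, (mul_pos this.2.2 this.2.1).le⟩
    rw [Nform]
    have h1 := mul_neg_of_pos_of_neg (mul_pos (sub_pos.2 hgt) (gpos (R i₀ t - 1))) hneg.1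
    have h2 := mul_nonpos_of_nonneg_of_nonpos hneg.2 (sub_nonpos.2 hg)
    linarith
  have near : ∀ (j : Fin k) (s : ℝ), R j s ≤ 1 + y → N j s < 0 := by
    intro j s hs
    obtain ⟨m, rfl, hm⟩ := hgap j s hs
    have := capN _ hm (by rw [periodic_add_int (pR j)]; exact hs)
    rwa [periodic_add_int (pN j)] at this
  have hW : ∀ i t, bookMap (p i t) (z i t) ≠ 0 := by
    intro i t h0
    have h1 : R i t - 1 = 0 := congrArg Complex.re h0
    have h2 : 2 * z i t = 0 := congrArg Complex.im h0
    have := near i t (by linarith)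
    simp only [N, h1, (mul_eq_zero.1 h2).resolve_left two_ne_zero] at this
    simp at this
  obtain ⟨γ, hγL, hplanar, hav⟩ := represents_bookMap HL' hW
  have av : ∀ i t, angularVelocity (γ i) t = 2 * N i t / Complex.normSq (bookMap (p i t) (z i t)) := by
    intro i t
    rw [hav, im_deriv_bookMap (dR i t) ((sz i).differentiable (by simp) t).hasDerivAt]
  -- Here `g` is the identity, the terms with `R'` cancel, and the right-hand side is the derivative
  -- of `arctan (2 * h)`.
  have avfar : ∀ i t, 1 + y < R i t →
      angularVelocity (γ i) =ᶠ[nhds t] fun t => 2 * deriv (h i) t / (1 + 4 * h i t ^ 2) := by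
    intro i t ht
    filter_upwards [(sR i).continuous.continuousAt.eventually (lt_mem_nhds ht)] with s hs
    have hg : g (R i s - 1) = R i s - 1 := gid _ (by linarith)
    have hg' : deriv g (R i s - 1) = 1 := by
      have : g =ᶠ[nhds (R i s - 1)] id := by
        filter_upwards [lt_mem_nhds (show y < R i s - 1 by linarith)] with w hw using gid w hw.le
      simpa using this.deriv_eq
    have hne : R i s - 1 ≠ 0 := by linarith
    have hq : (1 + 4 * h i s ^ 2) ≠ 0 := by positivity
    have e : Complex.normSq (bookMap (p i s) (z i s)) = (R i s - 1) ^ 2 * (1 + 4 * h i s ^ 2) := by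
      rw [normSq_bookMap]
      simp only [z, hg]
      simp only [R]
      ring
    rw [av, e, Nform, hg, hg']
    field_simp
    ring
  have avzero : ∀ i t, angularVelocity (γ i) t = 0 ↔ 1 + y < R i t ∧ deriv (h i) t = 0 := by
    intro i t
    have hq : (1 + 4 * h i t ^ 2) ≠ 0 := by positivity
    by_cases hf : 1 + y < R i t
    · rw [(avfar i t hf).self_of_nhds]
      simp [hf, hq]
    · simp only [hf, false_and, iff_false]
      rw [av]
      have h1 := near i t (not_lt.1 hf)
      have h2 := Complex.normSq_pos.2 (hW i t)
      exact div_ne_zero (by linarith) h2.ne'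
  refine ⟨γ, hγL, ⟨hγL.isLink, fun i t => ?_, fun i t h0 => ?_, ?_⟩, ?_⟩
  · obtain ⟨c, hc, e⟩ := hplanar i t
    rw [e]
    exact mul_ne_zero (Complex.ofReal_ne_zero.2 hc.ne') (hW i t)
  · obtain ⟨hf, h1⟩ := (avzero i t).1 h0
    rw [(avfar i t hf).deriv_eq]
    have hq : (1 + 4 * h i t ^ 2) ≠ 0 := by positivity
    have d1 := ((dh' i t).const_mul 2).div
      ((((D.hasDerivAt_h i t).pow 2).const_mul 4).const_add 1) hq
    have e : deriv (fun t => 2 * deriv (h i) t / (1 + 4 * h i t ^ 2)) t = _ := d1.deriv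
    rw [e]
    simp only [h1, mul_zero, sub_zero]
    refine div_ne_zero (mul_ne_zero (mul_ne_zero two_ne_zero (hm i t h1)) hq) (pow_ne_zero 2 hq)
  · have hfa : Int.fract a + (⌊a⌋ : ℝ) = a := Int.fract_add_floor a
    have hfb : Int.fract b + (⌊b⌋ : ℝ) = b := Int.fract_add_floor b
    -- Near the cylinder the critical points of the height are the two ends of the arc only, since
    -- the height is strictly monotone on the arc and on both collars.
    have hset : angularCritical γ = criticalSet h \ {(i₀, Int.fract a), (i₀, Int.fract b)} := by
      ext ⟨j, s⟩
      simp only [angularCritical, criticalSet, Set.mem_ofPred_eq, Set.mem_sdiff, avzero,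
        Set.mem_insert_iff, Set.mem_singleton_iff, Prod.mk.injEq, not_or, not_and]
      constructor
      · rintro ⟨hs, hf, h0⟩
        refine ⟨⟨hs, h0⟩, ?_, ?_⟩
        · rintro rfl rfl
          have := inner a (Set.left_mem_Icc.2 T.lt.le)
          rw [← hfa, periodic_add_int (pR j)] at this
          linarith
        · rintro rfl rfl
          have := inner b (Set.right_mem_Icc.2 T.lt.le)
          rw [← hfb, periodic_add_int (pR j)] at this
          linarith
      · rintro ⟨⟨hs, h0⟩, hna, hnb⟩
        refine ⟨hs, ?_, h0⟩
        by_contra hf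
        obtain ⟨m, rfl, hm'⟩ := hgap j s (not_lt.1 hf)
        have h0' : deriv (h j) (s + m) = 0 := by
          rw [periodic_add_int (periodic_deriv (D.periodic_h j)), h0]
        have hfr : Int.fract (s + m) = s := by
          rw [Int.fract_add_intCast, Int.fract_eq_self]; exact hs
        rcases lt_trichotomy (s + m) a with hlt | heq | hgt
        · exact (hu _ ⟨hm'.1, hlt⟩).1.ne h0'
        · exact hna rfl (by rw [← hfr, heq])
        · rcases lt_trichotomy (s + m) b with hlt | heq | hgt'
          · exact (T.ascending _ ⟨hgt, hlt⟩).ne' h0'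
          · exact hnb rfl (by rw [← hfr, heq])
          · exact (hv _ ⟨hgt', hm'.2⟩).1.ne h0'
    have hsub : ({(i₀, Int.fract a), (i₀, Int.fract b)} : Set (Fin k × ℝ)) ⊆ criticalSet h := by
      rintro q (rfl | rfl)
      · refine ⟨⟨Int.fract_nonneg _, Int.fract_lt_one _⟩, ?_⟩
        have := periodic_add_int (periodic_deriv (D.periodic_h i₀)) (Int.fract a) ⌊a⌋
        rw [hfa] at this
        exact this.symm.trans T.crit_left
      · refine ⟨⟨Int.fract_nonneg _, Int.fract_lt_one _⟩, ?_⟩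
        have := periodic_add_int (periodic_deriv (D.periodic_h i₀)) (Int.fract b) ⌊b⌋
        rw [hfb] at this
        exact this.symm.trans T.crit_right
    have hne : ((i₀, Int.fract a) : Fin k × ℝ) ≠ (i₀, Int.fract b) := by
      intro he
      obtain ⟨m, hm'⟩ := Int.fract_eq_fract.1 (congrArg Prod.snd he)
      have hm1 : (m : ℝ) < 0 := by linarith [T.lt]
      have hm2 : (-1 : ℝ) < m := by linarith [T.lt_add_one]
      have hm1' : m < 0 := by exact_mod_cast hm1
      have hm2' : -1 < m := by exact_mod_cast hm2
      omega
    have hcard := Set.encard_sdiff_add_encard_of_subset hsub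
    rw [hd, Set.encard_pair hne, ← hset] at hcard
    have : (2 : ℕ∞) * ((d + 1 : ℕ) : ℕ∞) = 2 * (d : ℕ∞) + 2 := by push_cast; ring
    rw [this] at hcard
    exact (ENat.add_left_injective_of_ne_top (by simp)) hcard
  -- On the page at angle `π` the value of `bookMap` is a negative real number, so the point lies
  -- inside the cylinder at height `0`; the ascending arc has at most one such point.
  · refine (iInf_le _ Real.pi).trans (Set.encard_le_one_iff.2 ?_)
    have mono : StrictMonoOn (h i₀) (Set.Icc a b) :=
      strictMonoOn_of_deriv_pos (convex_Icc a b) (sh i₀).continuous.continuousOn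
        (by rw [interior_Icc]; exact T.ascending)
    have key : ∀ x ∈ support γ ∩ page Real.pi, ∃ t ∈ Set.Icc a b, h i₀ t = 0 ∧ x = γ i₀ t := by
      rintro x ⟨⟨j, s, rfl⟩, hx⟩
      obtain ⟨r, hr, e⟩ := mem_page_iff.1 hx
      obtain ⟨c, hc, e'⟩ := hplanar j s
      rw [e', Complex.exp_pi_mul_I] at e
      have er := congrArg Complex.re e
      have ei := congrArg Complex.im e
      rw [Complex.re_ofReal_mul] at er
      rw [Complex.im_ofReal_mul] at ei
      have hz0 : 2 * (h j s * g (R j s - 1)) = 0 := by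
        have : c * (2 * (h j s * g (R j s - 1))) = 0 := by simpa [bookMap, z] using ei
        exact (mul_eq_zero.1 this).resolve_left hc.ne'
      have hh : h j s = 0 := by
        have := (mul_eq_zero.1 hz0).resolve_left two_ne_zero
        exact (mul_eq_zero.1 this).resolve_right (gpos _).ne'
      have hlt : R j s < 1 := by
        have : c * (R j s - 1) = -r := by simpa [bookMap] using er
        by_contra hcon
        have := mul_nonneg hc.le (sub_nonneg.2 (not_lt.1 hcon))
        linarith
      have hin : ∃ m : ℤ, j = i₀ ∧ s + m ∈ Set.Icc a b := by
        by_contra hcon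
        exact absurd (T.outside j s hcon) (not_lt.2 hlt.le)
      obtain ⟨m, rfl, hm'⟩ := hin
      exact ⟨s + m, hm', by rw [periodic_add_int (D.periodic_h j), hh],
        (periodic_add_int (hγL.isLink.periodic j) s m).symm⟩
    intro x y hx hy
    obtain ⟨t, ht, ht0, rfl⟩ := key x hx
    obtain ⟨t', ht', ht0', rfl⟩ := key y hy
    rw [mono.injOn ht ht' (ht0.trans ht0'.symm)]

/-! ### The end of an ascending arc -/

/-- Deviation of a curve from its tangent, given a bound for the deviation of the velocity. -/
lemma norm_sub_sub_smul_le {E : Type*} [NormedAddCommGroup E] [NormedSpace ℝ E] {f : ℝ → E}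
    (hf : Differentiable ℝ f) {v : E} {C b r : ℝ}
    (hv : ∀ t ∈ Set.Icc (b - r) (b + r), ‖deriv f t - v‖ ≤ C) {s t : ℝ}
    (hs : s ∈ Set.Icc (b - r) (b + r)) (ht : t ∈ Set.Icc (b - r) (b + r)) :
    ‖f t - f s - (t - s) • v‖ ≤ C * |t - s| := by
  have hd : ∀ x, HasDerivAt (fun x => f x - x • v) (deriv f x - v) x := fun x => by
    exact ((hf x).hasDerivAt.sub ((hasDerivAt_id x).smul_const v)).congr_deriv (by simp)
  have := (convex_Icc (b - r) (b + r)).norm_image_sub_le_of_norm_deriv_le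
    (f := fun x => f x - x • v) (C := C) (fun x _ => (hd x).differentiableAt)
    (fun x hx => by rw [(hd x).deriv]; exact hv x hx) hs ht
  rw [Real.norm_eq_abs] at this
  refine le_trans (le_of_eq ?_) this
  congr 1
  rw [sub_smul]; abel

lemma abs_re_im_le {z : ℂ} {x C : ℝ} (h : ‖z - x‖ ≤ C) : |z.re - x| ≤ C ∧ |z.im| ≤ C := by
  have h1 := (Complex.abs_re_le_norm (z - x)).trans h
  have h2 := (Complex.abs_im_le_norm (z - x)).trans h
  simp only [Complex.sub_re, Complex.ofReal_re, Complex.sub_im, Complex.ofReal_im, sub_zero] at h1 h2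
  exact ⟨h1, h2⟩

set_option maxHeartbeats 800000 in
/-- Near a maximum `b` of the height at the end of an ascending arc, the arc can be moved onto a
centre (`X` is its relative position), within discs of a given small radius `K` whose boundary the
curve crosses at `b`; the curve stays outside of the discs just after `b`. -/
lemma exists_cap {p : ℝ → ℂ} {h : ℝ → ℝ} (sp : ContDiff ℝ ∞ p) (sh : ContDiff ℝ ∞ h) {a b δ : ℝ}
    (hδ : 0 < δ) (hδab : δ ≤ b - a) (hmono : StrictMonoOn h (Set.Icc a b))
    (h0 : deriv h b = 0) (h2 : deriv (deriv h) b < 0) (hp : deriv p b ≠ 0) :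
    ∃ K₀ τ : ℝ, 0 < K₀ ∧ 0 < τ ∧ (∀ s ∈ Set.Ioc b (b + τ), h a ≤ h s ∧ h s ≤ h b) ∧
      ∀ K ∈ Set.Ioo 0 K₀, ∃ X : ℝ → ℂ, ContDiff ℝ ∞ X ∧ (∀ t ≤ b - δ, X t = 0) ∧
        (∃ u : ℂ, ∃ ε > 0, ∀ t, b - ε ≤ t → X t = p t - u) ∧
        (∀ t < b, Complex.normSq (X t) < K ^ 2) ∧ Complex.normSq (X b) = K ^ 2 ∧
        (∀ t ≤ b, 0 ≤ deriv (fun t => Complex.normSq (X t)) t) ∧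
        0 < deriv (fun t => Complex.normSq (X t)) b ∧
        ∀ s ∈ Set.Ioc b (b + τ), ∀ t ∈ Set.Icc a b, h t = h s →
          b - δ ≤ t ∧ K ^ 2 < Complex.normSq (p s - p t + X t) := by
  set ν : ℝ := ‖deriv p b‖ with hν
  have hν0 : 0 < ν := norm_pos_iff.2 hp
  set e : ℂ := deriv p b / ν with he
  have hν0' : (ν : ℂ) ≠ 0 := Complex.ofReal_ne_zero.2 hν0.ne'
  have hne : Complex.normSq e = 1 := by
    rw [he, Complex.normSq_div, Complex.normSq_ofReal, Complex.normSq_eq_norm_sq, ← hν]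
    field_simp
  have hec : e * (starRingEnd ℂ) e = 1 := by rw [Complex.mul_conj, hne, Complex.ofReal_one]
  -- the position relative to the maximum, with the velocity at the maximum real
  set q : ℝ → ℂ := fun t => (starRingEnd ℂ) e * (p t - p b) with hq
  have hpq : ∀ t, p t = p b + e * q t := fun t => by
    simp only [q]
    linear_combination (-(p t - p b)) * hec
  have sq : ContDiff ℝ ∞ q := contDiff_const.mul (sp.sub contDiff_const)
  have dq : ∀ t, HasDerivAt q (deriv q t) t := fun t =>
    (sq.differentiable (by simp) t).hasDerivAt
  have hqb : q b = 0 := by simp [q]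
  have hqb' : deriv q b = ν := by
    have := (((sp.differentiable (by simp) b).hasDerivAt.sub_const (p b)).const_mul
      ((starRingEnd ℂ) e)).deriv
    refine Eq.trans this ?_
    have h1 : deriv p b = e * ν := by rw [he]; field_simp
    rw [h1]
    linear_combination (ν : ℂ) * hec
  set c : ℝ := -deriv (deriv h) b with hc
  have hc0 : 0 < c := by simpa [c] using h2
  have sh' := contDiff_deriv_of_smooth sh
  have sq' := contDiff_deriv_of_smooth sq
  obtain ⟨r, hr0, hrδ, hrq, hrh⟩ : ∃ r, 0 < r ∧ r ≤ δ ∧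
      (∀ t ∈ Set.Icc (b - r) (b + r), ‖deriv q t - (ν : ℂ)‖ ≤ ν / 10) ∧
      ∀ t ∈ Set.Icc (b - r) (b + r), ‖deriv (deriv h) t - -c‖ ≤ c / 2 := by
    have e1 : ∀ᶠ t in nhds b, ‖deriv q t - (ν : ℂ)‖ < ν / 10 := by
      have hcont : Continuous fun t => ‖deriv q t - (ν : ℂ)‖ :=
        (sq'.continuous.sub continuous_const).norm
      refine hcont.continuousAt.eventually (gt_mem_nhds ?_)
      simp only [hqb', sub_self, norm_zero]; positivity
    have e2 : ∀ᶠ t in nhds b, ‖deriv (deriv h) t - -c‖ < c / 2 := by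
      have hcont : Continuous fun t => ‖deriv (deriv h) t - -c‖ :=
        ((contDiff_deriv_of_smooth sh').continuous.sub continuous_const).norm
      refine hcont.continuousAt.eventually (gt_mem_nhds ?_)
      simp only [c, neg_neg, sub_self, norm_zero]
      simp only [c] at hc0
      linarith
    obtain ⟨r, hr, hball⟩ := Metric.nhds_basis_closedBall.eventually_iff.1 (e1.and e2)
    have hmem : ∀ t ∈ Set.Icc (b - min r δ) (b + min r δ), t ∈ Metric.closedBall b r := by
      intro t ht
      rw [Metric.mem_closedBall, Real.dist_eq, abs_le]
      have := min_le_left r δ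
      constructor <;> linarith [ht.1, ht.2]
    exact ⟨min r δ, lt_min hr hδ, min_le_right _ _, fun t ht => (hball (hmem t ht)).1.le,
      fun t ht => (hball (hmem t ht)).2.le⟩
  have hbmem : b ∈ Set.Icc (b - r) (b + r) := ⟨by linarith, by linarith⟩
  -- bounds for the curve
  have qbound : ∀ s t, s ∈ Set.Icc (b - r) (b + r) → t ∈ Set.Icc (b - r) (b + r) →
      |(q t).re - (q s).re - ν * (t - s)| ≤ ν / 10 * |t - s| ∧
      |(q t).im - (q s).im| ≤ ν / 10 * |t - s| := by
    intro s t hs ht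
    have := norm_sub_sub_smul_le (sq.differentiable (by simp)) hrq hs ht
    have h1 := abs_re_im_le (z := q t - q s) (x := ν * (t - s)) (C := ν / 10 * |t - s|) (by
      rw [Complex.ofReal_mul, mul_comm (ν : ℂ)]
      rwa [Complex.real_smul] at this)
    simpa using h1
  -- bounds for the height
  have hbound : ∀ t ∈ Set.Icc (b - r) (b + r), |deriv h t + c * (t - b)| ≤ c / 2 * |t - b| := by
    intro t ht
    have := norm_sub_sub_smul_le (sh'.differentiable (by simp)) hrh hbmem ht
    rw [h0, Real.norm_eq_abs, sub_zero, smul_eq_mul] at this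
    rwa [show deriv h t + c * (t - b) = deriv h t - (t - b) * -c by ring]
  have hanti : StrictAntiOn h (Set.Icc b (b + r)) := by
    refine strictAntiOn_of_deriv_neg (convex_Icc _ _) sh.continuous.continuousOn fun t ht => ?_
    rw [interior_Icc] at ht
    have := hbound t ⟨by linarith [ht.1], ht.2.le⟩
    rw [abs_of_pos (sub_pos.2 ht.1)] at this
    nlinarith [(abs_le.1 this).2, mul_pos hc0 (sub_pos.2 ht.1)]
  -- As `h''` lies between `-3c/2` and `-c/2`, going back by `x` lowers the height by at least `c *
  -- x² / 4`, while going on by `x / 2` lowers it by at most `3 * c * x² / 16`.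
  have hcomp : ∀ x ∈ Set.Ioc 0 r, h (b - x) < h (b + x / 2) := by
    have hd : ∀ x, HasDerivAt (fun x => h (b + x / 2) - h (b - x))
        (deriv h (b + x / 2) * (1 / 2) - deriv h (b - x) * (-1)) x := fun x => by
      have dh : ∀ y, HasDerivAt h (deriv h y) y := fun y =>
        (sh.differentiable (by simp) y).hasDerivAt
      exact ((dh _).comp x (((hasDerivAt_id x).div_const 2).const_add b)).sub
        ((dh _).comp x ((hasDerivAt_id x).const_sub b))
    have hm : StrictMonoOn (fun x => h (b + x / 2) - h (b - x)) (Set.Icc 0 r) := by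
      refine strictMonoOn_of_deriv_pos (convex_Icc _ _)
        (fun x _ => (hd x).continuousAt.continuousWithinAt) fun x hx => ?_
      rw [interior_Icc] at hx
      rw [(hd x).deriv]
      have b1 := hbound (b + x / 2) ⟨by linarith [hx.1], by linarith [hx.2, hx.1]⟩
      have b2 := hbound (b - x) ⟨by linarith [hx.2], by linarith [hx.1]⟩
      rw [show b + x / 2 - b = x / 2 by ring, abs_of_pos (show 0 < x / 2 by linarith [hx.1])] at b1
      rw [show b - x - b = -x by ring, abs_neg, abs_of_pos hx.1] at b2
      nlinarith [(abs_le.1 b1).1, (abs_le.1 b2).1, mul_pos hc0 hx.1]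
    intro x hx
    have := hm (Set.left_mem_Icc.2 hr0.le) ⟨hx.1.le, hx.2⟩ hx.1
    simp only [zero_div, add_zero, sub_zero, sub_self] at this
    linarith
  have hra : a ≤ b - r := by linarith
  obtain ⟨τ, hτ0, hτr, hτ⟩ : ∃ τ, 0 < τ ∧ τ ≤ r ∧ h (b - r) < h (b + τ) := by
    refine ⟨r / 2, by linarith, by linarith, hcomp r ⟨hr0, le_rfl⟩⟩
  have after : ∀ s ∈ Set.Ioc b (b + τ), h (b - r) < h s ∧ h s < h b := by
    intro s hs
    have hmem : s ∈ Set.Icc b (b + r) := ⟨hs.1.le, by linarith [hs.2]⟩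
    refine ⟨hτ.trans_le (hanti.antitoneOn hmem ⟨by linarith, by linarith⟩ hs.2), ?_⟩
    exact hanti (Set.left_mem_Icc.2 (by linarith)) hmem hs.1
  refine ⟨ν * r, τ, by positivity, hτ0, fun s hs => ⟨?_, (after s hs).2.le⟩, fun K hK => ?_⟩
  · refine le_trans ?_ (after s hs).1.le
    exact hmono.monotoneOn (Set.left_mem_Icc.2 (by linarith)) ⟨hra, by linarith⟩ hra
  -- the length of the cap
  obtain ⟨x, hx0, hxr, hxK⟩ : ∃ x, 0 < x ∧ 11 / 10 * x < r ∧ K = 13 / 10 * (ν * x) := by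
    -- The factor `13/10` lies between two bounds that come from the ten percent error of the
    -- velocity. It exceeds `11/10 * 11/10`, so `K + (q t).re` is positive on the cap. It is less
    -- than `9/10 * 3/2`, so points before the cap are farther than `K` from the points of equal
    -- height after `b`.
    refine ⟨10 / 13 * K / ν, by have := hK.1; positivity, ?_, by field_simp⟩
    have := hK.2
    rw [← mul_div_assoc, div_lt_iff₀ hν0]
    nlinarith [hK.1]
  have hνx : 0 < ν * x := mul_pos hν0 hx0
  set χ : ℝ → ℝ := fun t => Real.smoothTransition ((t - (b - 11 / 10 * x)) / (x / 10)) with hχ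
  have sχ : ContDiff ℝ ∞ χ := Real.smoothTransition.contDiff.comp
    ((contDiff_id.sub contDiff_const).div_const _)
  have χ0 : ∀ t, t ≤ b - 11 / 10 * x → χ t = 0 := fun t ht =>
    Real.smoothTransition.zero_of_nonpos (div_nonpos_of_nonpos_of_nonneg (by linarith) (by linarith))
  have χ1 : ∀ t, b - x ≤ t → χ t = 1 := fun t ht =>
    Real.smoothTransition.one_of_one_le (by rw [le_div_iff₀ (by linarith)]; linarith)
  have χm : Monotone χ := fun s t hst => Real.smoothTransition.monotone
    (div_le_div_of_nonneg_right (by linarith) (by linarith))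
  have χnn : ∀ t, 0 ≤ χ t := fun t => Real.smoothTransition.nonneg _
  have χle : ∀ t, χ t ≤ 1 := fun t => Real.smoothTransition.le_one _
  -- The centre `p - X` follows the curve itself up to `b - 11/10 * x`. From `b - x` on it rests at
  -- `p b - e * K`, at distance `K` from `p b`, so that the curve leaves the disc through its
  -- boundary at `b`.
  set X : ℝ → ℂ := fun t => (χ t : ℂ) * (e * (K + q t)) with hX
  set Q : ℝ → ℝ := fun t => Complex.normSq (K + q t) with hQ
  have sX : ContDiff ℝ ∞ X :=
    (Complex.ofRealCLM.contDiff.comp sχ).mul (contDiff_const.mul (contDiff_const.add sq))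
  have hXQ : ∀ t, Complex.normSq (X t) = χ t ^ 2 * Q t := fun t => by
    simp only [X, Q, Complex.normSq_mul, Complex.normSq_ofReal, hne, one_mul, pow_two]
  have dQ : ∀ t, HasDerivAt Q (2 * ((K + (q t).re) * (deriv q t).re +
      (q t).im * (deriv q t).im)) t := fun t => by
    have := hasDerivAt_normSq ((dq t).const_add (K : ℂ))
    simpa using this
  have Qpos : ∀ t ∈ Set.Icc (b - 11 / 10 * x) b, 0 < deriv Q t := by
    intro t ht
    rw [(dQ t).deriv]
    have hmem : t ∈ Set.Icc (b - r) (b + r) := ⟨by linarith [ht.1], by linarith [ht.2]⟩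
    obtain ⟨b1, b2⟩ := qbound b t hbmem hmem
    obtain ⟨b3, b4⟩ := abs_re_im_le (hrq t hmem)
    rw [hqb] at b1 b2
    have hneg : |t - b| = b - t := by rw [abs_of_nonpos (by linarith [ht.2])]; ring
    rw [hneg] at b1 b2
    simp only [Complex.zero_re, Complex.zero_im, sub_zero] at b1 b2
    have ht' : ν * (b - t) ≤ 11 / 10 * (ν * x) := by
      nlinarith [mul_le_mul_of_nonneg_left (show b - t ≤ 11 / 10 * x by linarith [ht.1]) hν0.le]
    have h1 : 9 / 100 * (ν * x) ≤ K + (q t).re := by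
      rw [hxK]; nlinarith [(abs_le.1 b1).1]
    have h2 : 9 / 10 * ν ≤ (deriv q t).re := by linarith [(abs_le.1 b3).1]
    have h3 : |(q t).im * (deriv q t).im| ≤ 11 / 100 * (ν * x) * (ν / 10) := by
      rw [abs_mul]
      exact mul_le_mul (by linarith) b4 (abs_nonneg _) (by positivity)
    have h4 : 9 / 100 * (ν * x) * (9 / 10 * ν) ≤ (K + (q t).re) * (deriv q t).re :=
      mul_le_mul h1 h2 (by positivity) (by linarith)
    nlinarith [(abs_le.1 h3).1, mul_pos hνx hν0]
  have Qmono : StrictMonoOn Q (Set.Icc (b - 11 / 10 * x) b) :=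
    strictMonoOn_of_deriv_pos (convex_Icc _ _) (fun t _ => (dQ t).continuousAt.continuousWithinAt)
      fun t ht => Qpos t (interior_subset ht)
  have hQb : Q b = K ^ 2 := by simp [Q, hqb, pow_two]
  have dX : ∀ t, deriv (fun t => Complex.normSq (X t)) t =
      2 * χ t * deriv χ t * Q t + χ t ^ 2 * deriv Q t := by
    intro t
    simp only [hXQ]
    have := (((sχ.differentiable (by simp) t).hasDerivAt.pow 2).mul
      (dQ t).differentiableAt.hasDerivAt).deriv
    refine Eq.trans this ?_
    simp
  have hXb : χ b = 1 := χ1 b (by linarith)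
  refine ⟨X, sX, fun t ht => ?_, ⟨p b - e * K, x, hx0, fun t ht => ?_⟩, fun t ht => ?_, ?_,
    fun t ht => ?_, ?_, fun s hs t ht hst => ?_⟩
  · simp only [X, χ0 t (by linarith), Complex.ofReal_zero, zero_mul]
  · simp only [X, χ1 t ht, hpq t, Complex.ofReal_one]; ring
  · rw [hXQ]
    rcases lt_or_ge t (b - 11 / 10 * x) with h1 | h1
    · rw [χ0 t h1.le]
      have := hK.1
      simp; positivity
    · have h3 := Qmono ⟨h1, ht.le⟩ (Set.right_mem_Icc.2 (by linarith)) ht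
      rw [hQb] at h3
      have h4 : 0 ≤ Q t := Complex.normSq_nonneg _
      nlinarith [χnn t, χle t, pow_le_one₀ (χnn t) (χle t) (n := 2)]
  · rw [hXQ, hXb, hQb]; ring
  · rw [dX]
    have h4 : 0 ≤ Q t := Complex.normSq_nonneg _
    have h5 : 0 ≤ deriv χ t := χm.deriv_nonneg
    have h6 := χnn t
    rcases lt_or_ge t (b - 11 / 10 * x) with h1 | h1
    · simp [χ0 t h1.le]
    · have := Qpos t ⟨h1, ht⟩
      positivity
  · rw [dX, hXb]
    have h4 : 0 ≤ Q b := Complex.normSq_nonneg _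
    have h5 : 0 ≤ deriv χ b := χm.deriv_nonneg
    have := Qpos b ⟨by linarith, le_rfl⟩
    positivity
  · obtain ⟨a1, a2⟩ := after s hs
    have htb : t < b := lt_of_le_of_ne ht.2 fun hc => by rw [hc] at hst; linarith
    have htr : b - r < t := by
      by_contra hc
      have := hmono.monotoneOn ht (show b - r ∈ Set.Icc a b from ⟨hra, by linarith⟩) (not_lt.1 hc)
      linarith
    -- By `hcomp`, a point after `b` at the height of `t` has gone more than half as far from `b` as
    -- `t`.
    have hst2 : (b - t) / 2 < s - b := by
      by_contra hc
      have h1 := hcomp (b - t) ⟨by linarith, by linarith⟩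
      rw [show b - (b - t) = t by ring, hst] at h1
      have h3 := hanti.antitoneOn (show s ∈ Set.Icc b (b + r) from ⟨hs.1.le, by linarith [hs.2]⟩)
        (show b + (b - t) / 2 ∈ Set.Icc b (b + r) from ⟨by linarith, by linarith⟩)
        (by linarith [not_lt.1 hc])
      linarith
    refine ⟨by linarith, ?_⟩
    have tmem : t ∈ Set.Icc (b - r) (b + r) := ⟨htr.le, by linarith⟩
    have smem : s ∈ Set.Icc (b - r) (b + r) := ⟨by linarith [hs.1], by linarith [hs.2]⟩
    have b1 := (abs_le.1 (qbound t s tmem smem).1).1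
    have b2 := (abs_le.1 (qbound b s hbmem smem).1).1
    rw [abs_of_pos (by linarith [hs.1])] at b1 b2
    rw [hqb, Complex.zero_re, sub_zero] at b2
    have hsb := hs.1
    have c1 : 0 < (q s).re := by linarith [mul_pos hν0 (sub_pos.2 hsb)]
    -- The real part is a convex combination, with weight `χ t`, of `(q s - q t).re` and `(K + q
    -- s).re`. The second always exceeds `K`; the first does when `t` is before the cap, and
    -- afterwards its weight is `0`.
    have key : K < ((q s - q t) + χ t * (K + q t)).re := by
      have ere : ((q s - q t) + χ t * (K + q t)).re =
          (1 - χ t) * ((q s).re - (q t).re) + χ t * (K + (q s).re) := by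
        simp; ring
      rw [ere]
      rcases lt_or_ge t (b - x) with h1 | h1
      · have c2 : K < (q s).re - (q t).re := by
          rw [hxK]
          have : 3 / 2 * x < s - t := by linarith
          linarith [mul_lt_mul_of_pos_left this hν0]
        rcases eq_or_lt_of_le (χnn t) with h3 | h3
        · rw [← h3]; linarith
        · linarith [mul_pos h3 c1, mul_nonneg (sub_nonneg.2 (χle t)) (sub_pos.2 c2).le]
      · rw [χ1 t h1]; linarith
    have e1 : p s - p t + X t = e * ((q s - q t) + χ t * (K + q t)) := by
      rw [hpq s, hpq t]; simp only [X]; ring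
    rw [e1, Complex.normSq_mul, hne, one_mul, Complex.normSq_apply]
    have := mul_lt_mul'' key key hK.1.le hK.1.le
    linarith [pow_two K, mul_self_nonneg ((q s - q t) + χ t * (K + q t)).im]

/-- The mirror image of `exists_cap`, at a minimum at the beginning of an ascending arc. -/
lemma exists_cap_left {p : ℝ → ℂ} {h : ℝ → ℝ} (sp : ContDiff ℝ ∞ p) (sh : ContDiff ℝ ∞ h)
    {a b δ : ℝ} (hδ : 0 < δ) (hδab : δ ≤ b - a) (hmono : StrictMonoOn h (Set.Icc a b))
    (h0 : deriv h a = 0) (h2 : 0 < deriv (deriv h) a) (hp : deriv p a ≠ 0) :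
    ∃ K₀ τ : ℝ, 0 < K₀ ∧ 0 < τ ∧ (∀ s ∈ Set.Ico (a - τ) a, h a ≤ h s ∧ h s ≤ h b) ∧
      ∀ K ∈ Set.Ioo 0 K₀, ∃ X : ℝ → ℂ, ContDiff ℝ ∞ X ∧ (∀ t, a + δ ≤ t → X t = 0) ∧
        (∃ u : ℂ, ∃ ε > 0, ∀ t ≤ a + ε, X t = p t - u) ∧
        (∀ t, a < t → Complex.normSq (X t) < K ^ 2) ∧ Complex.normSq (X a) = K ^ 2 ∧
        (∀ t, a ≤ t → deriv (fun t => Complex.normSq (X t)) t ≤ 0) ∧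
        deriv (fun t => Complex.normSq (X t)) a < 0 ∧
        ∀ s ∈ Set.Ico (a - τ) a, ∀ t ∈ Set.Icc a b, h t = h s →
          t ≤ a + δ ∧ K ^ 2 < Complex.normSq (p s - p t + X t) := by
  have dn : ∀ f : ℝ → ℝ, deriv (fun t => -f (-t)) = fun t => deriv f (-t) := fun f => by
    funext t
    rw [deriv.fun_neg, deriv_comp_neg f t, neg_neg]
  obtain ⟨K₀, τ, hK₀, hτ, hτh, H⟩ := exists_cap (p := fun t => p (-t)) (h := fun t => -h (-t))
    (a := -b) (b := -a) (sp.comp contDiff_neg) (sh.comp contDiff_neg).neg hδ (by linarith)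
    (fun s hs t ht hst => by
      simp only [neg_lt_neg_iff]
      exact hmono ⟨by linarith [ht.2], by linarith [ht.1]⟩ ⟨by linarith [hs.2], by linarith [hs.1]⟩
        (by linarith))
    (by rw [dn]; simpa using h0) (by
      rw [dn, deriv_comp_neg (deriv h), neg_neg]; linarith)
    (by rw [deriv_comp_neg p, neg_neg]; exact neg_ne_zero.2 hp)
  refine ⟨K₀, τ, hK₀, hτ, fun s hs => ?_, fun K hK => ?_⟩
  · have := hτh (-s) ⟨by linarith [hs.2], by linarith [hs.1]⟩
    simp only [neg_neg] at this
    constructor <;> linarith [this.1, this.2]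
  · obtain ⟨X, sX, X0, ⟨u, ε, hε, Xu⟩, Xlt, Xa, Xd, Xda, Xout⟩ := H K hK
    have dX : ∀ t, deriv (fun t => Complex.normSq (X (-t))) t =
        -deriv (fun t => Complex.normSq (X t)) (-t) := fun t =>
      deriv_comp_neg (fun t => Complex.normSq (X t)) t
    refine ⟨fun t => X (-t), sX.comp contDiff_neg, fun t ht => X0 _ (by linarith),
      ⟨u, ε, hε, fun t ht => ?_⟩, fun t ht => Xlt _ (by linarith), Xa, fun t ht => ?_, ?_,
      fun s hs t ht hst => ?_⟩
    · simpa using Xu (-t) (by linarith)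
    · rw [dX]; linarith [Xd (-t) (by linarith)]
    · rw [dX]; linarith
    · have := Xout (-s) ⟨by linarith [hs.2], by linarith [hs.1]⟩ (-t)
        ⟨by linarith [ht.2], by linarith [ht.1]⟩ (by simp only [neg_neg, hst])
      simp only [neg_neg] at this ⊢
      exact ⟨by linarith [this.1], this.2⟩

/-! ### The inverse of an ascending height function -/

/-- The inverse of a strictly increasing function on an interval, extended by constants. -/
lemma exists_clamped_inverse {h : ℝ → ℝ} (hc : Continuous h) {a b : ℝ} (hab : a < b)
    (hmono : StrictMonoOn h (Set.Icc a b)) :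
    ∃ T : ℝ → ℝ, Continuous T ∧ (∀ z, T z ∈ Set.Icc a b) ∧ (∀ t ∈ Set.Icc a b, T (h t) = t) ∧
      (∀ z, h a ≤ z → z ≤ h b → h (T z) = z) ∧ (∀ z ≤ h a, T z = a) ∧ ∀ z, h b ≤ z → T z = b := by
  have hab' : h a ≤ h b := (hmono (Set.left_mem_Icc.2 hab.le) (Set.right_mem_Icc.2 hab.le) hab).le
  have ex : ∀ z, ∃ t : Set.Icc a b, h t = max (h a) (min z (h b)) := by
    intro z
    obtain ⟨t, ht, e⟩ := intermediate_value_Icc hab.le hc.continuousOn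
      (show max (h a) (min z (h b)) ∈ Set.Icc (h a) (h b) from
        ⟨le_max_left _ _, max_le hab' (min_le_right _ _)⟩)
    exact ⟨⟨t, ht⟩, e⟩
  choose T hT using ex
  have inv : ∀ t (ht : t ∈ Set.Icc a b), T (h t) = ⟨t, ht⟩ := by
    intro t ht
    apply Subtype.ext
    apply hmono.injOn (T (h t)).2 ht
    rw [hT, min_eq_left (hmono.monotoneOn ht (Set.right_mem_Icc.2 hab.le) ht.2),
      max_eq_right (hmono.monotoneOn (Set.left_mem_Icc.2 hab.le) ht ht.1)]
  have mono : Monotone T := by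
    intro z w hzw
    rw [← Subtype.coe_le_coe, ← hmono.le_iff_le (T z).2 (T w).2, hT, hT]
    exact max_le_max le_rfl (min_le_min hzw le_rfl)
  have surj : Function.Surjective T := fun t => ⟨h t, inv t t.2⟩
  refine ⟨fun z => T z, continuous_subtype_val.comp (mono.continuous_of_surjective surj),
    fun z => (T z).2, fun t ht => by simp only [inv t ht], fun z h1 h2 => ?_, fun z hz => ?_, fun z hz => ?_⟩
  · rw [hT, min_eq_left h2, max_eq_right h1]
  · apply hmono.injOn (T z).2 (Set.left_mem_Icc.2 hab.le)
    rw [hT, max_eq_left ((min_le_left _ _).trans hz)]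
  · apply hmono.injOn (T z).2 (Set.right_mem_Icc.2 hab.le)
    rw [hT, min_eq_right hz, max_eq_right hab']

/-- The inverse `T` need not be smooth at the end heights, where `h'` may vanish, but there `D` is
locally constant. In between, `T` is a smooth local inverse of `h`. -/
lemma contDiff_comp_clamped_inverse {E : Type*} [NormedAddCommGroup E] [NormedSpace ℝ E]
    {h : ℝ → ℝ} (sh : ContDiff ℝ ∞ h) {a b : ℝ}
    (hpos : ∀ t ∈ Set.Ioo a b, 0 < deriv h t) {T : ℝ → ℝ} (cT : Continuous T)
    (hT : ∀ z, T z ∈ Set.Icc a b) (hinv : ∀ t ∈ Set.Icc a b, T (h t) = t)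
    (hh : ∀ z, h a ≤ z → z ≤ h b → h (T z) = z) (hTa : ∀ z ≤ h a, T z = a)
    (hTb : ∀ z, h b ≤ z → T z = b)
    {D : ℝ → E} (sD : ContDiff ℝ ∞ D) {ε : ℝ} (hε : 0 < ε) (hDa : ∀ t ∈ Set.Icc a (a + ε), D t = D a)
    (hDb : ∀ t ∈ Set.Icc (b - ε) b, D t = D b) : ContDiff ℝ ∞ (fun z => D (T z)) := by
  rw [contDiff_iff_contDiffAt]
  intro z
  rcases eq_or_lt_of_le (hT z).1 with h1 | h1
  · refine (contDiffAt_const (c := D a)).congr_of_eventuallyEq ?_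
    filter_upwards [cT.continuousAt.eventually (gt_mem_nhds (show T z < a + ε by linarith))] with w hw
    exact hDa _ ⟨(hT w).1, hw.le⟩
  rcases eq_or_lt_of_le (hT z).2 with h2 | h2
  · refine (contDiffAt_const (c := D b)).congr_of_eventuallyEq ?_
    filter_upwards [cT.continuousAt.eventually (lt_mem_nhds (show b - ε < T z by linarith))] with w hw
    exact hDb _ ⟨hw.le, (hT w).2⟩
  have hz : h (T z) = z := by
    refine hh z ?_ ?_
    · by_contra hc
      exact h1.ne' (hTa z (not_le.1 hc).le)
    · by_contra hc
      exact h2.ne (hTb z (not_le.1 hc).le)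
  set t := T z
  have hd := hpos t ⟨h1, h2⟩
  have hder := ((sh.differentiable (by simp) t).hasDerivAt).hasFDerivAt_equiv hd.ne'
  have sl := sh.contDiffAt.to_localInverse hder (by simp)
  set l := sh.contDiffAt.localInverse hder (by simp : (∞ : WithTop ℕ∞) ≠ 0) with hl
  have hlt : l (h t) = t := sh.contDiffAt.localInverse_apply_image hder _
  have key : T =ᶠ[nhds z] l := by
    have e1 : ∀ᶠ w in nhds (h t), h (l w) = w :=
      (sh.contDiffAt.hasStrictFDerivAt' hder (by simp)).eventually_right_inverse
    have e2 : ∀ᶠ w in nhds (h t), l w ∈ Set.Icc a b := by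
      refine sl.continuousAt.eventually ?_
      rw [hlt]
      exact Icc_mem_nhds h1 h2
    rw [hz] at e1 e2
    filter_upwards [e1, e2] with w hw1 hw2
    rw [← hinv _ hw2, hw1]
  rw [hz] at sl
  exact (sD.contDiffAt.comp z sl).congr_of_eventuallyEq (key.fun_comp D)

/-! ### Straightening an ascending arc -/

/-- The height parametrizes the arc, so moving each point of it to a prescribed place in its
horizontal plane is a shear. The centre of the disc at each height is the arc point, modified near
the ends by `exists_cap` and `exists_cap_left`, and stays constant beyond the end heights. `hup` and
`hdown` keep the rest of the link away from the vertical rays over the maximum and under the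
minimum; compactness then gives a uniform gap, and the radius `K` is chosen small against it. -/
lemma exists_isTube {p : Fin k → ℝ → ℂ} {h : Fin k → ℝ → ℝ} (D : IsLinkData p h) {i₀ : Fin k}
    {a b : ℝ} (hab : a < b) (ha0 : deriv (h i₀) a = 0) (ha2 : 0 < deriv (deriv (h i₀)) a)
    (hb0 : deriv (h i₀) b = 0) (hb2 : deriv (deriv (h i₀)) b < 0)
    (hpos : ∀ t ∈ Set.Ioo a b, 0 < deriv (h i₀) t)
    (hup : ∀ (j : Fin k) (s : ℝ), h i₀ b < h j s → p j s ≠ p i₀ b)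
    (hdown : ∀ (j : Fin k) (s : ℝ), h j s < h i₀ a → p j s ≠ p i₀ a) :
    ∃ (c : ℝ → ℂ) (lam nu : ℝ), ContDiff ℝ ∞ c ∧ 0 < lam ∧
      IsTube (fun i t => (lam : ℂ) * (p i t - c (h i t))) (fun i t => 1 * h i t + nu) i₀ a b := by
  set f := h i₀ with hf
  have sf : ContDiff ℝ ∞ f := D.smooth_h i₀
  have sp : ContDiff ℝ ∞ (p i₀) := D.smooth_p i₀
  have hmono : StrictMonoOn f (Set.Icc a b) :=
    strictMonoOn_of_deriv_pos (convex_Icc a b) sf.continuous.continuousOn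
      (by rw [interior_Icc]; exact hpos)
  have hfab : f a < f b := hmono (Set.left_mem_Icc.2 hab.le) (Set.right_mem_Icc.2 hab.le) hab
  have hba : b < a + 1 := by
    by_contra hc
    have := hmono (Set.left_mem_Icc.2 hab.le) (show a + 1 ∈ Set.Icc a b from
      ⟨by linarith, not_lt.1 hc⟩) (by linarith)
    simp only [f] at this
    rw [D.periodic_h i₀ a] at this
    exact lt_irrefl _ this
  have hpa : deriv (p i₀) a ≠ 0 := fun hc => D.immersion i₀ a hc ha0
  have hpb : deriv (p i₀) b ≠ 0 := fun hc => D.immersion i₀ b hc hb0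
  set δ := (b - a) / 3 with hδ
  have hδ0 : 0 < δ := by simp only [δ]; linarith
  have hδ3 : 3 * δ = b - a := by simp only [δ]; ring
  obtain ⟨Kb, τb, hKb, hτb, hτbh, Hb⟩ := exists_cap sp sf hδ0 (by linarith) hmono hb0 hb2 hpb
  obtain ⟨Ka, τa, hKa, hτa, hτah, Ha⟩ := exists_cap_left sp sf hδ0 (by linarith) hmono ha0 ha2 hpa
  obtain ⟨T, cT, hT, hinv, hh, hTa, hTb⟩ := exists_clamped_inverse sf.continuous hab hmono
  -- the other parts of the link are at a positive distance from the arc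
  set τ := min (min τa τb) ((a + 1 - b) / 3) with hτ
  have hτ0 : 0 < τ := lt_min (lt_min hτa hτb) (by linarith)
  have hτ1 : τ ≤ τa := (min_le_left _ _).trans (min_le_left _ _)
  have hτ2 : τ ≤ τb := (min_le_left _ _).trans (min_le_right _ _)
  have hτ3 : τ ≤ (a + 1 - b) / 3 := min_le_right _ _
  have hzero : ∀ (j : Fin k) (s : ℝ), p j s = p i₀ (T (h j s)) →
      ∃ m : ℤ, j = i₀ ∧ s + m ∈ Set.Icc a b := by
    intro j s he
    rcases lt_or_ge (f b) (h j s) with h1 | h1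
    · rw [hTb _ h1.le] at he
      exact absurd he (hup j s h1)
    rcases lt_or_ge (h j s) (f a) with h2 | h2
    · rw [hTa _ h2.le] at he
      exact absurd he (hdown j s h2)
    obtain ⟨hj, m, hm⟩ := D.injective j i₀ s _ he (hh _ h2 h1).symm
    exact ⟨m, hj, hm ▸ hT _⟩
  obtain ⟨y, hy0, hy⟩ := exists_gap (c := 0)
    (R := fun j s => Complex.normSq (p j s - p i₀ (T (h j s))))
    (fun j => Complex.continuous_normSq.comp ((D.smooth_p j).continuous.sub
      (sp.continuous.comp (cT.comp (D.smooth_h j).continuous))))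
    (fun j s => by simp only [D.periodic_p j s, D.periodic_h j s])
    (i₀ := i₀) (u := a - τ) (v := b + τ) (by linarith) (by linarith)
    (fun j s hs => Complex.normSq_pos.2 fun h0 => hs (by
      obtain ⟨m, hj, hm⟩ := hzero j s (sub_eq_zero.1 h0)
      exact ⟨m, hj, by linarith [hm.1], by linarith [hm.2]⟩))
  -- By `4 * K ^ 2 ≤ y` distant parts of the link are more than `2 * K` from the arc point at the
  -- clamped height; the centre is within `K` of that point, hence they are outside the disc of
  -- radius `K`.
  obtain ⟨K, hK0, hKb', hKa', hKy⟩ : ∃ K, 0 < K ∧ K < Kb ∧ K < Ka ∧ 4 * K ^ 2 ≤ y := by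
    have hm : 0 < min (min Kb Ka) (min y 1) := lt_min (lt_min hKb hKa) (lt_min hy0 one_pos)
    refine ⟨min (min Kb Ka) (min y 1) / 4, by linarith, ?_, ?_, ?_⟩
    · linarith [(min_le_left (min Kb Ka) (min y 1)).trans (min_le_left _ _)]
    · linarith [(min_le_left (min Kb Ka) (min y 1)).trans (min_le_right _ _)]
    · have h1 := (min_le_right (min Kb Ka) (min y 1)).trans (min_le_left _ _)
      have h2 := (min_le_right (min Kb Ka) (min y 1)).trans (min_le_right _ _)
      nlinarith
  obtain ⟨X, sX, X0, ⟨ub, εb, hεb, Xu⟩, Xlt, Xb, Xd, Xdb, Xout⟩ := Hb K ⟨hK0, hKb'⟩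
  obtain ⟨Y, sY, Y0, ⟨ua, εa, hεa, Yu⟩, Ylt, Ya, Yd, Yda, Yout⟩ := Ha K ⟨hK0, hKa'⟩
  -- On the arc, `X` is supported in the last third and `Y` in the first, so the two end corrections
  -- do not interact.
  set C : ℝ → ℂ := fun t => p i₀ t - X t - Y t with hC
  have sC : ContDiff ℝ ∞ C := (sp.sub sX).sub sY
  set ε := min (min εa εb) δ with hε
  have hε0 : 0 < ε := lt_min (lt_min hεa hεb) hδ0
  have hε1 : ε ≤ εa := (min_le_left _ _).trans (min_le_left _ _)
  have hε2 : ε ≤ εb := (min_le_left _ _).trans (min_le_right _ _)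
  have hε3 : ε ≤ δ := min_le_right _ _
  have Cb : ∀ t, b - ε ≤ t → C t = ub := fun t ht => by
    simp only [C]
    rw [Xu t (by linarith), Y0 t (by linarith)]
    ring
  have Ca : ∀ t, t ≤ a + ε → C t = ua := fun t ht => by
    simp only [C]
    rw [Yu t (by linarith), X0 t (by linarith)]
    ring
  have sc : ContDiff ℝ ∞ (fun z => C (T z)) :=
    contDiff_comp_clamped_inverse sf hpos cT hT hinv hh hTa hTb sC hε0
      (fun t ht => by rw [Ca t ht.2, Ca a (by linarith)])
      (fun t ht => by rw [Cb t ht.1, Cb b (by linarith)])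
  -- the position of the arc in the tube
  have onarc : ∀ t ∈ Set.Icc a b, p i₀ t - C (T (f t)) = X t + Y t := fun t ht => by
    rw [hinv t ht]; simp only [C]; ring
  have evR : ∀ t, a < t → (a + b) / 2 ≤ t → t ≤ b →
      (fun s => Complex.normSq (((K⁻¹ : ℝ) : ℂ) * (p i₀ s - C (T (f s))))) =ᶠ[nhds t]
        fun s => (K⁻¹ * K⁻¹) * Complex.normSq (X s) := by
    intro t _ h2 h3
    have hthis : ∀ᶠ s in nhds t, p i₀ s - C (T (f s)) = X s := by
      rcases eq_or_lt_of_le h3 with rfl | h3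
      · have e1 : ∀ᶠ s in nhds t, t - ε < T (f s) := by
          refine (cT.comp sf.continuous).continuousAt.eventually (lt_mem_nhds ?_)
          simp only [Function.comp]
          rw [hinv t ⟨hab.le, le_rfl⟩]; linarith
        filter_upwards [e1, lt_mem_nhds (show t - ε < t by linarith)] with s h4 h5
        rw [Cb _ h4.le, Xu s (by linarith)]
      · filter_upwards [Ioo_mem_nhds (show a + δ < t by linarith) h3] with s hs
        rw [onarc s ⟨by linarith [hs.1], hs.2.le⟩, Y0 s hs.1.le, add_zero]
    filter_upwards [hthis] with s hs
    rw [hs, Complex.normSq_mul, Complex.normSq_ofReal]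
  have evL : ∀ t, t < b → t ≤ (a + b) / 2 → a ≤ t →
      (fun s => Complex.normSq (((K⁻¹ : ℝ) : ℂ) * (p i₀ s - C (T (f s))))) =ᶠ[nhds t]
        fun s => (K⁻¹ * K⁻¹) * Complex.normSq (Y s) := by
    intro t _ h2 h3
    have hthis : ∀ᶠ s in nhds t, p i₀ s - C (T (f s)) = Y s := by
      rcases eq_or_lt_of_le h3 with rfl | h3
      · have e1 : ∀ᶠ s in nhds a, T (f s) < a + ε := by
          refine (cT.comp sf.continuous).continuousAt.eventually (gt_mem_nhds ?_)
          simp only [Function.comp]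
          rw [hinv a ⟨le_rfl, hab.le⟩]; linarith
        filter_upwards [e1, gt_mem_nhds (show a < a + ε by linarith)] with s h4 h5
        rw [Ca _ h4.le, Yu s (by linarith)]
      · filter_upwards [Ioo_mem_nhds h3 (show t < b - δ by linarith)] with s hs
        rw [onarc s ⟨hs.1.le, by linarith [hs.2]⟩, X0 s hs.2.le, zero_add]
    filter_upwards [hthis] with s hs
    rw [hs, Complex.normSq_mul, Complex.normSq_ofReal]
  have dXY : ∀ (Z : ℝ → ℂ), ContDiff ℝ ∞ Z → ∀ t,
      deriv (fun s => (K⁻¹ * K⁻¹) * Complex.normSq (Z s)) t =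
        (K⁻¹ * K⁻¹) * deriv (fun s => Complex.normSq (Z s)) t := fun Z sZ t =>
    deriv_const_mul _ ((contDiff_normSq sZ).differentiable (by simp) t)
  have hKK : 0 < K⁻¹ * K⁻¹ := by positivity
  have hKK1 : K⁻¹ * K⁻¹ * K ^ 2 = 1 := by field_simp
  have small : ∀ t ∈ Set.Icc a b, Complex.normSq (X t + Y t) ≤ K ^ 2 ∧
      (t ∈ Set.Ioo a b → Complex.normSq (X t + Y t) < K ^ 2) := by
    intro t ht
    rcases le_total t ((a + b) / 2) with h1 | h1
    · rw [X0 t (by linarith), zero_add]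
      rcases eq_or_lt_of_le ht.1 with rfl | h2
      · exact ⟨Ya.le, fun hc => absurd hc.1 (lt_irrefl _)⟩
      · exact ⟨(Ylt t h2).le, fun _ => Ylt t h2⟩
    · rw [Y0 t (by linarith), add_zero]
      rcases eq_or_lt_of_le ht.2 with rfl | h2
      · exact ⟨Xb.le, fun hc => absurd hc.2 (lt_irrefl _)⟩
      · exact ⟨(Xlt t h2).le, fun _ => Xlt t h2⟩
  have scale : ∀ w : ℂ, Complex.normSq (((K⁻¹ : ℝ) : ℂ) * w) = (K⁻¹ * K⁻¹) * Complex.normSq w :=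
    fun w => by rw [Complex.normSq_mul, Complex.normSq_ofReal]
  have scale_lt : ∀ w : ℂ, K ^ 2 < Complex.normSq w → 1 < Complex.normSq (((K⁻¹ : ℝ) : ℂ) * w) :=
    fun w hw => by
      rw [scale, ← hKK1]
      exact mul_lt_mul_of_pos_left hw hKK
  have capOut : ∀ s, s ∈ Set.Ioo (a - τ) (b + τ) → s ∉ Set.Icc a b →
      K ^ 2 < Complex.normSq (p i₀ s - C (T (f s))) := by
    intro s hs hn
    rw [Set.mem_Icc, not_and_or, not_le, not_le] at hn
    rcases hn with h1 | h1
    · have hmem : s ∈ Set.Ico (a - τa) a := ⟨by linarith [hs.1], h1⟩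
      have hfs := hτah s hmem
      obtain ⟨h3, h4⟩ := Yout s hmem (T (f s)) (hT _) (hh _ hfs.1 hfs.2)
      have e : p i₀ s - C (T (f s)) = p i₀ s - p i₀ (T (f s)) + Y (T (f s)) := by
        simp only [C]; rw [X0 _ (by linarith)]; ring
      rwa [e]
    · have hmem : s ∈ Set.Ioc b (b + τb) := ⟨h1, by linarith [hs.2]⟩
      have hfs := hτbh s hmem
      obtain ⟨h3, h4⟩ := Xout s hmem (T (f s)) (hT _) (hh _ hfs.1 hfs.2)
      have e : p i₀ s - C (T (f s)) = p i₀ s - p i₀ (T (f s)) + X (T (f s)) := by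
        simp only [C]; rw [Y0 _ (by linarith)]; ring
      rwa [e]
  have farOut : ∀ (j : Fin k) (s : ℝ), (¬∃ m : ℤ, j = i₀ ∧ s + m ∈ Set.Ioo (a - τ) (b + τ)) →
      K ^ 2 < Complex.normSq (p j s - C (T (h j s))) := by
    intro j s hs
    have h1 : 0 + y < Complex.normSq (p j s - p i₀ (T (h j s))) := by
      by_contra hc
      exact hs (hy j s (not_lt.1 hc))
    have h2 := (small _ (hT (h j s))).1
    set t := T (h j s)
    have e : p j s - C t = (p j s - p i₀ t) - (-(X t + Y t)) := by simp only [C]; ring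
    rw [e]
    rw [Complex.normSq_eq_norm_sq] at h1 h2 ⊢
    have h3 : 2 * K < ‖p j s - p i₀ t‖ := by
      refine lt_of_pow_lt_pow_left₀ 2 (norm_nonneg _) ?_
      nlinarith
    have h4 : ‖-(X t + Y t)‖ ≤ K := by
      rw [norm_neg]
      exact le_of_sq_le_sq h2 hK0.le
    have h5 := norm_sub_norm_le (p j s - p i₀ t) (-(X t + Y t))
    exact pow_lt_pow_left₀ (by linarith) hK0.le two_ne_zero
  have sh1 : ∀ nu, deriv (fun t => 1 * f t + nu) = deriv f := fun nu => by funext t; simp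
  -- The midpoint of the parameter interval gets height `0`. Above it the radius does not decrease,
  -- below it the radius does not increase, so the height times the derivative of the squared radius
  -- is nonnegative, as `slope` needs.
  set nu := -f ((a + b) / 2) with hnu
  have fm : ∀ t ∈ Set.Icc a b, ((a + b) / 2 ≤ t → 0 ≤ 1 * f t + nu) ∧
      (t ≤ (a + b) / 2 → 1 * f t + nu ≤ 0) := by
    intro t ht
    have hmid : (a + b) / 2 ∈ Set.Icc a b := ⟨by linarith, by linarith⟩
    refine ⟨fun h1 => ?_, fun h1 => ?_⟩
    · linarith [hmono.monotoneOn hmid ht h1]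
    · linarith [hmono.monotoneOn ht hmid h1]
  have hin : ∀ t ∈ Set.Ioo a b, Complex.normSq (((K⁻¹ : ℝ) : ℂ) * (p i₀ t - C (T (f t)))) < 1 := by
    intro t ht
    have ht' := Set.Ioo_subset_Icc_self ht
    rw [onarc t ht', scale, ← hKK1]
    exact mul_lt_mul_of_pos_left ((small t ht').2 ht) hKK
  refine ⟨fun z => C (T z), K⁻¹, nu, sc, by positivity, ?_⟩
  refine
    { lt := hab
      lt_add_one := hba
      crit_left := by rw [sh1, ha0]
      crit_right := by rw [sh1, hb0]
      convex_left := by rw [sh1]; exact ha2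
      concave_right := by rw [sh1]; exact hb2
      ascending := by rw [sh1]; exact hpos
      inside := hin
      boundary_left := ?_
      boundary_right := ?_
      outside := ?_
      slope := ?_
      deriv_left := ?_
      deriv_right := ?_
      height_left := ?_
      height_right := ?_ }
  · rw [onarc a ⟨le_rfl, hab.le⟩, X0 a (by linarith), zero_add, scale, Ya, hKK1]
  · rw [onarc b ⟨hab.le, le_rfl⟩, Y0 b (by linarith), add_zero, scale, Xb, hKK1]
  · intro j s hs
    refine scale_lt _ ?_
    by_cases hc : ∃ m : ℤ, j = i₀ ∧ s + m ∈ Set.Ioo (a - τ) (b + τ)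
    · obtain ⟨m, rfl, hm⟩ := hc
      have := capOut (s + m) hm fun hc => hs ⟨m, rfl, hc⟩
      simp only [f] at this
      rwa [periodic_add_int (D.periodic_p j), periodic_add_int (D.periodic_h j)] at this
    · exact farOut j s hc
  · intro t ht
    have h1 := mul_pos (sub_pos.2 (hin t ht)) (hpos t ht)
    rw [sh1]
    suffices hnn : 0 ≤ (1 * f t + nu) *
        deriv (fun s => Complex.normSq (((K⁻¹ : ℝ) : ℂ) * (p i₀ s - C (T (f s))))) t by
      linarith
    rcases le_total ((a + b) / 2) t with h2 | h2
    · rw [(evR t ht.1 h2 ht.2.le).deriv_eq, dXY X sX]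
      exact mul_nonneg ((fm t (Set.Ioo_subset_Icc_self ht)).1 h2)
        (mul_nonneg hKK.le (Xd t ht.2.le))
    · rw [(evL t ht.2 h2 ht.1.le).deriv_eq, dXY Y sY]
      exact mul_nonneg_of_nonpos_of_nonpos ((fm t (Set.Ioo_subset_Icc_self ht)).2 h2)
        (mul_nonpos_of_nonneg_of_nonpos hKK.le (Yd t ht.1.le))
  · rw [(evL a hab (by linarith) le_rfl).deriv_eq, dXY Y sY]
    exact mul_neg_of_pos_of_neg hKK Yda
  · rw [(evR b hab (by linarith) le_rfl).deriv_eq, dXY X sX]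
    exact mul_pos hKK Xdb
  · have := hmono (Set.left_mem_Icc.2 hab.le) (show (a + b) / 2 ∈ Set.Icc a b from
      ⟨by linarith, by linarith⟩) (by linarith)
    simp only [nu]; linarith
  · have := hmono (show (a + b) / 2 ∈ Set.Icc a b from ⟨by linarith, by linarith⟩)
      (Set.right_mem_Icc.2 hab.le) (by linarith)
    simp only [nu]; linarith

/-! ### General position of the ends of an arc -/

/-- General position by dimension: finitely many smooth curves cannot fill the plane. -/
lemma dimH_image_le_one {f : ℝ → ℂ} {U : Set ℝ} (hf : ∀ s ∈ U, ContDiffAt ℝ 1 f s) :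
    dimH (f '' U) ≤ 1 := by
  refine (dimH_image_le_of_locally_lipschitzOn fun s hs => ?_).trans
    ((dimH_mono (Set.subset_univ U)).trans Real.dimH_univ.le)
  obtain ⟨K, t, ht, hK⟩ := (hf s hs).exists_lipschitzOnWith
  exact ⟨K, t, mem_nhdsWithin_of_mem_nhds ht, hK⟩

/-- A shear that is the identity below the height `M`, after which no part of the link above the
height `M` lies over the point `x₀`. -/
lemma exists_shear_above {p : Fin k → ℝ → ℂ} {h : Fin k → ℝ → ℝ}
    (sp : ∀ i, ContDiff ℝ ∞ (p i)) (sh : ∀ i, ContDiff ℝ ∞ (h i)) (M : ℝ) (x₀ : ℂ) :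
    ∃ c : ℝ → ℂ, ContDiff ℝ ∞ c ∧ (∀ z ≤ M, c z = 0) ∧
      ∀ (j : Fin k) (s : ℝ), M < h j s → p j s - c (h j s) ≠ x₀ := by
  let e : ℝ → ℝ := fun z => expNegInvGlue (z - M)
  have se : ContDiff ℝ ∞ e := expNegInvGlue.contDiff.comp (contDiff_id.sub contDiff_const)
  have epos : ∀ z, M < z → 0 < e z := fun z hz => expNegInvGlue.pos_of_pos (sub_pos.2 hz)
  -- `A j` consists of the vectors `q` for which the shear `e z * q` would put a point of the `j`-th
  -- component above height `M` over `x₀`. Any `q` outside all of them works.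
  let A : Fin k → Set ℂ := fun j =>
    (fun s => ((e (h j s))⁻¹ : ℝ) * (p j s - x₀)) '' {s | M < h j s}
  have hA : dimH (⋃ j, A j) < Module.finrank ℝ ℂ := by
    rw [dimH_iUnion, Complex.finrank_real_complex]
    refine lt_of_le_of_lt (iSup_le fun j => dimH_image_le_one fun s hs => ?_)
      (show (1 : ENNReal) < (2 : ℕ) by norm_num)
    have h1 : ContDiffAt ℝ 1 (fun s => (e (h j s))⁻¹) s :=
      (((se.comp (sh j)).of_le (by simp)).contDiffAt).inv (epos _ hs).ne'
    exact (Complex.ofRealCLM.contDiff.contDiffAt.comp s h1).mul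
      (((sp j).sub contDiff_const).of_le (by simp)).contDiffAt
  obtain ⟨q, hq⟩ := (dense_compl_of_dimH_lt_finrank hA).nonempty
  refine ⟨fun z => (e z : ℂ) * q, (Complex.ofRealCLM.contDiff.comp se).mul contDiff_const,
    fun z hz => ?_, fun j s hs h0 => hq (Set.mem_iUnion.2 ⟨j, s, hs, ?_⟩)⟩
  · simp [e, expNegInvGlue.zero_of_nonpos (sub_nonpos.2 hz)]
  · have hne : (e (h j s) : ℂ) ≠ 0 := Complex.ofReal_ne_zero.2 (epos _ hs).ne'
    have : p j s - x₀ = e (h j s) * q := by linear_combination h0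
    simp only [this]
    push_cast
    field_simp

lemma exists_shear_below {p : Fin k → ℝ → ℂ} {h : Fin k → ℝ → ℝ}
    (sp : ∀ i, ContDiff ℝ ∞ (p i)) (sh : ∀ i, ContDiff ℝ ∞ (h i)) (m : ℝ) (x₀ : ℂ) :
    ∃ c : ℝ → ℂ, ContDiff ℝ ∞ c ∧ (∀ z, m ≤ z → c z = 0) ∧
      ∀ (j : Fin k) (s : ℝ), h j s < m → p j s - c (h j s) ≠ x₀ := by
  obtain ⟨c, sc, c0, hc⟩ := exists_shear_above (h := fun i t => -h i t) sp (fun i => (sh i).neg)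
    (-m) x₀
  refine ⟨fun z => c (-z), sc.comp contDiff_neg, fun z hz => c0 _ (by linarith), fun j s hs =>
    hc j s (by linarith)⟩

lemma exists_localMax {p : Fin k → ℝ → ℂ} {h : Fin k → ℝ → ℝ} (D : IsLinkData p h)
    (hm : ∀ i, IsMorse (h i)) {d : ℕ} (hd : (criticalSet h).encard = 2 * ((d + 1 : ℕ) : ℕ∞)) :
    ∃ i b, IsLocalMax (h i) b := by
  have hmax : {q : Fin k × ℝ | q.2 ∈ Set.Ico (0 : ℝ) 1 ∧ IsLocalMax (h q.1) q.2}.Nonempty := by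
    rw [← Set.encard_pos, pos_iff_ne_zero]
    intro h0
    rw [encard_criticalSet D.smooth_h D.periodic_h hm, h0, mul_zero] at hd
    have : ((2 * (d + 1) : ℕ) : ℕ∞) = 0 := by rw [hd]; push_cast; rfl
    have := Nat.cast_eq_zero.1 this
    omega
  obtain ⟨⟨i, b⟩, -, hb⟩ := hmax
  exact ⟨i, b, hb⟩

/-- Cancelling a minimum and a maximum of the height against one passage through a page. -/
lemma exists_booklink_of_height_succ {p : Fin k → ℝ → ℂ} {h : Fin k → ℝ → ℝ}
    {L : Fin k → ℝ → R4} (HL : Represents (curve p h) L) (hm : ∀ i, IsMorse (h i)) {d : ℕ}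
    (hd : (criticalSet h).encard = 2 * ((d + 1 : ℕ) : ℕ∞)) :
    ∃ γ : Fin k → ℝ → R3, Represents γ L ∧ IsBooklink γ d ∧ pageNumber γ ≤ 1 := by
  have D := isLink_curve_iff.1 HL.isLink
  obtain ⟨i₀, b, hb⟩ := exists_localMax D hm hd
  obtain ⟨hb0, hb2⟩ := (isLocalMax_iff (D.smooth_h i₀) (hm i₀) b).1 hb
  obtain ⟨a, hab, ha0, ha2, hpos⟩ := exists_prev_min (D.smooth_h i₀) (D.periodic_h i₀) (hm i₀) hb0 hb2
  have hlt : h i₀ a < h i₀ b :=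
    strictMonoOn_of_deriv_pos (convex_Icc a b) (D.smooth_h i₀).continuous.continuousOn
      (by rw [interior_Icc]; exact hpos) (Set.left_mem_Icc.2 hab.le) (Set.right_mem_Icc.2 hab.le) hab
  obtain ⟨c₁, sc₁, c₁0, hc₁⟩ := exists_shear_above D.smooth_p D.smooth_h (h i₀ b) (p i₀ b)
  obtain ⟨c₂, sc₂, c₂0, hc₂⟩ := exists_shear_below D.smooth_p D.smooth_h (h i₀ a) (p i₀ a)
  -- Both shears vanish at all heights between those of the two ends, so the ends stay in place;
  -- each shear also leaves the region of the other untouched.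
  have iso₁ := D.isotopic_shear (sc₁.add sc₂)
  have D₁ := iso₁.isLinkData_right
  obtain ⟨c, lam, nu, sc, hlam, hT⟩ := exists_isTube D₁ hab ha0 ha2 hb0 hb2 hpos
    (fun j s hs => by
      have e1 : c₂ (h j s) = 0 := c₂0 _ (hlt.trans hs).le
      have e2 : c₂ (h i₀ b) = 0 := c₂0 _ hlt.le
      simpa [e1, e2, c₁0 _ (le_refl (h i₀ b))] using hc₁ j s hs)
    (fun j s hs => by
      have e1 : c₁ (h j s) = 0 := c₁0 _ (hs.trans hlt).le
      have e2 : c₁ (h i₀ a) = 0 := c₁0 _ hlt.le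
      simpa [e1, e2, c₂0 _ (le_refl (h i₀ a))] using hc₂ j s hs)
  have iso₂ := D₁.isotopic_shear sc
  have iso₃ := iso₂.isLinkData_right.isotopic_affine hlam one_pos nu
  have hder : ∀ i, deriv (fun t => 1 * h i t + nu) = deriv (h i) := fun i => by funext t; simp
  refine exists_booklink_of_isTube (HL.of_isotopic ((iso₁.trans iso₂).trans iso₃))
    (fun i t h0 => ?_) hT ?_
  · rw [hder] at h0 ⊢
    exact hm i t h0
  · rw [← hd]
    congr 1
    ext q
    simp only [criticalSet, Set.mem_ofPred_eq, hder]

/-! ### Creation of a pair of critical points -/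

/-- A smooth function that is the identity outside of `[-1, 1]` and has exactly two critical points,
which are nondegenerate. -/
lemma exists_fold : ∃ f : ℝ → ℝ, ContDiff ℝ ∞ f ∧ (∀ u, 1 ≤ |u| → f u = u) ∧
    ∃ w, 0 < w ∧ w < 1 ∧ (∀ u, deriv f u = 0 ↔ u = w ∨ u = -w) ∧
      ∀ u, deriv f u = 0 → deriv (deriv f) u ≠ 0 := by
  -- A bump supported in `[-1, 1]`, normalized to `B 0 = 1`.
  let B : ℝ → ℝ := fun v => Real.exp 1 * expNegInvGlue (1 - v ^ 2)
  have sB : ContDiff ℝ ∞ B := contDiff_const.mul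
    (expNegInvGlue.contDiff.comp (contDiff_const.sub (contDiff_id.pow 2)))
  have B0 : ∀ v, 1 ≤ |v| → B v = 0 := fun v hv => by
    have : 1 ≤ v ^ 2 := by rw [← sq_abs]; nlinarith
    simp [B, expNegInvGlue.zero_of_nonpos (sub_nonpos.2 this)]
  have Bnn : ∀ v, 0 ≤ B v := fun v => mul_nonneg (Real.exp_pos 1).le (expNegInvGlue.nonneg _)
  have Bexp : ∀ v, |v| < 1 → B v = Real.exp (1 - (1 - v ^ 2)⁻¹) := fun v hv => by
    have : ¬(1 - v ^ 2 ≤ 0) := by rw [← sq_abs]; nlinarith [abs_nonneg v]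
    simp only [B, expNegInvGlue, if_neg this]
    rw [← Real.exp_add, ← sub_eq_add_neg]
  have hB : ∀ v, |v| < 1 → deriv B v = B v * (-(2 * v) / (1 - v ^ 2) ^ 2) := fun v hv => by
    have hne : 1 - v ^ 2 ≠ 0 := by
      have : 0 < 1 - v ^ 2 := by rw [← sq_abs]; nlinarith [abs_nonneg v]
      exact this.ne'
    have hev : B =ᶠ[nhds v] fun v => Real.exp (1 - (1 - v ^ 2)⁻¹) := by
      filter_upwards [continuous_abs.continuousAt.eventually (gt_mem_nhds hv)] with x hx
        using Bexp x hx
    have h1 : HasDerivAt (fun v : ℝ => 1 - v ^ 2) (-(2 * v)) v := by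
      simpa using ((hasDerivAt_id v).pow 2).const_sub 1
    have h2 := ((h1.inv hne).const_sub 1).exp
    rw [hev.deriv_eq, Bexp v hv]
    refine Eq.trans (HasDerivAt.deriv h2) ?_
    simp only [Pi.inv_apply]
    ring
  let K : ℝ → ℝ := fun v => ∫ x in (-1)..v, B x
  have dK : ∀ v, HasDerivAt K (B v) v := fun v =>
    intervalIntegral.integral_hasDerivAt_right (sB.continuous.intervalIntegrable _ _)
      (sB.continuous.stronglyMeasurableAtFilter _ _) sB.continuous.continuousAt
  have sK : ContDiff ℝ ∞ K := by
    refine contDiff_infty_iff_deriv.2 ⟨fun v => (dK v).differentiableAt, ?_⟩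
    rwa [show deriv K = B from funext fun v => (dK v).deriv]
  have K0 : ∀ v, v ≤ -1 → K v = 0 := fun v hv => by
    refine intervalIntegral.integral_zero_ae (Filter.Eventually.of_forall fun x hx => B0 x ?_)
    rw [Set.uIoc_of_ge hv] at hx
    rw [le_abs]; right; linarith [hx.2]
  have K1 : ∀ v, 1 ≤ v → K v = K 1 := fun v hv => by
    have h1 := intervalIntegral.integral_add_adjacent_intervals
      (sB.continuous.intervalIntegrable (μ := MeasureTheory.volume) (-1) 1)
      (sB.continuous.intervalIntegrable 1 v)
    have h2 : ∫ x in (1 : ℝ)..v, B x = 0 := by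
      refine intervalIntegral.integral_zero_ae (Filter.Eventually.of_forall fun x hx => B0 x ?_)
      rw [Set.uIoc_of_le hv] at hx
      rw [le_abs]; left; linarith [hx.1]
    simp only [K]
    rw [← h1, h2, add_zero]
  -- The derivative is `1` minus twice a central bump plus two side bumps with disjoint interiors of
  -- support. The added integrals cancel, so `f` returns to the identity, and the derivative
  -- vanishes only where the central bump equals `1/2`.
  let f : ℝ → ℝ := fun u => u + (K (4 * u - 2) + K (4 * u + 2) - 2 * K (4 * u)) / 4
  have df : deriv f = fun u => 1 + (B (4 * u - 2) + B (4 * u + 2) - 2 * B (4 * u)) := by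
    funext u
    have e0 : HasDerivAt (fun u : ℝ => 4 * u) 4 u := by simpa using (hasDerivAt_id u).const_mul 4
    have e1 := (dK (4 * u - 2)).comp u (e0.sub_const 2)
    have e2 := (dK (4 * u + 2)).comp u (e0.add_const 2)
    have e3 := (dK (4 * u)).comp u e0
    have := (hasDerivAt_id u).add (((e1.add e2).sub (e3.const_mul 2)).div_const 4)
    refine (HasDerivAt.deriv this).trans ?_
    ring
  have sf : ContDiff ℝ ∞ f := by
    have l : ∀ c : ℝ, ContDiff ℝ ∞ fun u : ℝ => 4 * u + c := fun c => by fun_prop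
    have l2 : ContDiff ℝ ∞ fun u : ℝ => 4 * u - 2 := by fun_prop
    have l3 : ContDiff ℝ ∞ fun u : ℝ => 4 * u := by fun_prop
    exact contDiff_id.add ((((sK.comp l2).add (sK.comp (l 2))).sub
      (contDiff_const.mul (sK.comp l3))).div_const 4)
  have hlog := Real.log_pos one_lt_two
  -- The positive solution of `B w = 1/2`, that is, of `1 - (1 - w²)⁻¹ = -log 2`.
  set w := Real.sqrt (Real.log 2 / (1 + Real.log 2)) with hw
  have hw2 : w ^ 2 = Real.log 2 / (1 + Real.log 2) := Real.sq_sqrt (by positivity)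
  have hw0 : 0 < w := Real.sqrt_pos.2 (by positivity)
  have hw1 : w < 1 := by
    have : w ^ 2 < 1 := by rw [hw2, div_lt_one (by positivity)]; linarith
    nlinarith
  -- off the central bump the derivative is at least one
  have dbig : ∀ u, 1 / 4 ≤ |u| → deriv f u ≠ 0 := fun u hu => by
    rw [df]
    have : B (4 * u) = 0 := B0 _ (by rw [abs_mul]; norm_num; linarith)
    simp only [this]
    have := Bnn (4 * u - 2)
    have := Bnn (4 * u + 2)
    linarith
  have dmid : ∀ u, |u| < 1 / 4 → deriv f u = 1 - 2 * B (4 * u) := fun u hu => by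
    have hu' := abs_lt.1 hu
    simp only [df]
    rw [B0 (4 * u - 2) (by rw [le_abs]; right; linarith [hu'.2]),
      B0 (4 * u + 2) (by rw [le_abs]; left; linarith [hu'.1])]
    ring
  have hzero : ∀ u, deriv f u = 0 ↔ u = w / 4 ∨ u = -(w / 4) := by
    intro u
    rcases le_or_gt (1 / 4) |u| with hu | hu
    · simp only [dbig u hu, false_iff]
      rintro (rfl | rfl)
      · rw [abs_of_pos (by linarith)] at hu; linarith
      · rw [abs_neg, abs_of_pos (by linarith)] at hu; linarith
    · have h4 : |4 * u| < 1 := by rw [abs_mul]; norm_num; linarith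
      have hpos : 0 < 1 - (4 * u) ^ 2 := by rw [← sq_abs]; nlinarith [abs_nonneg (4 * u)]
      rw [dmid u hu, Bexp _ h4]
      have e1 : 1 - 2 * Real.exp (1 - (1 - (4 * u) ^ 2)⁻¹) = 0 ↔
          1 - (1 - (4 * u) ^ 2)⁻¹ = -Real.log 2 := by
        constructor
        · intro h
          have : Real.exp (1 - (1 - (4 * u) ^ 2)⁻¹) = 2⁻¹ := by linarith
          rw [← Real.log_inv, ← this, Real.log_exp]
        · intro h
          rw [h, Real.exp_neg, Real.exp_log two_pos]; norm_num
      have e2 : 1 - (1 - (4 * u) ^ 2)⁻¹ = -Real.log 2 ↔ (4 * u) ^ 2 = w ^ 2 := by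
        rw [hw2]
        have hl : 1 + Real.log 2 ≠ 0 := by positivity
        constructor
        · intro h
          have h5 : 1 - (4 * u) ^ 2 = (1 + Real.log 2)⁻¹ := by
            rw [← inv_inj, inv_inv]; linarith
          rw [← sub_sub_self 1 ((4 * u) ^ 2), h5]
          field_simp
          ring
        · intro h
          have h5 : 1 - (4 * u) ^ 2 = (1 + Real.log 2)⁻¹ := by rw [h]; field_simp; ring
          rw [h5, inv_inv]; ring
      rw [e1, e2, sq_eq_sq_iff_eq_or_eq_neg]
      constructor
      · rintro (h | h)
        · left; linarith
        · right; linarith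
      · rintro (h | h)
        · left; linarith
        · right; linarith
  refine ⟨f, sf, fun u hu => ?_, w / 4, by linarith, by linarith, hzero, fun u h0 => ?_⟩
  · simp only [f]
    rcases le_abs.1 hu with h | h
    · rw [K1 _ (by linarith), K1 (4 * u + 2) (by linarith), K1 (4 * u) (by linarith)]; ring
    · rw [K0 _ (by linarith), K0 (4 * u + 2) (by linarith), K0 (4 * u) (by linarith)]; ring
  · have hu : |u| < 1 / 4 := by
      by_contra hc
      exact dbig u (not_lt.1 hc) h0
    have h4 : |4 * u| < 1 := by rw [abs_mul]; norm_num; linarith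
    have hev : deriv f =ᶠ[nhds u] fun u => 1 - 2 * B (4 * u) := by
      filter_upwards [continuous_abs.continuousAt.eventually (gt_mem_nhds hu)] with x hx
        using dmid x hx
    have e0 : HasDerivAt (fun u : ℝ => 4 * u) 4 u := by simpa using (hasDerivAt_id u).const_mul 4
    have d1 := (((sB.differentiable (by simp) (4 * u)).hasDerivAt.comp u e0).const_mul 2).const_sub 1
    have e : deriv (fun u => 1 - 2 * B (4 * u)) u = _ := d1.deriv
    rw [hev.deriv_eq, e, hB _ h4]
    have hB0 : B (4 * u) ≠ 0 := by rw [Bexp _ h4]; exact (Real.exp_pos _).ne'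
    have hpos : 0 < 1 - (4 * u) ^ 2 := by rw [← sq_abs]; nlinarith [abs_nonneg (4 * u)]
    have hu0 : u ≠ 0 := by
      rintro rfl
      rcases (hzero 0).1 h0 with h | h <;> linarith
    simpa using ⟨hB0, hu0, hpos.ne'⟩

lemma exists_bilipschitz {E : Type*} [NormedAddCommGroup E] [NormedSpace ℝ E] {f : ℝ → E}
    (sf : ContDiff ℝ ∞ f) {t₀ : ℝ} (h0 : deriv f t₀ ≠ 0) :
    ∃ r, 0 < r ∧ (∀ t ∈ Set.Icc (t₀ - r) (t₀ + r), deriv f t ≠ 0) ∧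
      ∀ s ∈ Set.Icc (t₀ - r) (t₀ + r), ∀ t ∈ Set.Icc (t₀ - r) (t₀ + r),
        ‖f t - f s - (t - s) • deriv f t₀‖ ≤ ‖deriv f t₀‖ / 2 * |t - s| := by
  have hpos := norm_pos_iff.2 h0
  have hcont : Continuous fun t => ‖deriv f t - deriv f t₀‖ :=
    ((contDiff_deriv_of_smooth sf).continuous.sub continuous_const).norm
  have ev : ∀ᶠ t in nhds t₀, ‖deriv f t - deriv f t₀‖ < ‖deriv f t₀‖ / 2 := by
    refine hcont.continuousAt.eventually (gt_mem_nhds ?_)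
    simp only [sub_self, norm_zero]
    positivity
  obtain ⟨r, hr, hball⟩ := Metric.nhds_basis_closedBall.eventually_iff.1 ev
  have hb : ∀ t ∈ Set.Icc (t₀ - r) (t₀ + r), ‖deriv f t - deriv f t₀‖ < ‖deriv f t₀‖ / 2 :=
    fun t ht => hball (by
      rw [Metric.mem_closedBall, Real.dist_eq, abs_le]
      constructor <;> linarith [ht.1, ht.2])
  refine ⟨r, hr, fun t ht hc => ?_, fun s hs t ht =>
    norm_sub_sub_smul_le (sf.differentiable (by simp)) (fun t ht => (hb t ht).le) hs ht⟩
  have := hb t ht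
  rw [hc, zero_sub, norm_neg] at this
  linarith

/-- A small vertical isotopy near a point at which neither the height nor the projection is
critical creates two critical points of the height. -/
lemma IsLinkData.exists_two_more_critical {p : Fin k → ℝ → ℂ} {h : Fin k → ℝ → ℝ}
    (H : IsLinkData p h) (hm : ∀ i, IsMorse (h i)) {i₀ : Fin k} {t₀ : ℝ}
    (hp0 : deriv (p i₀) t₀ ≠ 0) (hv : 0 < deriv (h i₀) t₀) :
    ∃ h' : Fin k → ℝ → ℝ, Isotopic Set.univ (curve p h) (curve p h') ∧ (∀ i, IsMorse (h' i)) ∧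
      (criticalSet h').encard = (criticalSet h).encard + 2 := by
  obtain ⟨f, sf, fid, w, hw0, hw1, hzero, hnd⟩ := exists_fold
  obtain ⟨M, hM⟩ : ∃ M, ∀ u, |f u - u| ≤ M := by
    have hc : Continuous fun u => |f u - u| := (sf.continuous.sub continuous_id).abs
    obtain ⟨x, -, hx⟩ := (isCompact_Icc (a := (-1 : ℝ)) (b := 1)).exists_isMaxOn
      (Set.nonempty_Icc.2 (by norm_num)) hc.continuousOn
    refine ⟨|f x - x|, fun u => ?_⟩
    rcases le_or_gt 1 |u| with hu | hu
    · rw [fid u hu, sub_self, abs_zero]; exact abs_nonneg _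
    · exact hx ⟨(abs_lt.1 hu).1.le, (abs_lt.1 hu).2.le⟩
  have hM0 : 0 ≤ M := (abs_nonneg _).trans (hM 0)
  -- an arc on which both the projection and the height are bilipschitz
  obtain ⟨r₁, hr₁, hpd, hpb⟩ := exists_bilipschitz (H.smooth_p i₀) hp0
  obtain ⟨r₂, hr₂, hhd, hhb⟩ := exists_bilipschitz (H.smooth_h i₀) hv.ne'
  set r := min (min r₁ r₂) (1 / 4) with hr_def
  have hr : 0 < r := by positivity
  have hr4 : r ≤ 1 / 4 := min_le_right _ _
  have s₁ : Set.Icc (t₀ - r) (t₀ + r) ⊆ Set.Icc (t₀ - r₁) (t₀ + r₁) := by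
    have : r ≤ r₁ := (min_le_left _ _).trans (min_le_left _ _)
    exact Set.Icc_subset_Icc (by linarith) (by linarith)
  have s₂ : Set.Icc (t₀ - r) (t₀ + r) ⊆ Set.Icc (t₀ - r₂) (t₀ + r₂) := by
    have : r ≤ r₂ := (min_le_left _ _).trans (min_le_right _ _)
    exact Set.Icc_subset_Icc (by linarith) (by linarith)
  have m₀ : t₀ ∈ Set.Icc (t₀ - r) (t₀ + r) := ⟨by linarith, by linarith⟩
  set A := ‖deriv (p i₀) t₀‖ with hA
  set v := deriv (h i₀) t₀ with hv_def
  have hApos : 0 < A := norm_pos_iff.2 hp0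
  set y₀ := h i₀ t₀ with hy₀
  have pinj : ∀ s ∈ Set.Icc (t₀ - r) (t₀ + r), ∀ t ∈ Set.Icc (t₀ - r) (t₀ + r),
      p i₀ s = p i₀ t → s = t := by
    intro s hs t ht he
    have := hpb s (s₁ hs) t (s₁ ht)
    rw [he, sub_self, zero_sub, norm_neg, norm_smul, Real.norm_eq_abs] at this
    by_contra hne
    have : 0 < |t - s| := abs_pos.2 (sub_ne_zero.2 (Ne.symm hne))
    nlinarith
  have pup : ∀ t ∈ Set.Icc (t₀ - r) (t₀ + r), ‖p i₀ t - p i₀ t₀‖ ≤ 2 * A * |t - t₀| := by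
    intro t ht
    have h1 := hpb t₀ (s₁ m₀) t (s₁ ht)
    have h2 := norm_sub_norm_le (p i₀ t - p i₀ t₀) ((t - t₀) • deriv (p i₀) t₀)
    rw [norm_smul, Real.norm_eq_abs] at h2
    have := abs_nonneg (t - t₀)
    nlinarith
  have hmono : ∀ s ∈ Set.Icc (t₀ - r) (t₀ + r), ∀ t ∈ Set.Icc (t₀ - r) (t₀ + r), s ≤ t →
      v / 2 * (t - s) ≤ h i₀ t - h i₀ s := by
    intro s hs t ht hst
    have := hhb s (s₂ hs) t (s₂ ht)
    rw [Real.norm_eq_abs, smul_eq_mul, abs_of_nonneg (sub_nonneg.2 hst), Real.norm_eq_abs,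
      abs_of_pos hv] at this
    have := (abs_le.1 this).1
    linarith
  have hup : ∀ t ∈ Set.Icc (t₀ - r) (t₀ + r), v / 2 * |t - t₀| ≤ |h i₀ t - y₀| := by
    intro t ht
    rcases le_total t₀ t with hle | hle
    · rw [abs_of_nonneg (sub_nonneg.2 hle)]
      exact (hmono t₀ m₀ t ht hle).trans (le_abs_self _)
    · rw [abs_sub_comm, abs_of_nonneg (sub_nonneg.2 hle), abs_sub_comm]
      exact (hmono t ht t₀ m₀ hle).trans (le_abs_self _)
  -- a ball that meets the link in this arc only
  let X : Fin k → ℝ → ℂ × ℝ := fun i t => (p i t, h i t)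
  have sX : ∀ i, ContDiff ℝ ∞ (X i) := fun i => (H.smooth_p i).prodMk (H.smooth_h i)
  have pX : ∀ i, Function.Periodic (X i) 1 := fun i t => by
    simp only [X, H.periodic_p i t, H.periodic_h i t]
  obtain ⟨ρ, hρ, hball⟩ := exists_gap (R := fun j s => dist (X j s) (X i₀ t₀)) (i₀ := i₀)
    (u := t₀ - r) (v := t₀ + r) (c := 0)
    (fun j => (sX j).continuous.dist continuous_const)
    (fun j t => by simp only [pX j t]) (by linarith) (by linarith) (by
      intro j s hout
      by_contra hc
      have h0 : X j s = X i₀ t₀ := dist_eq_zero.1 (le_antisymm (not_lt.1 hc) dist_nonneg)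
      obtain ⟨hj, m, hm⟩ := H.injective j i₀ s t₀ (congrArg Prod.fst h0) (congrArg Prod.snd h0)
      exact hout ⟨m, hj, by rw [← hm]; constructor <;> linarith⟩)
  simp only [zero_add] at hball
  let χ : ContDiffBump (X i₀ t₀) := ⟨ρ / 4, ρ / 2, by linarith, by linarith⟩
  -- the scale of the fold
  obtain ⟨δ, hδ, hδ1, hδ2, hδ3, hδ4⟩ : ∃ δ, 0 < δ ∧ δ * M < ρ / 2 ∧ δ ≤ v / 2 * r ∧ δ < ρ / 4 ∧
      4 * A / v * δ < ρ / 4 := by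
    -- The first bound keeps displacements below `ρ / 2`. The second makes the arc cover all heights
    -- within `δ` of `y₀`. The last two put the part of the arc at these heights into the ball where
    -- the cutoff is `1`.
    have t1 : Filter.Tendsto (fun δ : ℝ => δ * M) (nhds 0) (nhds 0) := by
      have := (show Continuous fun δ : ℝ => δ * M by fun_prop).tendsto 0
      rwa [zero_mul] at this
    have t2 : Filter.Tendsto (fun δ : ℝ => 4 * A / v * δ) (nhds 0) (nhds 0) := by
      have := (show Continuous fun δ : ℝ => 4 * A / v * δ by fun_prop).tendsto 0
      rwa [mul_zero] at this
    have e1 := t1.eventually (gt_mem_nhds (show (0 : ℝ) < ρ / 2 by linarith))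
    have e2 := t2.eventually (gt_mem_nhds (show (0 : ℝ) < ρ / 4 by linarith))
    have e3 : ∀ᶠ δ : ℝ in nhds 0, δ < v / 2 * r := gt_mem_nhds (by positivity)
    have e4 : ∀ᶠ δ : ℝ in nhds 0, δ < ρ / 4 := gt_mem_nhds (by positivity)
    obtain ⟨δ, ⟨⟨h1, h2⟩, h3, h4⟩, h5⟩ :=
      ((((e1.and e2).and (e3.and e4)).filter_mono nhdsWithin_le_nhds).and
        (self_mem_nhdsWithin (s := Set.Ioi (0 : ℝ)))).exists
    exact ⟨δ, h5, h1, h3.le, h4, h2⟩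
  let ψ : ℝ → ℝ := fun y => y₀ + δ * f ((y - y₀) / δ)
  have sψ : ContDiff ℝ ∞ ψ := contDiff_const.add
    (contDiff_const.mul (sf.comp ((contDiff_id.sub contDiff_const).div_const δ)))
  have ψid : ∀ y, δ ≤ |y - y₀| → ψ y = y := fun y hy => by
    simp only [ψ]
    rw [fid _ (by rw [abs_div, abs_of_pos hδ, one_le_div hδ]; exact hy)]
    field_simp
    ring
  have ψnear : ∀ y, |ψ y - y| < ρ / 2 := fun y => by
    have : ψ y - y = δ * (f ((y - y₀) / δ) - (y - y₀) / δ) := by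
      simp only [ψ]; field_simp; ring
    rw [this, abs_mul, abs_of_pos hδ]
    exact (mul_le_mul_of_nonneg_left (hM _) hδ.le).trans_lt hδ1
  let G : ℂ × ℝ → ℝ := fun x => χ x * (ψ x.2 - x.2)
  have sG : ContDiff ℝ ∞ G := χ.contDiff.mul ((sψ.comp contDiff_snd).sub contDiff_snd)
  have G0 : ∀ x, ρ / 2 ≤ dist x (X i₀ t₀) → G x = 0 := fun x hx => by
    simp only [G, χ.zero_of_le_dist hx, zero_mul]
  have Gsmall : ∀ x, |G x| < ρ / 2 := fun x => by
    simp only [G]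
    rw [abs_mul, abs_of_nonneg χ.nonneg]
    exact (mul_le_of_le_one_left (abs_nonneg _) χ.le_one).trans_lt (ψnear _)
  let h' : Fin k → ℝ → ℝ := fun i t => h i t + G (X i t)
  have sh' : ∀ i, ContDiff ℝ ∞ (h' i) := fun i => (H.smooth_h i).add (sG.comp (sX i))
  have ph' : ∀ i, Function.Periodic (h' i) 1 := fun i t => by
    simp only [h', H.periodic_h i t, pX i t]
  have harc : ∀ t ∈ Set.Icc (t₀ - r) (t₀ + r), h' i₀ t = ψ (h i₀ t) := by
    intro t ht
    simp only [h', G]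
    rcases le_or_gt δ |h i₀ t - y₀| with hd | hd
    · simp only [X, ψid _ hd, sub_self, mul_zero, add_zero]
    · have hχ : χ (X i₀ t) = 1 := by
        refine χ.one_of_mem_closedBall ?_
        rw [Metric.mem_closedBall, Prod.dist_eq]
        refine max_le ?_ ?_
        · have h1 := hup t ht
          have h2 : |t - t₀| ≤ 2 / v * δ := by
            rw [div_mul_eq_mul_div, le_div_iff₀ hv]; nlinarith
          change dist (p i₀ t) (p i₀ t₀) ≤ ρ / 4
          rw [dist_eq_norm]
          calc _ ≤ 2 * A * |t - t₀| := pup t ht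
            _ ≤ 2 * A * (2 / v * δ) := by gcongr
            _ = 4 * A / v * δ := by ring
            _ ≤ _ := hδ4.le
        · change dist (h i₀ t) y₀ ≤ ρ / 4
          rw [Real.dist_eq]
          linarith
      rw [hχ]
      simp only [X]
      ring
  have hfar : ∀ (i : Fin k) (t : ℝ), (¬∃ m : ℤ, i = i₀ ∧ t + m ∈ Set.Ioo (t₀ - r) (t₀ + r)) →
      h' i =ᶠ[nhds t] h i := by
    intro i t hout
    have hd : ρ < dist (X i t) (X i₀ t₀) := by
      by_contra hc
      obtain ⟨m, hi, hmem⟩ := hball i t (not_lt.1 hc)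
      exact hout ⟨m, hi, hmem⟩
    have hc : Continuous fun s => dist (X i s) (X i₀ t₀) :=
      (sX i).continuous.dist continuous_const
    filter_upwards [hc.continuousAt.eventually (lt_mem_nhds hd)] with s hs
    simp only [h', G0 (X i s) (by linarith), add_zero]
  have dnear : ∀ t ∈ Set.Ioo (t₀ - r) (t₀ + r),
      deriv (h' i₀) t = deriv f ((h i₀ t - y₀) / δ) * deriv (h i₀) t := by
    intro t ht
    have hev : h' i₀ =ᶠ[nhds t] fun s => ψ (h i₀ s) := by
      filter_upwards [Ioo_mem_nhds ht.1 ht.2] with s hs using harc s ⟨hs.1.le, hs.2.le⟩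
    have d1 := ((H.hasDerivAt_h i₀ t).sub_const y₀).div_const δ
    have d2 := (((sf.differentiable (by simp) _).hasDerivAt.comp t d1).const_mul δ).const_add y₀
    rw [hev.deriv_eq]
    refine (HasDerivAt.deriv d2).trans ?_
    field_simp
  -- the new critical points
  have hτ : ∀ c, |c| < 1 → ∃ τ ∈ Set.Ioo (t₀ - r) (t₀ + r), h i₀ τ = y₀ + δ * c := by
    intro c hc
    have hc' := abs_lt.1 hc
    have ml : t₀ - r ∈ Set.Icc (t₀ - r) (t₀ + r) := ⟨le_rfl, by linarith⟩
    have mr : t₀ + r ∈ Set.Icc (t₀ - r) (t₀ + r) := ⟨by linarith, le_rfl⟩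
    have e1 := hmono _ ml _ m₀ (by linarith)
    have e2 := hmono _ m₀ _ mr (by linarith)
    have := intermediate_value_Ioo (show t₀ - r ≤ t₀ + r by linarith)
      (H.smooth_h i₀).continuous.continuousOn
    exact this ⟨by nlinarith, by nlinarith⟩
  obtain ⟨τ₁, mτ₁, hτ₁⟩ := hτ w (by rw [abs_of_pos hw0]; exact hw1)
  obtain ⟨τ₂, mτ₂, hτ₂⟩ := hτ (-w) (by rw [abs_neg, abs_of_pos hw0]; exact hw1)
  have hinj : ∀ s ∈ Set.Ioo (t₀ - r) (t₀ + r), ∀ t ∈ Set.Ioo (t₀ - r) (t₀ + r),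
      h i₀ s = h i₀ t → s = t := by
    intro s hs t ht he
    rcases le_total s t with hle | hle
    · have := hmono s ⟨hs.1.le, hs.2.le⟩ t ⟨ht.1.le, ht.2.le⟩ hle
      nlinarith
    · have := hmono t ⟨ht.1.le, ht.2.le⟩ s ⟨hs.1.le, hs.2.le⟩ hle
      nlinarith
  have hhne : ∀ t ∈ Set.Ioo (t₀ - r) (t₀ + r), deriv (h i₀) t ≠ 0 :=
    fun t ht => hhd t (s₂ ⟨ht.1.le, ht.2.le⟩)
  have hcrit : ∀ t ∈ Set.Ioo (t₀ - r) (t₀ + r), deriv (h' i₀) t = 0 ↔ t = τ₁ ∨ t = τ₂ := by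
    intro t ht
    rw [dnear t ht, mul_eq_zero_iff_right (hhne t ht), hzero]
    refine or_congr ⟨fun he => hinj t ht τ₁ mτ₁ ?_, fun he => ?_⟩
      ⟨fun he => hinj t ht τ₂ mτ₂ ?_, fun he => ?_⟩
    · rw [hτ₁, ← he]; field_simp; ring
    · rw [he, hτ₁]; field_simp; ring
    · rw [hτ₂, ← he]; field_simp; ring
    · rw [he, hτ₂]; field_simp; ring
  have hτne : τ₁ ≠ τ₂ := by
    rintro rfl
    nlinarith
  refine ⟨h', H.isotopic_vertical sh' ph' ?_ ?_, ?_, ?_⟩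
  · intro i j s t he hlt
    have hGs := abs_lt.1 (Gsmall (X i s))
    have hGt := abs_lt.1 (Gsmall (X j t))
    have hdist : dist (X i s) (X j t) = h j t - h i s := by
      rw [Prod.dist_eq]
      simp only [X, he, dist_self]
      rw [Real.dist_eq, abs_sub_comm, abs_of_pos (sub_pos.2 hlt), max_eq_right (by linarith)]
    simp only [h']
    -- Two points in the ball of radius `ρ` would lie on the arc, where the projection is injective.
    -- Otherwise at most one of them moves, and then only if it is within `ρ / 2` of the centre; its
    -- vertical distance to the other exceeds `ρ / 2`, hence the displacement.
    rcases le_or_gt (dist (X i s) (X i₀ t₀)) ρ with h1 | h1 <;>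
      rcases le_or_gt (dist (X j t) (X i₀ t₀)) ρ with h2 | h2
    · obtain ⟨m, rfl, hm1⟩ := hball i s h1
      obtain ⟨l, rfl, hm2⟩ := hball j t h2
      have := pinj _ ⟨hm1.1.le, hm1.2.le⟩ _ ⟨hm2.1.le, hm2.2.le⟩
        (by rw [periodic_add_int (H.periodic_p _), periodic_add_int (H.periodic_p _), he])
      have e := congrArg (h j) this
      rw [periodic_add_int (H.periodic_h _), periodic_add_int (H.periodic_h _)] at e
      exact absurd e hlt.ne
    · rw [G0 (X j t) (by linarith)]
      rcases le_or_gt (ρ / 2) (dist (X i s) (X i₀ t₀)) with h3 | h3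
      · rw [G0 _ h3]; linarith
      · have := dist_triangle_left (X j t) (X i₀ t₀) (X i s)
        linarith
    · rw [G0 (X i s) (by linarith)]
      rcases le_or_gt (ρ / 2) (dist (X j t) (X i₀ t₀)) with h3 | h3
      · rw [G0 _ h3]; linarith
      · have := dist_triangle (X i s) (X j t) (X i₀ t₀)
        linarith
    · rw [G0 (X i s) (by linarith), G0 (X j t) (by linarith)]; linarith
  · intro i t h0
    have hout : ¬∃ m : ℤ, i = i₀ ∧ t + m ∈ Set.Ioo (t₀ - r) (t₀ + r) := by
      rintro ⟨m, rfl, hm⟩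
      refine hpd _ (s₁ ⟨hm.1.le, hm.2.le⟩) ?_
      rw [periodic_add_int (periodic_deriv (H.periodic_p _)), h0]
    rw [(hfar i t hout).deriv_eq]
    exact mul_self_pos.2 (H.immersion i t h0)
  · intro i t h0
    by_cases hin : ∃ m : ℤ, i = i₀ ∧ t + m ∈ Set.Ioo (t₀ - r) (t₀ + r)
    · obtain ⟨m, rfl, hmem⟩ := hin
      rw [← periodic_add_int (periodic_deriv (periodic_deriv (ph' i))) t m]
      rw [← periodic_add_int (periodic_deriv (ph' i)) t m] at h0
      set s := t + m
      have hev : deriv (h' i) =ᶠ[nhds s]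
          fun s => deriv f ((h i s - y₀) / δ) * deriv (h i) s := by
        filter_upwards [Ioo_mem_nhds hmem.1 hmem.2] with x hx using dnear x hx
      have hf0 : deriv f ((h i s - y₀) / δ) = 0 := by
        rw [dnear s hmem] at h0
        exact (mul_eq_zero_iff_right (hhne s hmem)).1 h0
      have d1 := ((H.hasDerivAt_h i s).sub_const y₀).div_const δ
      have d2 := (((contDiff_deriv_of_smooth sf).differentiable (by simp) _).hasDerivAt.comp s d1).mul
        ((contDiff_deriv_of_smooth (H.smooth_h i)).differentiable (by simp) s).hasDerivAt
      have e : deriv (fun s => deriv f ((h i s - y₀) / δ) * deriv (h i) s) s = _ := d2.deriv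
      rw [hev.deriv_eq, e]
      simp only [Function.comp_apply, hf0, zero_mul, add_zero]
      have := hhne s hmem
      exact mul_ne_zero (mul_ne_zero (hnd _ hf0) (div_ne_zero this hδ.ne')) this
    · have := hfar i t hin
      rw [this.deriv.deriv_eq]
      rw [this.deriv_eq] at h0
      exact hm i t h0
  · have hfr : ∀ t τ : ℝ, t ∈ Set.Ico (0 : ℝ) 1 → ((∃ m : ℤ, t + m = τ) ↔ t = Int.fract τ) := by
      intro t τ ht
      constructor
      · rintro ⟨m, rfl⟩
        rw [Int.fract_add_intCast, Int.fract_eq_self.2 ht]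
      · rintro rfl
        exact ⟨⌊τ⌋, Int.fract_add_floor τ⟩
    have hτfr : ∀ τ ∈ Set.Ioo (t₀ - r) (t₀ + r), (i₀, Int.fract τ) ∉ criticalSet h := by
      rintro τ hτ ⟨-, h0⟩
      refine hhne τ hτ ?_
      rw [← Int.fract_add_floor τ, periodic_add_int (periodic_deriv (H.periodic_h i₀))]
      exact h0
    have hset : criticalSet h' = insert (i₀, Int.fract τ₁) (insert (i₀, Int.fract τ₂)
        (criticalSet h)) := by
      ext ⟨i, t⟩
      by_cases ht : t ∈ Set.Ico (0 : ℝ) 1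
      swap
      · have h1 : ∀ τ, t ≠ Int.fract τ := fun τ he => ht (he ▸ ⟨Int.fract_nonneg τ, Int.fract_lt_one τ⟩)
        simp [criticalSet, -Set.mem_Ico, ht, h1]
      simp only [Set.mem_insert_iff, Prod.mk.injEq, ← hfr t _ ht]
      by_cases hin : ∃ m : ℤ, i = i₀ ∧ t + m ∈ Set.Ioo (t₀ - r) (t₀ + r)
      · obtain ⟨m, rfl, hmem⟩ := hin
        have hnot : (i, t) ∉ criticalSet h := by
          rw [(hfr t _ ht).1 ⟨m, rfl⟩]
          exact hτfr _ hmem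
        have huniq : ∀ τ ∈ Set.Ioo (t₀ - r) (t₀ + r), (∃ l : ℤ, t + l = τ) ↔ t + m = τ := by
          intro τ hτ
          refine ⟨?_, fun he => ⟨m, he⟩⟩
          rintro ⟨l, rfl⟩
          have e1 : (m : ℝ) < l + 1 := by linarith [hτ.1, hmem.2]
          have e2 : (l : ℝ) < m + 1 := by linarith [hτ.2, hmem.1]
          have : m = l := by
            have e1' : m < l + 1 := by exact_mod_cast e1
            have e2' : l < m + 1 := by exact_mod_cast e2
            omega
          rw [this]
        simp only [hnot, or_false, true_and, huniq τ₁ mτ₁, huniq τ₂ mτ₂, ← hcrit _ hmem]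
        simp only [criticalSet, Set.mem_ofPred_eq, ht, true_and]
        rw [periodic_add_int (periodic_deriv (ph' i))]
      · have h1 : ∀ τ ∈ Set.Ioo (t₀ - r) (t₀ + r), ¬(i = i₀ ∧ ∃ m : ℤ, t + m = τ) := by
          rintro τ hτ ⟨hi, m, rfl⟩
          exact hin ⟨m, hi, hτ⟩
        simp only [h1 τ₁ mτ₁, h1 τ₂ mτ₂, false_or]
        simp only [criticalSet, Set.mem_ofPred_eq, (hfar i t hin).deriv_eq]
    have hne : (i₀, Int.fract τ₁) ≠ (i₀, Int.fract τ₂) := by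
      intro he
      obtain ⟨z, hz⟩ := Int.fract_eq_fract.1 (Prod.mk.inj he).2
      have e1 : (z : ℝ) < 1 := by linarith [mτ₁.2, mτ₂.1]
      have e2 : (-1 : ℝ) < z := by linarith [mτ₁.1, mτ₂.2]
      have : z = 0 := by
        have e1' : z < 1 := by exact_mod_cast e1
        have e2' : -1 < z := by exact_mod_cast e2
        omega
      rw [this, Int.cast_zero, sub_eq_zero] at hz
      exact hτne hz
    rw [hset, Set.encard_insert_of_notMem, Set.encard_insert_of_notMem (hτfr τ₂ mτ₂), add_assoc]
    · rfl
    · rw [Set.mem_insert_iff]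
      rintro (he | he)
      · exact hne he
      · exact hτfr τ₁ mτ₁ he

/-- Just before a maximum the height increases, and the projection is regular there because it is so
at the maximum, where the height is stationary. A fold can be inserted at such a point. -/
lemma IsLinkData.exists_critical_succ {p : Fin k → ℝ → ℂ} {h : Fin k → ℝ → ℝ}
    (D : IsLinkData p h) (hm : ∀ i, IsMorse (h i)) {d : ℕ}
    (hd : (criticalSet h).encard = 2 * ((d + 1 : ℕ) : ℕ∞)) :
    ∃ h' : Fin k → ℝ → ℝ, Isotopic Set.univ (curve p h) (curve p h') ∧ (∀ i, IsMorse (h' i)) ∧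
      (criticalSet h').encard = 2 * ((d + 1 + 1 : ℕ) : ℕ∞) := by
  obtain ⟨i, b, hb⟩ := exists_localMax D hm hd
  obtain ⟨hb0, hb2⟩ := (isLocalMax_iff (D.smooth_h i) (hm i) b).1 hb
  obtain ⟨a, hab, -, -, hpos⟩ := exists_prev_min (D.smooth_h i) (D.periodic_h i) (hm i) hb0 hb2
  have hp : deriv (p i) b ≠ 0 := fun h0 => D.immersion i b h0 hb0
  have e1 : ∀ᶠ t in nhdsWithin b (Set.Iio b), deriv (p i) t ≠ 0 :=
    ((contDiff_deriv_of_smooth (D.smooth_p i)).continuous.continuousAt.eventually_ne hp).filter_mono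
      nhdsWithin_le_nhds
  obtain ⟨t, ht, htab⟩ := (e1.and (Ioo_mem_nhdsLT hab)).exists
  obtain ⟨h', iso, hm', hc⟩ := D.exists_two_more_critical hm ht (hpos t htab)
  refine ⟨h', iso, hm', ?_⟩
  rw [hc, hd]
  push_cast
  ring

lemma IsLinkData.exists_critical_add {p : Fin k → ℝ → ℂ} {h : Fin k → ℝ → ℝ}
    (D : IsLinkData p h) (hm : ∀ i, IsMorse (h i)) {d : ℕ}
    (hd : (criticalSet h).encard = 2 * ((d + 1 : ℕ) : ℕ∞)) (n : ℕ) :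
    ∃ h' : Fin k → ℝ → ℝ, Isotopic Set.univ (curve p h) (curve p h') ∧ (∀ i, IsMorse (h' i)) ∧
      (criticalSet h').encard = 2 * ((d + 1 + n : ℕ) : ℕ∞) := by
  induction n with
  | zero => exact ⟨h, ⟨fun _ => curve p h, fun i => (isLink_curve_iff.2 D).smooth i |>.comp contDiff_snd,
      fun _ => isLink_curve_iff.2 D, rfl, rfl⟩, hm, hd⟩
  | succ n ih =>
    obtain ⟨h₁, iso₁, hm₁, hd₁⟩ := ih
    obtain ⟨h₂, iso₂, hm₂, hd₂⟩ := iso₁.isLinkData_right.exists_critical_succ hm₁ (d := d + n)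
      (by rw [hd₁, add_right_comm])
    exact ⟨h₂, iso₁.trans iso₂, hm₂, by rw [hd₂, add_right_comm d n 1, add_assoc (d + 1)]⟩

/-! ### Booklinks without critical points -/

/-- The number of parameters in a period at which a monotone lift of the angle meets a given
angle modulo `2 * π`. -/
lemma encard_level {φ : ℝ → ℝ} (hc : Continuous φ) (hm : StrictMono φ) {w : ℤ}
    (hw : ∀ t, φ (t + 1) = φ t + w) (θ : ℝ) :
    {t : ℝ | t ∈ Set.Ico (0 : ℝ) 1 ∧ ∃ m : ℤ, φ t = θ + m}.encard = (w.toNat : ℕ∞) := by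
  have h01 : φ 1 = φ 0 + w := by simpa using hw 0
  have hinj : Set.InjOn (fun t => ⌊φ t - θ⌋) {t : ℝ | t ∈ Set.Ico (0 : ℝ) 1 ∧ ∃ m : ℤ, φ t = θ + m} := by
    rintro s ⟨-, a, ha⟩ t ⟨-, b, hb⟩ he
    simp only [ha, hb, add_sub_cancel_left, Int.floor_intCast] at he
    exact hm.injective (by rw [ha, hb, he])
  rw [← hinj.encard_image]
  -- On the level set the floor recovers the integer `m`. The values that occur are the integers of
  -- a half-open interval of length `w`, because the period is half-open.
  have : (fun t => ⌊φ t - θ⌋) '' {t : ℝ | t ∈ Set.Ico (0 : ℝ) 1 ∧ ∃ m : ℤ, φ t = θ + m} =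
      Set.Ico ⌈φ 0 - θ⌉ (⌈φ 0 - θ⌉ + w) := by
    ext m
    constructor
    · rintro ⟨t, ⟨⟨h0, h1⟩, a, ha⟩, rfl⟩
      simp only [ha, add_sub_cancel_left, Int.floor_intCast]
      refine ⟨Int.ceil_le.2 ?_, ?_⟩
      · have := hm.monotone h0
        linarith
      · rw [← Int.ceil_add_intCast, Int.lt_ceil]
        have := hm h1
        linarith
    · rintro ⟨h0, h1⟩
      rw [Int.ceil_le] at h0
      rw [← Int.ceil_add_intCast, Int.lt_ceil] at h1
      obtain ⟨t, ht, hte⟩ := intermediate_value_Ico (zero_le_one' ℝ) hc.continuousOn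
        (show θ + m ∈ Set.Ico (φ 0) (φ 1) from ⟨by linarith, by linarith⟩)
      exact ⟨t, ⟨ht, m, hte⟩, by simp [hte]⟩
  rw [this, ← Finset.coe_Ico, Set.encard_coe_eq_coe_finsetCard, Int.card_Ico, add_sub_cancel_left]

/-- The imaginary part of the integral of `q' / q`, started at `log (q 0)`, is a continuous angle.
It is measured in full turns, so the increment over a period is the winding number `w`. -/
lemma exists_angle_lift {q : ℝ → ℂ} (sq : ContDiff ℝ ∞ q) (pq : Function.Periodic q 1)
    (h0 : ∀ t, q t ≠ 0) :
    ∃ (φ : ℝ → ℝ) (w : ℤ), (∀ t, HasDerivAt φ ((deriv q t / q t).im / (2 * Real.pi)) t) ∧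
      (∀ t, q t = ‖q t‖ * Complex.exp (2 * Real.pi * φ t * Complex.I)) ∧
      ∀ t, φ (t + 1) = φ t + w := by
  have dq : ∀ t, HasDerivAt q (deriv q t) t := fun t => (sq.differentiable (by simp) t).hasDerivAt
  have hc : Continuous fun t => deriv q t / q t :=
    (contDiff_deriv_of_smooth sq).continuous.div sq.continuous h0
  let Φ : ℝ → ℂ := fun t => Complex.log (q 0) + ∫ s in (0 : ℝ)..t, deriv q s / q s
  have dΦ : ∀ t, HasDerivAt Φ (deriv q t / q t) t := fun t =>
    (intervalIntegral.integral_hasDerivAt_right (hc.intervalIntegrable _ _)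
      (hc.stronglyMeasurableAtFilter _ _) hc.continuousAt).const_add _
  have hexp : ∀ t, q t = Complex.exp (Φ t) := by
    intro t
    have hd : ∀ t, HasDerivAt (fun t => q t * Complex.exp (-Φ t)) 0 t := fun t =>
      ((dq t).mul (dΦ t).neg.cexp).congr_deriv (by field_simp [h0 t]; ring)
    have := is_const_of_deriv_eq_zero (fun t => (hd t).differentiableAt) (fun t => (hd t).deriv) t 0
    have e0 : Φ 0 = Complex.log (q 0) := by simp [Φ]
    rw [e0, Complex.exp_neg, Complex.exp_neg, Complex.exp_log (h0 0), mul_inv_cancel₀ (h0 0)] at this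
    exact (mul_inv_eq_one₀ (Complex.exp_ne_zero _)).1 this
  have dφ : ∀ t, HasDerivAt (fun t => (Φ t).im / (2 * Real.pi))
      ((deriv q t / q t).im / (2 * Real.pi)) t := fun t =>
    (Complex.imCLM.hasFDerivAt.comp_hasDerivAt t (dΦ t)).div_const _
  have hpi : (Real.pi : ℂ) ≠ 0 := Complex.ofReal_ne_zero.2 Real.pi_ne_zero
  obtain ⟨w, hw⟩ : ∃ w : ℤ, Φ 1 = Φ 0 + w * (2 * Real.pi * Complex.I) := by
    rw [← Complex.exp_eq_exp_iff_exists_int, ← hexp, ← hexp, ← pq 0, zero_add]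
  refine ⟨fun t => (Φ t).im / (2 * Real.pi), w, dφ, fun t => ?_, fun t => ?_⟩
  · rw [hexp t, Complex.norm_exp, Complex.ofReal_exp, ← Complex.exp_add]
    congr 1
    push_cast
    rw [mul_div_cancel₀ _ (by simp)]
    exact (Complex.re_add_im _).symm
  · have hd : ∀ t, HasDerivAt (fun t => (Φ (t + 1)).im / (2 * Real.pi) - (Φ t).im / (2 * Real.pi))
        0 t := fun t =>
      (((dφ (t + 1)).comp_add_const t 1).sub (dφ t)).congr_deriv (by
        rw [periodic_deriv pq t, pq t, sub_self])
    have := is_const_of_deriv_eq_zero (fun t => (hd t).differentiableAt) (fun t => (hd t).deriv) t 0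
    simp only [zero_add] at this
    have e : (Φ 1).im = (Φ 0).im + w * (2 * Real.pi) := by
      rw [hw]; simp
    have e2 : (Φ 1).im / (2 * Real.pi) - (Φ 0).im / (2 * Real.pi) = w := by
      rw [e]; field_simp; ring
    linarith

/-- The angular velocity keeps its sign, so the lifted angle is strictly monotone and passes every
angle as often as the absolute value of the winding number says; a decreasing angle is replaced by
its negative. -/
lemma exists_encard_ray {q : ℝ → ℂ} (sq : ContDiff ℝ ∞ q) (pq : Function.Periodic q 1)
    (h0 : ∀ t, q t ≠ 0) (hv : ∀ t, (deriv q t / q t).im ≠ 0) :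
    ∃ N : ℕ, ∀ θ : ℝ, {t : ℝ | t ∈ Set.Ico (0 : ℝ) 1 ∧
      ∃ r : ℝ, 0 < r ∧ q t = r * Complex.exp (θ * Complex.I)}.encard = N := by
  obtain ⟨φ, w, dφ, hφ, hw⟩ := exists_angle_lift sq pq h0
  have cφ : Continuous φ := (show Differentiable ℝ φ from fun t => (dφ t).differentiableAt).continuous
  have hpi := Real.pi_pos
  have key : ∀ θ t : ℝ, (∃ r : ℝ, 0 < r ∧ q t = r * Complex.exp (θ * Complex.I)) ↔
      ∃ m : ℤ, φ t = θ / (2 * Real.pi) + m := by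
    intro θ t
    have hn := norm_pos_iff.2 (h0 t)
    constructor
    · rintro ⟨r, hr, e⟩
      have hnr : ‖q t‖ = r := by
        rw [e, norm_mul, Complex.norm_exp_ofReal_mul_I, mul_one, Complex.norm_of_nonneg hr.le]
      rw [hφ t, hnr] at e
      have e1 := mul_left_cancel₀ (Complex.ofReal_ne_zero.2 hr.ne') e
      obtain ⟨m, hm⟩ := Complex.exp_eq_exp_iff_exists_int.1 e1
      refine ⟨m, ?_⟩
      have := congrArg Complex.im hm
      simp at this
      field_simp
      linarith
    · rintro ⟨m, hm⟩
      refine ⟨‖q t‖, hn, (hφ t).trans ?_⟩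
      congr 1
      refine Complex.exp_eq_exp_iff_exists_int.2 ⟨m, ?_⟩
      rw [hm]
      have : (Real.pi : ℂ) ≠ 0 := Complex.ofReal_ne_zero.2 hpi.ne'
      push_cast
      field_simp
  have hcont : Continuous fun t => (deriv q t / q t).im :=
    Complex.continuous_im.comp ((contDiff_deriv_of_smooth sq).continuous.div sq.continuous h0)
  simp only [key]
  rcases lt_or_gt_of_ne (hv 0) with hneg | hpos
  · have hall : ∀ t, (deriv q t / q t).im < 0 := by
      intro t
      by_contra hc
      obtain ⟨s, hs⟩ := mem_range_of_exists_le_of_exists_ge hcont ⟨0, hneg.le⟩ ⟨t, not_lt.1 hc⟩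
      exact hv s hs
    have hm : StrictMono fun t => -φ t := strictMono_of_deriv_pos fun t => by
      have : HasDerivAt (fun t => -φ t) _ t := (dφ t).neg
      rw [this.deriv, neg_pos]
      exact div_neg_of_neg_of_pos (hall t) (by positivity)
    refine ⟨(-w).toNat, fun θ => ?_⟩
    rw [← encard_level cφ.neg hm (w := -w) (fun t => by simp only [Pi.neg_apply]; rw [hw]; push_cast; ring)
      (-(θ / (2 * Real.pi)))]
    congr 1
    ext t
    refine and_congr_right fun _ => ⟨fun ⟨m, h⟩ => ⟨-m, ?_⟩, fun ⟨m, h⟩ => ⟨-m, ?_⟩⟩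
    · simp only [Pi.neg_apply]; rw [h]; push_cast; ring
    · simp only [Pi.neg_apply] at h; push_cast; linarith
  · have hall : ∀ t, 0 < (deriv q t / q t).im := by
      intro t
      by_contra hc
      obtain ⟨s, hs⟩ := mem_range_of_exists_le_of_exists_ge hcont ⟨t, not_lt.1 hc⟩ ⟨0, hpos.le⟩
      exact hv s hs
    have hm : StrictMono φ := strictMono_of_deriv_pos fun t => by
      rw [(dφ t).deriv]
      exact div_pos (hall t) (by positivity)
    exact ⟨w.toNat, fun θ => encard_level cφ hm hw _⟩

lemma encard_support_inter_page {γ : Fin k → ℝ → R3} (H : IsLink Set.univ γ) (θ : ℝ) :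
    (support γ ∩ page θ).encard = {p : Fin k × ℝ | p.2 ∈ Set.Ico (0 : ℝ) 1 ∧
      ∃ r : ℝ, 0 < r ∧ planar (γ p.1 p.2) = r * Complex.exp (θ * Complex.I)}.encard := by
  have hinj : Set.InjOn (fun p : Fin k × ℝ => γ p.1 p.2) {p : Fin k × ℝ | p.2 ∈ Set.Ico (0 : ℝ) 1 ∧
      ∃ r : ℝ, 0 < r ∧ planar (γ p.1 p.2) = r * Complex.exp (θ * Complex.I)} := by
    rintro ⟨i, s⟩ ⟨hs, -⟩ ⟨j, t⟩ ⟨ht, -⟩ he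
    obtain ⟨rfl, m, hm⟩ := H.injective i j s t he
    simp only at hs ht hm
    have e1 : (m : ℝ) < 1 := by linarith [hs.1, ht.2]
    have e2 : (-1 : ℝ) < m := by linarith [hs.2, ht.1]
    have : m = 0 := by
      have e1' : m < 1 := by exact_mod_cast e1
      have e2' : -1 < m := by exact_mod_cast e2
      omega
    rw [hm, this, Int.cast_zero, add_zero]
  rw [← hinj.encard_image]
  congr 1
  ext x
  constructor
  · rintro ⟨⟨i, t, rfl⟩, hx⟩
    obtain ⟨s, hs, e⟩ := (H.periodic i).exists_mem_Ico₀ one_pos t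
    rw [e] at hx ⊢
    exact ⟨(i, s), ⟨hs, mem_page_iff.1 hx⟩, rfl⟩
  · rintro ⟨⟨i, t⟩, ⟨-, hx⟩, rfl⟩
    exact ⟨⟨i, t, rfl⟩, mem_page_iff.2 hx⟩

lemma encard_sigma_eq {S : Fin k → Set ℝ} {N : Fin k → ℕ} (hS : ∀ i, (S i).encard = N i) :
    {p : Fin k × ℝ | p.2 ∈ S p.1}.encard = ((∑ i, N i : ℕ) : ℕ∞) := by
  have e : {p : Fin k × ℝ | p.2 ∈ S p.1} ≃ Σ i, S i :=
    ⟨fun p => ⟨p.1.1, p.1.2, p.2⟩, fun p => ⟨(p.1, p.2.1), p.2.2⟩, fun _ => rfl, fun _ => rfl⟩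
  have hfin : ∀ i, Finite (S i) := fun i =>
    (Set.finite_of_encard_eq_coe (hS i)).to_subtype
  have : ∀ i, Fintype (S i) := fun i => Fintype.ofFinite _
  change ENat.card _ = _
  rw [ENat.card_congr e, ENat.card_eq_coe_fintype_card, Fintype.card_sigma]
  congr 1
  refine Finset.sum_congr rfl fun i _ => ?_
  have h1 : ENat.card (S i) = N i := hS i
  rw [ENat.card_eq_coe_fintype_card] at h1
  exact_mod_cast h1

/-- Constancy of the number of strands in `IsClosedBraid` is automatic: each component contributes
the same number of points to all pages. -/
lemma exists_strands {γ : Fin k → ℝ → R3} (H : IsLink Set.univ γ)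
    (h0 : ∀ i t, planar (γ i t) ≠ 0) (hv : ∀ i t, angularVelocity (γ i) t ≠ 0) :
    ∃ m : ℕ, ∀ θ : ℝ, (support γ ∩ page θ).encard = m := by
  have : ∀ i, ∃ N : ℕ, ∀ θ : ℝ, {t : ℝ | t ∈ Set.Ico (0 : ℝ) 1 ∧
      ∃ r : ℝ, 0 < r ∧ planar (γ i t) = r * Complex.exp (θ * Complex.I)}.encard = N := fun i =>
    exists_encard_ray (contDiff_planar.comp (H.smooth i))
      (fun t => by simp only [H.periodic i t]) (h0 i) (hv i)
  choose N hN using this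
  exact ⟨∑ i, N i, fun θ => (encard_support_inter_page H θ).trans (encard_sigma_eq fun i => hN i θ)⟩

lemma IsBooklink.isClosedBraid {γ : Fin k → ℝ → R3} (H : IsBooklink γ 0) :
    ∃ m : ℕ, IsClosedBraid γ m := by
  have hv : ∀ i t, angularVelocity (γ i) t ≠ 0 := by
    intro i t h0
    have hp : Function.Periodic (angularVelocity (γ i)) 1 := fun t => by
      have h1 : Function.Periodic (fun s => planar (γ i s)) 1 := fun s => by
        simp only [H.isLink.periodic i s]
      simp only [angularVelocity]
      rw [periodic_deriv h1 t, H.isLink.periodic i t]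
    obtain ⟨s, hs, e⟩ := hp.exists_mem_Ico₀ one_pos t
    have := H.card_critical
    rw [Nat.cast_zero, mul_zero, Set.encard_eq_zero, Set.eq_empty_iff_forall_notMem] at this
    exact this (i, s) ⟨hs, e ▸ h0⟩
  obtain ⟨m, hm⟩ := exists_strands H.isLink H.off_axis hv
  exact ⟨m, H.isLink, H.off_axis, hv, hm⟩

lemma IsClosedBraid.isBooklink {γ : Fin k → ℝ → R3} {m : ℕ} (H : IsClosedBraid γ m) :
    IsBooklink γ 0 := by
  refine ⟨H.isLink, H.off_axis, fun i t h0 => absurd h0 (H.monotone i t), ?_⟩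
  rw [Nat.cast_zero, mul_zero, Set.encard_eq_zero, Set.eq_empty_iff_forall_notMem]
  exact fun q hq => H.monotone _ _ hq.2

lemma IsClosedBraid.pageNumber_eq {γ : Fin k → ℝ → R3} {m : ℕ} (H : IsClosedBraid γ m) :
    pageNumber γ = m := by
  simp only [pageNumber, H.strands, iInf_const]

/-- Booklinks with `d = 0` and closed braids are the same links, and on them the minimum over the
pages is the number of strands. -/
lemma spectrum_zero (L : Fin k → ℝ → R4) : spectrum L 0 = braidIndex L := by
  rw [spectrum, braidIndex]
  congr 1
  ext n
  constructor
  · rintro ⟨γ, hR, hB, rfl⟩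
    obtain ⟨m, hm⟩ := hB.isClosedBraid
    exact ⟨γ, m, hR, hm, hm.pageNumber_eq⟩
  · rintro ⟨γ, m, hR, hm, rfl⟩
    exact ⟨γ, hR, hm.isBooklink, hm.pageNumber_eq⟩

/-! ### The spectrum of two-bridge links -/

/-- A finite infimum in `ℕ∞` is attained; an empty set would have infimum `⊤`. -/
lemma exists_curve_of_bridgeIndex {L : Fin k → ℝ → R4} {b : ℕ} (hb : bridgeIndex L = b) :
    ∃ (p : Fin k → ℝ → ℂ) (h : Fin k → ℝ → ℝ), Represents (curve p h) L ∧
      (∀ i, IsMorse (h i)) ∧ (criticalSet h).encard = 2 * (b : ℕ∞) := by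
  have hne : {b : ℕ∞ | ∃ γ : Fin k → ℝ → R3,
      Represents γ L ∧ HeightMorse γ ∧ (heightMaxima γ).encard = b}.Nonempty := by
    by_contra he
    rw [bridgeIndex, Set.not_nonempty_iff_eq_empty.1 he, sInf_empty] at hb
    exact ENat.natCast_ne_top b hb.symm
  obtain ⟨γ, hR, hm, hc⟩ := csInf_mem hne
  rw [← bridgeIndex, hb] at hc
  obtain ⟨p, h, rfl⟩ : ∃ p h, γ = curve p h := ⟨_, _, (curve_coords γ).symm⟩
  have D := isLink_curve_iff.1 hR.isLink
  refine ⟨p, h, hR, hm, ?_⟩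
  rw [encard_criticalSet D.smooth_h D.periodic_h hm, ← hc]
  rfl

lemma bridgeIndex_le {L : Fin k → ℝ → R4} {p : Fin k → ℝ → ℂ} {h : Fin k → ℝ → ℝ}
    (HL : Represents (curve p h) L) (hm : ∀ i, IsMorse (h i)) {b : ℕ}
    (hc : (criticalSet h).encard = 2 * (b : ℕ∞)) : bridgeIndex L ≤ b := by
  have D := isLink_curve_iff.1 HL.isLink
  rw [encard_criticalSet D.smooth_h D.periodic_h hm] at hc
  refine sInf_le ⟨curve p h, HL, hm, ?_⟩
  have := ENat.mul_right_strictMono (a := 2) (by simp) (by simp) |>.injective hc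
  exact this

end BridgeBraid

end

theorem corollary5p3 {k : ℕ} (L : Fin k → ℝ → BridgeBraid.R4)
    (hL : BridgeBraid.IsLink BridgeBraid.S3 L)
    (hbridge : BridgeBraid.bridgeIndex L = 2)
    (n : ℕ) (hbraid : BridgeBraid.braidIndex L = n) :
    BridgeBraid.spectrum L 0 = n ∧
      BridgeBraid.spectrum L 1 = 1 ∧
      ∀ d : ℕ, 2 ≤ d → BridgeBraid.spectrum L d = 0 := by
  open BridgeBraid in
  obtain ⟨p, h, HL, hm, hc⟩ := exists_curve_of_bridgeIndex (b := 2) hbridge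
  have D := isLink_curve_iff.1 HL.isLink
  refine ⟨(spectrum_zero L).trans hbraid, le_antisymm ?_ ?_, fun d hd => ?_⟩
  · obtain ⟨γ, hR, hB, hle⟩ := exists_booklink_of_height_succ HL hm (d := 1) hc
    have h1 : spectrum L 1 ≤ pageNumber γ := sInf_le ⟨γ, hR, hB, rfl⟩
    exact h1.trans hle
  · refine le_sInf ?_
    rintro _ ⟨γ, hR, hB, rfl⟩
    rw [Order.one_le_iff_ne_zero]
    intro h0
    -- A missed page would give a Morse position with a single maximum, against bridge index `2`.
    obtain ⟨p', h', iso, hm', hc'⟩ := exists_height_of_booklink hB h0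
    have := bridgeIndex_le (hR.of_isotopic iso) hm' hc'
    rw [hbridge] at this
    exact absurd this (by norm_num)
  -- A position with two maxima receives `d - 2` folds before it is wrapped around the axis.
  · obtain ⟨e, rfl⟩ := Nat.exists_eq_add_of_le hd
    obtain ⟨h', iso, hm', hc'⟩ := D.exists_critical_add hm (d := 1) hc e
    obtain ⟨γ, iso', hB, h0⟩ := exists_booklink_of_height iso.isLinkData_right hm' hc'
    exact le_antisymm (sInf_le ⟨γ, HL.of_isotopic (iso.trans iso'), hB, h0⟩) zero_le
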